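/- \textbf{Streaming dictionary matching for patterns with short periods.} Logarithms are to base $2$, and $\log m$ is rounded to the nearest integer. The period of a non-empty string $x$ is the least $p$ with $0<p\le |x|$ such that $x_i=x_{i+p}$ for all $1\le i\le |x|-p$. In the streaming dictionary matching problem for a set $\mathcal P$ of patterns, the characters of a text $T=t_1\dots t_n$ arrive one at a time, and after each arrival $t_x$, before the next one, the algorithm must answer whether some $P\in\mathcal P$ satisfies $t_{x-|P|+1}\dots t_x=P$. The model is the word RAM: a memory of words of $w$ bits, direct and indirect addressing, jumps on zero, and unit-cost arithmetic, bitwise and comparison operations on words. Space is the total number of words of memory. There are a fixed word-RAM program and absolute constants $C,c$ with the following property. Let $n\ge 1$ be a text length, let $\{0,\dots,\sigma-1\}$ be the alphabet, let $\mathcal P$ be a non-empty set of $k$ patterns over it of length at most $m$, and let the word length $w$ satisfy $2^w\ge (n+m+\sigma)^c$ (so $w=\Theta(\log n)$ suffices if $m$ and $\sigma$ are polynomial in $n$). Suppose that every $P\in\mathcal P$ has length $|P|\ge 2k\log m$, and that its prefix $Q$ of length $|P|-k\log m$ has period less than $k\log m$. Then there is a preprocessing, that is, a choice of the initial memory contents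 depending only on $n,m,\sigma,w,\mathcal P$ and on a random seed drawn uniformly from a finite non-empty set, such that the program uses at most $C\,k\log m$ words of memory in total (including everything precomputed), and for every text $T$ of length $n$ over the alphabet: (i) for every seed, each arriving character is processed in at most $C$ steps; (ii) with probability at least $1-C/n$ over the seed, the answers after all $n$ arrivals are correct. In short, streaming matching for these dictionaries is solved by a randomised algorithm in $O(1)$ time per character and $O(k\log m)$ words of space, with error probability $O(1/n)$. -/

import Mathlib

namespace StreamMatch

/-! ### Strings -/

/-- Base-two logarithm, rounded to the nearest integer. -/
noncomputable def rlog (m : ℕ) : ℕ := (round (Real.logb 2 (m : ℝ))).toNat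

/-- The period of a non-empty string: the least `p` with `0 < p ≤ |x|` and `x_i = x_{i+p}`
whenever both positions exist. -/
noncomputable def period {α : Type*} (x : List α) : ℕ :=
  sInf {p : ℕ | 0 < p ∧ p ≤ x.length ∧ x.HasPeriod p}

/-- The answer expected after the arrival of each character of the text: at (0-based) position `x`
it is `true` exactly if some pattern is a suffix of the first `x + 1` characters. -/
noncomputable def expected {α : Type*} (patterns : Finset (List α)) (text : List α) : List Bool :=
  open Classical in
  (List.range text.length).map fun x => decide (∃ P ∈ patterns, P <:+ text.take (x + 1))

/-! ### The word RAM

The memory consists of `S` words of `w` bits, at addresses `0, …, S - 1`. There are no other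
registers: the operands of instructions are memory cells, addressed directly or indirectly. -/

/-- Arithmetic, bitwise and comparison operations on words. -/
inductive BinOp
  | add | sub | mul | div | mod | and | or | xor | shl | shr | eq | lt

/-- Result of an operation on `w`-bit words; overflow wraps around, division by zero gives `0`,
and comparisons give `1` or `0`. -/
def BinOp.eval (w : ℕ) (o : BinOp) (a b : ℕ) : ℕ :=
  match o with
  | .add => (a + b) % 2 ^ w
  | .sub => (a + (2 ^ w - b)) % 2 ^ w
  | .mul => (a * b) % 2 ^ w
  | .div => a / b
  | .mod => a % b
  | .and => a &&& b
  | .or => a ||| b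
  | .xor => a ^^^ b
  | .shl => (a * 2 ^ b) % 2 ^ w
  | .shr => a / 2 ^ b
  | .eq => if a = b then 1 else 0
  | .lt => if a < b then 1 else 0

/-- Instructions, where `M` denotes the memory. -/
inductive Instr
  /-- `M[d] := c` -/
  | const (d c : ℕ)
  /-- `M[d] := M[a] o M[b]` -/
  | bin (o : BinOp) (d a b : ℕ)
  /-- `M[d] := M[M[a]]` -/
  | load (d a : ℕ)
  /-- `M[M[a]] := M[b]` -/
  | store (a b : ℕ)
  /-- jump to instruction number `t` if `M[a] = 0` -/
  | jz (a t : ℕ)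
  /-- stop -/
  | halt

/-- One step of an instruction other than `halt`, from program counter `pc` and memory `M`. The
machine is stuck (`none`) if a cell outside the `S` words of memory is accessed. -/
def step (w S : ℕ) (ins : Instr) (pc : ℕ) (M : ℕ → ℕ) : Option (ℕ × (ℕ → ℕ)) :=
  match ins with
  | .const d c => if d < S then some (pc + 1, Function.update M d (c % 2 ^ w)) else none
  | .bin o d a b =>
      if d < S ∧ a < S ∧ b < S then
        some (pc + 1, Function.update M d (o.eval w (M a) (M b))) else none
  | .load d a =>
      if d < S ∧ a < S ∧ M a < S then some (pc + 1, Function.update M d (M (M a))) else none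
  | .store a b =>
      if a < S ∧ b < S ∧ M a < S then some (pc + 1, Function.update M (M a) (M b)) else none
  | .jz a t => if a < S then some (if M a = 0 then t else pc + 1, M) else none
  | .halt => none

/-- Run a program from program counter `pc` and memory `M`: the memory at the time it halts, if it
halts after executing at most `t` instructions (not counting `halt`), and `none` otherwise. -/
def exec (prog : List Instr) (w S : ℕ) : ℕ → ℕ → (ℕ → ℕ) → Option (ℕ → ℕ)
  | t, pc, M =>
    match prog[pc]? with
    | none => none
    | some .halt => some M
    | some ins =>
      match t with
      | 0 => none
      | t + 1 =>
        match step w S ins pc M with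
        | none => none
        | some (pc', M') => exec prog w S t pc' M'

/-- Streaming computation with at most `C` instructions per arrival. Each arriving character is
put into cell `0`, the program is run from its first instruction, and when it halts, cell `1` holds
the answer for this arrival (non-zero means `true`). Only the memory is kept between arrivals. The
result is the list of answers, or `none` if some arrival is not completed in `C` steps. -/
def stream (prog : List Instr) (w S C : ℕ) : (ℕ → ℕ) → List ℕ → Option (List Bool)
  | _, [] => some []
  | M, a :: text =>
    match exec prog w S C 0 (Function.update M 0 a) with
    | none => none
    | some M' => (stream prog w S C M' text).map fun out => (M' 1 != 0) :: out

end StreamMatch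

namespace StreamMatch

/-! ### A small structured language on top of the word RAM

Cells `0, …, 31` hold variables, cells `32, …, 63` are temporaries, and entry `i ≥ 1` of the array
with number `c < 64` is cell `64 * i + c`. -/

/-! Put $l = k\log m$ and write each pattern as $QR$ with $|R| = l$. The pattern ends at $x$ iff its
last $2l$ characters end at $x$ and $Q$ ends at $z = x - l$ (`occ_add_iff`). The first condition is
one fingerprint lookup in a perfect hash table. The answer to the second is needed only $l$ arrivals
after position $z$, and this slack pays for handling a single pattern per arrival, in rotation; it
suffices because $k \le l/2$.

Let $u$ be the last $l$ characters of $Q$ and $r < l$ the period of $Q$. An occurrence of $u$ is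
special if no other one ends at most $\lfloor l/2\rfloor$ positions earlier. Special positions of
$u$ are therefore more than $k$ apart, and the rotation reaches each pattern between two of them
(`le_don_of_lt_start`). Occurrences of $u$ are recorded with delay $l - \lfloor l/2\rfloor$; the
other $\lfloor l/2\rfloor$ arrivals are left to the rotation. When a pattern has its turn at a new
special position, a suffix of $Q$ of length $W < 3l$ is tested there by fingerprints. Two cases
remain.

If $r \le l/2$, the occurrences of $u$ in a run that starts at a special $z_0$ are spaced exactly
$r$ apart (`exists_chain`). Whether $Q$ ends at $z$ then depends only on $z - z_0$ and on the one
test at $z_0$ (`occ_iff_of_small`). Among such patterns with equal last $2l$ characters, the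
shortest one decides (`occ_of_occ_of_small`).

If $r > l/2$, every occurrence of $Q$ is itself special (`special_of_occ`). Successful tests at
distance exactly $r$ are joined into chains, and $Q$ ends at $z$ iff the chain ending there spans
$|Q| - W$ (`occ_of_chain`, `need_le_of_occ`). A success is stored as a mark at the table entry of
the last $2l$ characters.

`answer_iff` combines the cases, assuming that no fingerprint comparison gives a false positive. A
false positive makes the random base a root of a nonzero polynomial of degree below $3l$; a union
bound over the $3k(l+n)$ comparisons that could occur, modulo a prime above $(n+m+\sigma)^4$, gives
error $O(1/n)$ (`card_exists_collision_le`). Constant time holds for every seed, since the program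
is loop-free code (`Cmd.reach_code`) all of whose operations are shown to be in range
(`matchCmd_ok`). -/

/-- Operations on natural numbers without overflow. -/
inductive Op
  | add | sub | mul | mod | eq | lt

/-- The machine operation for `o`. -/
def Op.toBinOp : Op → BinOp
  | .add => .add
  | .sub => .sub
  | .mul => .mul
  | .mod => .mod
  | .eq => .eq
  | .lt => .lt

/-- Value of an operation. -/
def Op.val (o : Op) (a b : ℕ) : ℕ :=
  match o with
  | .add => a + b
  | .sub => a - b
  | .mul => a * b
  | .mod => a % b
  | .eq => if a = b then 1 else 0
  | .lt => if a < b then 1 else 0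

/-- The operation on `w`-bit words gives its value on natural numbers. -/
def Op.Safe (w : ℕ) (o : Op) (a b : ℕ) : Prop :=
  match o with
  | .add => a + b < 2 ^ w
  | .sub => b ≤ a ∧ a < 2 ^ w
  | .mul => a * b < 2 ^ w
  | _ => True

theorem Op.eval_toBinOp {w : ℕ} {o : Op} {a b : ℕ} (h : o.Safe w a b) :
    o.toBinOp.eval w a b = o.val a b := by
  cases o <;> simp only [Op.toBinOp, BinOp.eval, Op.val, Op.Safe] at *
  · exact Nat.mod_eq_of_lt h
  · have : a + (2 ^ w - b) = (a - b) + 2 ^ w := by omega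
    rw [this, Nat.add_mod_right]
    exact Nat.mod_eq_of_lt (by omega)
  · exact Nat.mod_eq_of_lt h

/-- Expressions. -/
inductive Expr
  | const (c : ℕ)
  | var (i : ℕ)
  | bin (o : Op) (e f : Expr)
  | read (c : ℕ) (e : Expr)

/-- Values of variables and arrays. -/
structure Store where
  v : ℕ → ℕ
  a : ℕ → ℕ → ℕ

/-- Value of an expression. -/
def Expr.eval (s : Store) : Expr → ℕ
  | .const c => c
  | .var i => s.v i
  | .bin o e f => o.val (e.eval s) (f.eval s)
  | .read c e => s.a c (e.eval s)

/-- No overflow occurs, and array indices are at least `1` and less than `Z`. -/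
def Expr.Safe (w Z : ℕ) (s : Store) : Expr → Prop
  | .const c => c < 2 ^ w
  | .var _ => True
  | .bin o e f => e.Safe w Z s ∧ f.Safe w Z s ∧ o.Safe w (e.eval s) (f.eval s)
  | .read _ e => e.Safe w Z s ∧ 1 ≤ e.eval s ∧ e.eval s < Z

/-- Evaluation into temporary `d` stays within the cells available. -/
def Expr.WF : ℕ → Expr → Prop
  | d, .const _ => d < 64
  | d, .var i => d < 64 ∧ i < 32
  | d, .bin _ e f => e.WF d ∧ f.WF (d + 1)
  | d, .read c e => e.WF d ∧ c < 64 ∧ d + 1 < 64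

instance Expr.decWF : ∀ (d : ℕ) (e : Expr), Decidable (e.WF d)
  | d, .const _ => inferInstanceAs (Decidable (d < 64))
  | d, .var i => inferInstanceAs (Decidable (d < 64 ∧ i < 32))
  | d, .bin _ e f => @instDecidableAnd _ _ (Expr.decWF d e) (Expr.decWF (d + 1) f)
  | d, .read c e => @instDecidableAnd _ _ (Expr.decWF d e)
      (inferInstanceAs (Decidable (c < 64 ∧ d + 1 < 64)))

/-- Replace the index in cell `d` by the address of the entry of array `c`. -/
def addrCode (c d : ℕ) : List Instr :=
  [.const (d + 1) 64, .bin .mul d d (d + 1), .const (d + 1) c, .bin .add d d (d + 1)]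

/-- Code that evaluates an expression into cell `d`. -/
def Expr.code : ℕ → Expr → List Instr
  | d, .const c => [.const d c]
  -- A copy is expressed as the bitwise `or` of a word with itself.
  | d, .var i => [.bin .or d i i]
  | d, .bin o e f => e.code d ++ (f.code (d + 1) ++ [.bin o.toBinOp d d (d + 1)])
  | d, .read c e => e.code d ++ (addrCode c d ++ [.load d d])

/-- Commands. -/
inductive Cmd
  | asg (i : ℕ) (e : Expr)
  | write (c : ℕ) (e f : Expr)
  | seq (c d : Cmd)
  | cond (e : Expr) (c : Cmd)

/-- Effect of a command. -/
def Cmd.run : Cmd → Store → Store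
  | .asg i e, s => { s with v := Function.update s.v i (e.eval s) }
  | .write c e f, s =>
      { s with a := Function.update s.a c (Function.update (s.a c) (e.eval s) (f.eval s)) }
  | .seq c d, s => d.run (c.run s)
  | .cond e c, s => if e.eval s = 0 then s else c.run s

/-- All expressions evaluated by a command are safe. -/
def Cmd.Safe (w Z : ℕ) : Cmd → Store → Prop
  | .asg _ e, s => e.Safe w Z s
  | .write _ e f, s => e.Safe w Z s ∧ f.Safe w Z s ∧ 1 ≤ e.eval s ∧ e.eval s < Z
  | .seq c d, s => c.Safe w Z s ∧ d.Safe w Z (c.run s)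
  | .cond e c, s => e.Safe w Z s ∧ (e.eval s ≠ 0 → c.Safe w Z s)

/-- Variables, arrays and temporaries of a command are in range. -/
def Cmd.WF : Cmd → Prop
  | .asg i e => i < 32 ∧ e.WF 32
  | .write c e f => c < 64 ∧ e.WF 33 ∧ f.WF 32
  | .seq c d => c.WF ∧ d.WF
  | .cond e c => e.WF 32 ∧ c.WF

instance Cmd.decWF : ∀ c : Cmd, Decidable c.WF
  | .asg i e => inferInstanceAs (Decidable (i < 32 ∧ e.WF 32))
  | .write c e f => inferInstanceAs (Decidable (c < 64 ∧ e.WF 33 ∧ f.WF 32))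
  | .seq c d => @instDecidableAnd _ _ (Cmd.decWF c) (Cmd.decWF d)
  | .cond e c => @instDecidableAnd _ _ (inferInstanceAs (Decidable (e.WF 32))) (Cmd.decWF c)

/-- Code for a command, to be placed at address `pc`. -/
def Cmd.code : ℕ → Cmd → List Instr
  | _, .asg i e => e.code 32 ++ [.bin .or i 32 32]
  | _, .write c e f => f.code 32 ++ (e.code 33 ++ (addrCode c 33 ++ [.store 33 32]))
  | pc, .seq c d => c.code pc ++ d.code (pc + (c.code pc).length)
  | pc, .cond e c =>
      e.code 32 ++
        ([.jz 32 (pc + (e.code 32).length + 1 + (c.code (pc + (e.code 32).length + 1)).length)] ++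
          c.code (pc + (e.code 32).length + 1))

/-! ### Correctness of the compilation to the word RAM. -/

/-- `code` occurs in `prog` at address `pc`. -/
def CodeAt (prog : List Instr) (pc : ℕ) (code : List Instr) : Prop :=
  code <+: prog.drop pc

theorem CodeAt.append {prog : List Instr} {pc : ℕ} {c d : List Instr}
    (h : CodeAt prog pc (c ++ d)) : CodeAt prog pc c ∧ CodeAt prog (pc + c.length) d := by
  obtain ⟨r, hr⟩ := h
  refine ⟨⟨d ++ r, by simpa using hr⟩, ⟨r, ?_⟩⟩
  rw [← List.drop_drop, ← hr]
  simp

theorem CodeAt.getElem? {prog : List Instr} {pc : ℕ} {i : Instr} {d : List Instr}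
    (h : CodeAt prog pc (i :: d)) : prog[pc]? = some i := by
  obtain ⟨r, hr⟩ := h
  have : (prog.drop pc)[0]? = some i := by rw [← hr]; simp
  simpa using this

theorem CodeAt.tail {prog : List Instr} {pc : ℕ} {i : Instr} {d : List Instr}
    (h : CodeAt prog pc (i :: d)) : CodeAt prog (pc + 1) d :=
  (CodeAt.append (c := [i]) h).2

/-- At most `n` steps lead from `(pc, M)` to `(pc', M')`. -/
def Reach (prog : List Instr) (w S n pc : ℕ) (M : ℕ → ℕ) (pc' : ℕ) (M' : ℕ → ℕ) : Prop :=
  ∃ t ≤ n, ∀ t', exec prog w S (t' + t) pc M = exec prog w S t' pc' M'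

theorem Reach.trans {prog : List Instr} {w S n₁ n₂ pc₁ pc₂ pc₃ : ℕ} {M₁ M₂ M₃ : ℕ → ℕ}
    (h : Reach prog w S n₁ pc₁ M₁ pc₂ M₂) (h' : Reach prog w S n₂ pc₂ M₂ pc₃ M₃) :
    Reach prog w S (n₁ + n₂) pc₁ M₁ pc₃ M₃ := by
  obtain ⟨t, ht, H⟩ := h
  obtain ⟨u, hu, H'⟩ := h'
  refine ⟨u + t, by omega, fun t' => ?_⟩
  rw [← add_assoc, H, H']

theorem Reach.mono {prog : List Instr} {w S n m pc₁ pc₂ : ℕ} {M₁ M₂ : ℕ → ℕ}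
    (h : Reach prog w S n pc₁ M₁ pc₂ M₂) (hn : n ≤ m) : Reach prog w S m pc₁ M₁ pc₂ M₂ := by
  obtain ⟨t, ht, H⟩ := h
  exact ⟨t, ht.trans hn, H⟩

theorem Reach.step {prog : List Instr} {w S pc pc' : ℕ} {M M' : ℕ → ℕ} {i : Instr}
    (hi : prog[pc]? = some i) (hs : step w S i pc M = some (pc', M')) :
    Reach prog w S 1 pc M pc' M' := by
  refine ⟨1, le_rfl, fun t' => ?_⟩
  have hne : i ≠ .halt := by
    rintro rfl
    simp [StreamMatch.step] at hs
  rw [exec, hi]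
  cases i <;> first | exact absurd rfl hne | simp only [hs]

theorem reach_bin {prog : List Instr} {w S pc : ℕ} {M : ℕ → ℕ} {o : BinOp} {d a b : ℕ}
    (hi : prog[pc]? = some (.bin o d a b)) (hd : d < S) (ha : a < S) (hb : b < S) :
    Reach prog w S 1 pc M (pc + 1) (Function.update M d (o.eval w (M a) (M b))) :=
  Reach.step hi (by simp [step, hd, ha, hb])

theorem reach_const {prog : List Instr} {w S pc : ℕ} {M : ℕ → ℕ} {d c : ℕ}
    (hi : prog[pc]? = some (.const d c)) (hd : d < S) (hc : c < 2 ^ w) :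
    Reach prog w S 1 pc M (pc + 1) (Function.update M d c) :=
  Reach.step hi (by simp [step, hd, Nat.mod_eq_of_lt hc])

/-- The memory `M` represents the store `s`, with arrays of length `Z`. -/
def Agree (Z : ℕ) (s : Store) (M : ℕ → ℕ) : Prop :=
  (∀ i < 32, M i = s.v i) ∧ ∀ c < 64, ∀ i, 1 ≤ i → i < Z → M (64 * i + c) = s.a c i

/-- Temporaries lie strictly between the variables (below 32) and the arrays (from 64 on, as indices
start at 1), so overwriting them does not affect the represented store. -/
theorem Agree.congr {Z d : ℕ} {s : Store} {M M' : ℕ → ℕ} (h : Agree Z s M) (hd : 32 ≤ d)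
    (hM : ∀ j, ¬ (d ≤ j ∧ j < 64) → M' j = M j) : Agree Z s M' :=
  ⟨fun i hi => by rw [hM i (by omega), h.1 i hi],
    fun c hc i h1 hi => by rw [hM _ (by omega), h.2 c hc i h1 hi]⟩

theorem reach_addrCode {prog : List Instr} {w Z pc : ℕ} {M : ℕ → ℕ} {c d : ℕ}
    (hcode : CodeAt prog pc (addrCode c d)) (hZ : 64 * Z ≤ 2 ^ w) (hi : 1 ≤ M d) (hi' : M d < Z)
    (hc : c < 64) (hd : d + 1 < 64) :
    ∃ M', Reach prog w (64 * Z) 4 pc M (pc + 4) M' ∧ M' d = 64 * M d + c ∧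
      ∀ j, ¬ (d ≤ j ∧ j < 64) → M' j = M j := by
  have c0 := hcode.getElem?
  have c1 := hcode.tail.getElem?
  have c2 := hcode.tail.tail.getElem?
  have c3 := hcode.tail.tail.tail.getElem?
  have r0 := reach_const (w := w) (S := 64 * Z) (M := M) c0 (by omega) (by omega)
  have r1 := r0.trans (reach_bin c1 (by omega) (by omega) (by omega))
  have r2 := r1.trans (reach_const c2 (by omega) (by omega))
  have r3 := r2.trans (reach_bin c3 (by omega) (by omega) (by omega))
  refine ⟨_, r3, ?_, ?_⟩
  · simp only [Function.update_self, BinOp.eval, Function.update_of_ne (show d ≠ d + 1 by omega)]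
    rw [Nat.mod_eq_of_lt (a := M d * 64) (by omega), Nat.mod_eq_of_lt (by omega)]
    ring
  · intro j hj
    rw [Function.update_of_ne (by omega), Function.update_of_ne (by omega),
      Function.update_of_ne (by omega), Function.update_of_ne (by omega)]

theorem Expr.WF.lt {d : ℕ} {e : Expr} (h : e.WF d) : d < 64 := by
  induction e generalizing d with
  | const c => exact h
  | var i => exact h.1
  | bin o e f he _ => exact he h.1
  | read c e _ => exact (Nat.lt_succ_self d).trans h.2.2

/-- The frame condition drives the induction: a right operand is evaluated from `d + 1` upwards and
so cannot destroy the left operand in `d`. The code is straight-line, so its length bounds the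
number of steps. -/
theorem Expr.reach_code {prog : List Instr} {w Z : ℕ} {s : Store} (hZ : 64 * Z ≤ 2 ^ w)
    (hZ2 : 1 ≤ Z) (e : Expr) {pc d : ℕ} {M : ℕ → ℕ} (hM : Agree Z s M) (hs : e.Safe w Z s)
    (hwf : e.WF d) (hd : 32 ≤ d) (hcode : CodeAt prog pc (e.code d)) :
    ∃ M', Reach prog w (64 * Z) (e.code d).length pc M (pc + (e.code d).length) M' ∧
      M' d = e.eval s ∧ ∀ j, ¬ (d ≤ j ∧ j < 64) → M' j = M j := by
  induction e generalizing pc d M with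
  | const c =>
    have h : d < 64 := hwf
    refine ⟨_, reach_const hcode.getElem? (by omega) hs, by simp [Expr.eval], fun j hj => ?_⟩
    rw [Function.update_of_ne (by omega)]
  | var i =>
    have h := hwf.1
    have h' := hwf.2
    refine ⟨_, reach_bin hcode.getElem? (by omega) (by omega) (by omega), ?_, fun j hj => ?_⟩
    · simp [Expr.eval, BinOp.eval, hM.1 i h']
    · rw [Function.update_of_ne (by omega)]
  | bin o e f he hf =>
    obtain ⟨w1, w2⟩ := hwf
    obtain ⟨s1, s2, s3⟩ := hs
    have hd2 := w2.lt
    obtain ⟨k1, k2⟩ := hcode.append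
    obtain ⟨k2, k3⟩ := k2.append
    obtain ⟨M1, r1, v1, a1⟩ := he hM s1 w1 hd k1
    obtain ⟨M2, r2, v2, a2⟩ := hf (hM.congr hd a1) s2 w2 (by omega) k2
    have r3 := reach_bin (w := w) (S := 64 * Z) (M := M2) k3.getElem? (by omega) (by omega)
      (by omega)
    refine ⟨Function.update M2 d (o.toBinOp.eval w (M2 d) (M2 (d + 1))), ?_, ?_, ?_⟩
    · simpa [Expr.code, add_assoc] using (r1.trans r2).trans r3
    · rw [Function.update_self, a2 d (by omega), v1, v2, Op.eval_toBinOp s3]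
      rfl
    · intro j hj
      rw [Function.update_of_ne (by omega), a2 j (by omega), a1 j (by omega)]
  | read c e he =>
    obtain ⟨w1, w2, w3⟩ := hwf
    obtain ⟨s1, s2, s3⟩ := hs
    obtain ⟨k1, k2⟩ := hcode.append
    obtain ⟨k2, k3⟩ := k2.append
    obtain ⟨M1, r1, v1, a1⟩ := he hM s1 w1 hd k1
    obtain ⟨M2, r2, v2, a2⟩ := reach_addrCode (M := M1) k2 hZ (by rwa [v1]) (by rwa [v1]) w2 w3
    rw [v1] at v2
    have r3 : Reach prog w (64 * Z) 1 (pc + (e.code d).length + 4) M2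
        (pc + (e.code d).length + 4 + 1) (Function.update M2 d (M2 (M2 d))) :=
      Reach.step k3.getElem? (by simp [step, v2]; omega)
    refine ⟨Function.update M2 d (M2 (M2 d)), ?_, ?_, ?_⟩
    · simpa [Expr.code, addrCode, add_assoc] using (r1.trans r2).trans r3
    · rw [Function.update_self, v2, a2 _ (by omega), a1 _ (by omega), hM.2 c w2 _ s2 s3]
      rfl
    · intro j hj
      rw [Function.update_of_ne (by omega), a2 j (by omega), a1 j (by omega)]

/-- All jumps go forward, past the body of a conditional. No instruction runs twice, and the code
length bounds the time independently of the data. -/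
theorem Cmd.reach_code {prog : List Instr} {w Z : ℕ} (hZ : 64 * Z ≤ 2 ^ w)
    (hZ2 : 1 ≤ Z) (c : Cmd) {s : Store} {pc : ℕ} {M : ℕ → ℕ} (hM : Agree Z s M)
    (hs : c.Safe w Z s) (hwf : c.WF) (hcode : CodeAt prog pc (c.code pc)) :
    ∃ M', Reach prog w (64 * Z) (c.code pc).length pc M (pc + (c.code pc).length) M' ∧
      Agree Z (c.run s) M' := by
  induction c generalizing s pc M with
  | asg i e =>
    obtain ⟨w1, w2⟩ := hwf
    obtain ⟨k1, k2⟩ := hcode.append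
    obtain ⟨M1, r1, v1, a1⟩ := e.reach_code hZ hZ2 hM hs w2 le_rfl k1
    have r2 := reach_bin (w := w) (S := 64 * Z) (M := M1) k2.getElem? (by omega) (by omega)
      (by omega)
    have h1 := hM.congr le_rfl a1
    refine ⟨Function.update M1 i (BinOp.or.eval w (M1 32) (M1 32)), ?_, ?_, ?_⟩
    · simpa [Cmd.code, add_assoc] using r1.trans r2
    · intro j hj
      by_cases hij : j = i
      · subst hij
        simp [Cmd.run, BinOp.eval, v1]
      · simp only [Cmd.run]
        rw [Function.update_of_ne hij, Function.update_of_ne hij, h1.1 j hj]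
    · intro c hc j h1j hj
      rw [Function.update_of_ne (by omega)]
      exact h1.2 c hc j h1j hj
  | write c e f =>
    obtain ⟨w1, w2, w3⟩ := hwf
    obtain ⟨s1, s2, s3, s4⟩ := hs
    obtain ⟨k1, k2⟩ := hcode.append
    obtain ⟨k2, k3⟩ := k2.append
    obtain ⟨k3, k4⟩ := k3.append
    obtain ⟨M1, r1, v1, a1⟩ := f.reach_code hZ hZ2 hM s2 w3 le_rfl k1
    have h1 := hM.congr le_rfl a1
    obtain ⟨M2, r2, v2, a2⟩ := e.reach_code hZ hZ2 h1 s1 w2 (by omega) k2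
    have h2 := h1.congr (by omega) a2
    obtain ⟨M3, r3, v3, a3⟩ := reach_addrCode (M := M2) k3 hZ (by rwa [v2]) (by rwa [v2]) w1 (by omega)
    have h3 := h2.congr (by omega) a3
    rw [v2] at v3
    have e32 : M3 32 = f.eval s := by rw [a3 _ (by omega), a2 _ (by omega), v1]
    have r4 : Reach prog w (64 * Z) 1 (pc + (f.code 32).length + (e.code 33).length + 4) M3
        (pc + (f.code 32).length + (e.code 33).length + 4 + 1)
        (Function.update M3 (M3 33) (M3 32)) :=
      Reach.step k4.getElem? (by simp [step, v3]; omega)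
    refine ⟨Function.update M3 (M3 33) (M3 32), ?_, ?_, ?_⟩
    · simpa [Cmd.code, addrCode, add_assoc] using ((r1.trans r2).trans r3).trans r4
    · intro j hj
      rw [Function.update_of_ne (by omega)]
      exact h3.1 j hj
    · intro c' hc' j hj hj'
      simp only [Cmd.run]
      rw [v3, e32]
      by_cases hcc : c' = c
      · subst hcc
        rw [Function.update_self]
        by_cases hje : j = e.eval s
        · subst hje
          simp
        · rw [Function.update_of_ne (by omega), Function.update_of_ne hje]
          exact h3.2 _ hc' j hj hj'
      · rw [Function.update_of_ne (by omega), Function.update_of_ne hcc]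
        exact h3.2 _ hc' j hj hj'
  | seq c d hc hd =>
    obtain ⟨w1, w2⟩ := hwf
    obtain ⟨s1, s2⟩ := hs
    obtain ⟨k1, k2⟩ := hcode.append
    obtain ⟨M1, r1, a1⟩ := hc hM s1 w1 k1
    obtain ⟨M2, r2, a2⟩ := hd a1 s2 w2 k2
    refine ⟨M2, ?_, a2⟩
    simpa [Cmd.code, add_assoc] using r1.trans r2
  | cond e c hc =>
    obtain ⟨w1, w2⟩ := hwf
    obtain ⟨s1, s2⟩ := hs
    obtain ⟨k1, k2⟩ := hcode.append
    obtain ⟨k2, k3⟩ := k2.append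
    obtain ⟨M1, r1, v1, a1⟩ := e.reach_code hZ hZ2 hM s1 w1 le_rfl k1
    have h1 := hM.congr le_rfl a1
    by_cases he : e.eval s = 0
    · rw [he] at v1
      have r2 : Reach prog w (64 * Z) 1 (pc + (e.code 32).length) M1
          (pc + (e.code 32).length + 1 + (c.code (pc + (e.code 32).length + 1)).length) M1 :=
        Reach.step k2.getElem? (by simp only [step, v1]; rw [if_pos (by omega)]; rfl)
      refine ⟨M1, ?_, by simpa [Cmd.run, he] using h1⟩
      have r3 := (r1.trans r2).mono (m := (Cmd.code pc (.cond e c)).length) (by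
        simp only [Cmd.code, List.length_append, List.length_singleton]; omega)
      simpa [Cmd.code, add_assoc, add_comm, add_left_comm] using r3
    · have r2 : Reach prog w (64 * Z) 1 (pc + (e.code 32).length) M1
          (pc + (e.code 32).length + 1) M1 :=
        Reach.step k2.getElem? (by
          simp only [step, v1]; rw [if_pos (by omega), if_neg he])
      obtain ⟨M2, r3, a3⟩ := hc h1 (s2 he) w2 k3
      refine ⟨M2, ?_, by simpa [Cmd.run, he] using a3⟩
      simpa [Cmd.code, add_assoc, add_comm, add_left_comm] using (r1.trans r2).trans r3

/-- The program that runs a command and stops. -/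
def Cmd.prog (c : Cmd) : List Instr := c.code 0 ++ [.halt]

theorem Cmd.exec_prog {w Z : ℕ} (hZ : 64 * Z ≤ 2 ^ w) (hZ2 : 1 ≤ Z) (c : Cmd) {s : Store}
    {M : ℕ → ℕ} (hM : Agree Z s M) (hs : c.Safe w Z s) (hwf : c.WF) {C : ℕ}
    (hC : c.prog.length ≤ C) :
    ∃ M', exec c.prog w (64 * Z) C 0 M = some M' ∧ Agree Z (c.run s) M' := by
  have hp : CodeAt c.prog 0 (c.code 0 ++ [.halt]) := ⟨[], by simp [Cmd.prog]⟩
  obtain ⟨k1, k2⟩ := hp.append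
  obtain ⟨M', ⟨t, ht, H⟩, a⟩ := c.reach_code hZ hZ2 hM hs hwf k1
  refine ⟨M', ?_, a⟩
  have hle : t ≤ C := ht.trans (le_trans (by simp [Cmd.prog]) hC)
  rw [← Nat.sub_add_cancel hle, H, exec, k2.getElem?]


/-! ### Two-level perfect hashing -/

/-- A collision forces $a(x-y) \bmod p$ or its negative to be a positive multiple of $M$ below $p$.
There are $\lfloor (p-1)/M\rfloor$ such multiples, and $a \mapsto a(x-y)$ is injective modulo $p$.
-/
theorem card_collisions_mul_le {p : ℕ} [hp : Fact p.Prime] {x y M : ℕ} (hx : x < p) (hy : y < p)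
    (hxy : x ≠ y) :
    ((Finset.Ioc 0 (p - 1)).filter fun a => a * x % p % M = a * y % p % M).card * M
      ≤ 2 * (p - 1) := by
  have hp0 : 0 < p := hp.out.pos
  have hcast : ∀ a : ℕ, (((a * x % p + (p - a * y % p)) % p : ℕ) : ZMod p) = a * (x - y) := by
    intro a
    have h1 : a * y % p ≤ p := (Nat.mod_lt _ hp0).le
    simp [Nat.cast_sub h1]
    ring
  have hne : ((x : ZMod p) - y) ≠ 0 := by
    intro h
    rw [sub_eq_zero, ZMod.natCast_eq_natCast_iff', Nat.mod_eq_of_lt hx, Nat.mod_eq_of_lt hy] at h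
    exact hxy h
  set D := (Finset.Ioc 0 (p - 1)).filter fun d => M ∣ d with hD
  set D' := D.image fun d => p - d with hD'
  have hcard : ((Finset.Ioc 0 (p - 1)).filter
      fun a => a * x % p % M = a * y % p % M).card ≤ (D ∪ D').card := by
    refine Finset.card_le_card_of_injOn (fun a => (a * x % p + (p - a * y % p)) % p) ?_ ?_
    · intro a ha
      simp only [Finset.coe_filter, Finset.mem_Ioc, Set.mem_ofPred_eq] at ha
      obtain ⟨⟨ha0, hap⟩, hM⟩ := ha
      have hA := Nat.mod_lt (a * x) hp0
      have hB := Nat.mod_lt (a * y) hp0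
      have hd0 : (a * x % p + (p - a * y % p)) % p ≠ 0 := by
        intro h
        have h2 := hcast a
        rw [h] at h2
        rcases mul_eq_zero.1 (by simpa using h2.symm : (a : ZMod p) * (x - y) = 0) with h3 | h3
        · rw [ZMod.natCast_eq_zero_iff] at h3
          have := Nat.le_of_dvd ha0 h3
          omega
        · exact hne h3
      have hdp := Nat.mod_lt (a * x % p + (p - a * y % p)) hp0
      simp only [Finset.coe_union, Set.mem_union, Finset.mem_coe]
      rcases le_total (a * y % p) (a * x % p) with h | h
      · left
        have e : (a * x % p + (p - a * y % p)) % p = a * x % p - a * y % p := by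
          rw [show a * x % p + (p - a * y % p) = (a * x % p - a * y % p) + p by omega,
            Nat.add_mod_right, Nat.mod_eq_of_lt (by omega)]
        rw [hD, Finset.mem_filter, Finset.mem_Ioc]
        refine ⟨by omega, ?_⟩
        rw [e]
        exact (Nat.modEq_iff_dvd' h).1 hM.symm
      · right
        have hlt : a * x % p ≠ a * y % p := by
          intro h'
          apply hd0
          rw [h', Nat.add_sub_cancel' hB.le, Nat.mod_self]
        have e : (a * x % p + (p - a * y % p)) % p = p - (a * y % p - a * x % p) := by
          rw [Nat.mod_eq_of_lt (by omega)]
          omega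
        rw [hD', Finset.mem_image]
        refine ⟨a * y % p - a * x % p, ?_, e.symm⟩
        rw [hD, Finset.mem_filter, Finset.mem_Ioc]
        exact ⟨by omega, (Nat.modEq_iff_dvd' h).1 hM⟩
    · intro a ha b hb hab
      simp only [Finset.coe_filter, Finset.mem_Ioc, Set.mem_ofPred_eq] at ha hb
      have h2 : (a : ZMod p) * (x - y) = b * (x - y) := by
        rw [← hcast, ← hcast]
        exact congrArg _ hab
      have h3 := mul_right_cancel₀ hne h2
      rw [ZMod.natCast_eq_natCast_iff', Nat.mod_eq_of_lt (by omega),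
        Nat.mod_eq_of_lt (by omega)] at h3
      exact h3
  have hDc : D.card = (p - 1) / M := Nat.Ioc_filter_dvd_card_eq_div _ _
  have h1 : (D ∪ D').card ≤ 2 * ((p - 1) / M) := by
    refine (Finset.card_union_le _ _).trans ?_
    have : D'.card ≤ D.card := Finset.card_image_le
    omega
  calc _ ≤ 2 * ((p - 1) / M) * M := Nat.mul_le_mul_right _ (hcard.trans h1)
    _ = 2 * ((p - 1) / M * M) := by ring
    _ ≤ 2 * (p - 1) := Nat.mul_le_mul_left _ (Nat.div_mul_le_self _ _)

/-- Averaging over the nonzero multipliers: some $a$ has at most the mean number of colliding pairs.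
-/
theorem exists_few_collisions {p : ℕ} [hp : Fact p.Prime] (S : Finset ℕ) (hS : ∀ f ∈ S, f < p)
    (M : ℕ) :
    ∃ a < p, (S.offDiag.filter fun z => a * z.1 % p % M = a * z.2 % p % M).card * M
      ≤ 2 * S.offDiag.card := by
  have hp2 := hp.out.two_le
  have hne : (Finset.Ioc 0 (p - 1)).Nonempty := ⟨1, by simp; omega⟩
  have hsum : ∑ a ∈ Finset.Ioc 0 (p - 1),
      (S.offDiag.filter fun z => a * z.1 % p % M = a * z.2 % p % M).card * M
      ≤ ∑ a ∈ Finset.Ioc 0 (p - 1), 2 * S.offDiag.card := by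
    rw [← Finset.sum_mul]
    simp_rw [Finset.card_filter]
    rw [Finset.sum_comm, Finset.sum_mul]
    calc _ ≤ ∑ z ∈ S.offDiag, 2 * (p - 1) := by
          refine Finset.sum_le_sum fun z hz => ?_
          rw [← Finset.card_filter]
          rw [Finset.mem_offDiag] at hz
          exact card_collisions_mul_le (hS _ hz.1) (hS _ hz.2.1) hz.2.2
      _ = _ := by
          simp
          ring
  obtain ⟨a, ha, h⟩ := Finset.exists_le_of_sum_le hne hsum
  rw [Finset.mem_Ioc] at ha
  exact ⟨a, by omega, h⟩

/-- Position of the key `f` in a two-level hash table. -/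
def hashSlot (p a K : ℕ) (mult size off : ℕ → ℕ) (f : ℕ) : ℕ :=
  off (a * f % p % K + 1) + mult (a * f % p % K + 1) * f % p % size (a * f % p % K + 1)

/-- The Fredman–Komlós–Szemerédi construction. At most $2K$ ordered pairs collide on the first
level. A bucket with $c$ ordered pairs gets a table of size $2c+1$, so the tables have total size at
most $2\cdot 2K + K = 5K$. -/
theorem exists_hashSlot_injOn {p : ℕ} [hp : Fact p.Prime] (S : Finset ℕ) (hS : ∀ f ∈ S, f < p)
    {K : ℕ} (hK : S.card ≤ K) (hK0 : 0 < K) :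
    ∃ (a : ℕ) (mult size off : ℕ → ℕ), a < p ∧
      (∀ i, mult i < p ∧ 1 ≤ size i ∧ size i ≤ 5 * K ∧ 1 ≤ off i ∧ off i ≤ 5 * K) ∧
      (∀ i, 1 ≤ i → i ≤ K → off i + size i ≤ 5 * K + 1) ∧
      Set.InjOn (hashSlot p a K mult size off) S := by
  obtain ⟨a, ha, hcoll⟩ := exists_few_collisions S hS K
  set B : ℕ → Finset ℕ := fun i => S.filter fun f => a * f % p % K = i with hB
  have hBcard : ∀ i, ∃ b < p, Set.InjOn (fun f => b * f % p % (2 * (B i).offDiag.card + 1)) (B i) := by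
    intro i
    obtain ⟨b, hb, h⟩ := exists_few_collisions (B i)
      (fun f hf => hS f (Finset.mem_filter.1 hf).1) (2 * (B i).offDiag.card + 1)
    refine ⟨b, hb, ?_⟩
    -- The number of collisions times $2c+1$ is at most $2c$, so it vanishes.
    have h0 : ((B i).offDiag.filter fun z => b * z.1 % p % (2 * (B i).offDiag.card + 1)
        = b * z.2 % p % (2 * (B i).offDiag.card + 1)).card = 0 := by
      by_contra hne
      have := Nat.mul_le_mul_right (2 * (B i).offDiag.card + 1) (Nat.one_le_iff_ne_zero.2 hne)
      omega
    rw [Finset.card_eq_zero, Finset.filter_eq_empty_iff] at h0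
    intro f hf g hg hfg
    by_contra hne
    exact h0 (Finset.mem_offDiag.2 ⟨hf, hg, hne⟩ : (f, g) ∈ (B i).offDiag) hfg
  choose b hb hinj using hBcard
  set sz : ℕ → ℕ := fun i => 2 * (B i).offDiag.card + 1 with hsz
  have hsum : ∑ i ∈ Finset.range K, (B i).offDiag.card
      = (S.offDiag.filter fun z => a * z.1 % p % K = a * z.2 % p % K).card := by
    rw [Finset.card_eq_sum_card_fiberwise (f := fun z => a * z.1 % p % K) (t := Finset.range K)]
    · refine Finset.sum_congr rfl fun i _ => congrArg _ ?_
      ext ⟨f, g⟩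
      simp only [hB, Finset.mem_offDiag, Finset.mem_filter]
      constructor
      · rintro ⟨⟨h1, h2⟩, ⟨h3, h4⟩, h5⟩
        exact ⟨⟨⟨h1, h3, h5⟩, h2.trans h4.symm⟩, h2⟩
      · rintro ⟨⟨⟨h1, h3, h5⟩, h2⟩, h4⟩
        exact ⟨⟨h1, h4⟩, ⟨h3, h2.symm.trans h4⟩, h5⟩
    · intro z _
      simpa using Nat.mod_lt _ hK0
  have htot : ∑ i ∈ Finset.range K, sz i ≤ 5 * K := by
    have h1 : (S.offDiag.filter fun z => a * z.1 % p % K = a * z.2 % p % K).card ≤ 2 * K := by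
      have h2 : S.offDiag.card ≤ K * K := by
        rw [Finset.offDiag_card]
        exact (Nat.sub_le _ _).trans (Nat.mul_le_mul hK hK)
      refine Nat.le_of_mul_le_mul_right ?_ hK0
      calc _ ≤ _ := hcoll
        _ ≤ 2 * K * K := by rw [mul_assoc]; exact Nat.mul_le_mul_left _ h2
    rw [hsz, Finset.sum_add_distrib, ← Finset.mul_sum, hsum]
    simp
    omega
  have hpre : ∀ i j, i < j → j ≤ K →
      ∑ t ∈ Finset.range i, sz t + sz i ≤ ∑ t ∈ Finset.range j, sz t := by
    intro i j hij hj
    rw [← Finset.sum_range_succ]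
    exact Finset.sum_le_sum_of_subset (Finset.range_subset_range.2 (by omega))
  have hpre' : ∀ i, i < K → ∑ t ∈ Finset.range i, sz t + sz i ≤ 5 * K :=
    fun i hi => (hpre i K hi le_rfl).trans htot
  -- Everything is shifted by one because array entries start at index 1; indices beyond the buckets
  -- get harmless in-range values.
  refine ⟨a, fun i => b (i - 1), fun i => if i - 1 < K then sz (i - 1) else 1,
    fun i => if i - 1 < K then 1 + ∑ t ∈ Finset.range (i - 1), sz t else 1, ha, ?_, ?_, ?_⟩
  · intro i
    refine ⟨hb _, ?_⟩
    by_cases h : i - 1 < K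
    · have h2 := hpre' _ h
      have h3 : 1 ≤ sz (i - 1) := by simp [hsz]
      simp only [if_pos h]
      omega
    · simp only [if_neg h]
      omega
  · intro i h1 hi
    have h := hpre' (i - 1) (by omega)
    simp only [if_pos (show i - 1 < K by omega)]
    omega
  · have hlt : ∀ f, a * f % p % K < K := fun f => Nat.mod_lt _ hK0
    have hval : ∀ f, hashSlot p a K (fun i => b (i - 1))
        (fun i => if i - 1 < K then sz (i - 1) else 1)
        (fun i => if i - 1 < K then 1 + ∑ t ∈ Finset.range (i - 1), sz t else 1) f
        = 1 + ∑ t ∈ Finset.range (a * f % p % K), sz t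
          + b (a * f % p % K) * f % p % sz (a * f % p % K) := by
      intro f
      simp [hashSlot, hlt]
    have key : ∀ f g, a * f % p % K < a * g % p % K →
        1 + ∑ t ∈ Finset.range (a * f % p % K), sz t
          + b (a * f % p % K) * f % p % sz (a * f % p % K)
        ≠ 1 + ∑ t ∈ Finset.range (a * g % p % K), sz t
          + b (a * g % p % K) * g % p % sz (a * g % p % K) := by
      intro f g h
      have h1 := hpre _ _ h (hlt g).le
      have h2 : b (a * f % p % K) * f % p % sz (a * f % p % K) < sz (a * f % p % K) :=
        Nat.mod_lt _ (by simp [hsz])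
      omega
    intro f hf g hg hfg
    rw [hval, hval] at hfg
    rcases lt_trichotomy (a * f % p % K) (a * g % p % K) with h | h | h
    · exact absurd hfg (key f g h)
    · rw [← h] at hfg
      refine hinj (a * f % p % K) (Finset.mem_coe.2 (Finset.mem_filter.2 ⟨hf, rfl⟩))
        (Finset.mem_coe.2 (Finset.mem_filter.2 ⟨hg, h.symm⟩)) ?_
      exact Nat.add_left_cancel hfg
    · exact absurd hfg.symm (key g f h)


/-! ### Occurrences and periods

Strings are read from their last character backwards. -/

/-- The first `h` values of `q`, read backwards, end at position `z` of the text `X`. -/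
def Occ (X : ℤ → ℕ) (q : ℕ → ℕ) (h : ℕ) (z : ℤ) : Prop := ∀ i < h, X (z - i) = q i

theorem Occ.mono {X : ℤ → ℕ} {q : ℕ → ℕ} {h h' : ℕ} {z : ℤ} (H : Occ X q h z) (hh : h' ≤ h) :
    Occ X q h' z := fun i hi => H i (hi.trans_le hh)

/-- An occurrence of length `l` without another one at most `G` positions before. -/
def Special (X : ℤ → ℕ) (q : ℕ → ℕ) (l G : ℕ) (z : ℤ) : Prop :=
  Occ X q l z ∧ ∀ d : ℕ, 0 < d → d ≤ G → ¬ Occ X q l (z - d)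

/-- The string given by the first `N` values of `q` has least period `r`, and `r < l ≤ N`. -/
structure LeastPeriod (q : ℕ → ℕ) (N l r : ℕ) : Prop where
  pos : 0 < r
  lt : r < l
  le : l ≤ N
  per : ∀ i, i + r < N → q i = q (i + r)
  least : ∀ d, 0 < d → (∀ i, i + d < N → q i = q (i + d)) → r ≤ d

namespace LeastPeriod

variable {X : ℤ → ℕ} {q : ℕ → ℕ} {N l r : ℕ}

theorem add_mul (h : LeastPeriod q N l r) {i : ℕ} (c : ℕ) (hi : i + c * r < N) :
    q i = q (i + c * r) := by
  induction c with
  | zero => simp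
  | succ c ih =>
    rw [Nat.succ_mul, ← add_assoc] at hi ⊢
    rw [ih (by omega), h.per _ hi]

theorem mod_eq (h : LeastPeriod q N l r) {i : ℕ} (hi : i < N) : q (i % r) = q i := by
  have e : i % r + i / r * r = i := by
    rw [mul_comm]
    exact Nat.mod_add_div i r
  have := h.add_mul (i := i % r) (i / r) (by rwa [e])
  rwa [e] at this

/-- As $r < l$, the indices below $l$ contain a full set of residues modulo $r$; a shift respected
there is respected everywhere by $r$-periodicity. -/
theorem le_of_forall_lt (h : LeastPeriod q N l r) {d : ℕ} (hd : 0 < d)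
    (H : ∀ i < l, i + d < N → q i = q (i + d)) : r ≤ d := by
  refine h.least d hd fun i hi => ?_
  have h1 : i % r < r := Nat.mod_lt _ h.pos
  have h2 : i % r ≤ i := Nat.mod_le _ _
  have h3 := h.lt
  rw [← h.mod_eq (show i < N by omega), H _ (by omega) (by omega), ← h.mod_eq hi,
    ← h.mod_eq (show i % r + d < N by omega)]
  simp

/-- A weak form of Fine–Wilf: one full block of length $r$ and its shift by $d$ fit inside the first
$l$ values, so the local period $d$ is a period of the whole string. -/
theorem le_of_add_le (h : LeastPeriod q N l r) {d : ℕ} (hd : 0 < d) (hdl : d + r ≤ l)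
    (H : ∀ i, i + d < l → q i = q (i + d)) : r ≤ d := by
  refine h.least d hd fun i hi => ?_
  have h1 : i % r < r := Nat.mod_lt _ h.pos
  have h2 : i % r ≤ i := Nat.mod_le _ _
  have h3 := h.le
  rw [← h.mod_eq (show i < N by omega), H _ (by omega), ← h.mod_eq hi,
    ← h.mod_eq (show i % r + d < N by omega)]
  simp

/-- If $d < r$, the two occurrences overlap enough to give the shift relation on all indices below
$l$: either the first one is the entire string, or it extends at least $r > d$ beyond length $l$. -/
theorem le_of_occ (h : LeastPeriod q N l r) {W d : ℕ} {z : ℤ} (hW : W = N ∨ l + r ≤ W)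
    (hz : Occ X q W z) (hd : 0 < d) (hzd : Occ X q l (z - d)) : r ≤ d := by
  by_contra hlt
  refine hlt (h.le_of_forall_lt hd fun i hi hiN => ?_)
  rw [← hz (i + d) (by omega), ← hzd i hi]
  congr 1
  push_cast
  ring

theorem special_of_occ (h : LeastPeriod q N l r) {W G : ℕ} {z : ℤ} (hW : W = N ∨ l + r ≤ W)
    (hz : Occ X q W z) (hG : G < r) : Special X q l G z := by
  have := h.le
  refine ⟨hz.mono (by omega), fun d hd hdG hocc => ?_⟩
  have := h.le_of_occ hW hz hd hocc
  omega

/-- An index $t \ge W$ is moved by a multiple of $r$ into $[W-r, W)$, where it is covered by the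
corresponding member of the chain. -/
theorem occ_of_chain (h : LeastPeriod q N l r) {W c m : ℕ} {z : ℤ} (hW : l ≤ W)
    (hz : ∀ i ≤ c, Occ X q W (z - (i * r : ℕ))) (hm : m ≤ N) (hmW : m ≤ W + c * r) :
    Occ X q m z := by
  intro t ht
  by_cases htW : t < W
  · have := hz 0 (Nat.zero_le _) t htW
    simpa using this
  · have hr := h.pos
    have hrl := h.lt
    have e := Nat.mod_add_div (t - W) r
    have hmod := Nat.mod_lt (t - W) hr
    have hlt : (t - W) / r < c := by
      rw [Nat.div_lt_iff_lt_mul hr]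
      omega
    have e2 : ((t - W) / r + 1) * r = r * ((t - W) / r) + r := by ring
    have h1 := hz ((t - W) / r + 1) hlt (t - ((t - W) / r + 1) * r) (by omega)
    have h2 := h.add_mul (i := t - ((t - W) / r + 1) * r) ((t - W) / r + 1) (by omega)
    have e3 : t - ((t - W) / r + 1) * r + ((t - W) / r + 1) * r = t := by omega
    rw [e3] at h2
    rw [← h2, ← h1]
    congr 1
    omega

theorem occ_sub (h : LeastPeriod q N l r) {c m : ℕ} {z : ℤ} (hz : Occ X q N z)
    (hm : m + c * r ≤ N) : Occ X q m (z - (c * r : ℕ)) := by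
  intro t ht
  rw [h.add_mul c (show t + c * r < N by omega), ← hz (t + c * r) (by omega)]
  congr 1
  push_cast
  ring

/-! ### Runs of occurrences of strings with short period. -/

section Small

variable {G : ℕ}

/-- Occurrences at distance $d \le G$ give the first $l$ values period $d$, and $d + r \le l$. The
part of the shifted occurrence at $z - r$ that sticks out of the one at $z$ is read from the one at
$z - d$. -/
theorem occ_sub_period (h : LeastPeriod q N l r) (hr : r ≤ G) (hG : 2 * G ≤ l) {z : ℤ} {d : ℕ}
    (hz : Occ X q l z) (hd : 0 < d) (hdG : d ≤ G) (hzd : Occ X q l (z - d)) :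
    r ≤ d ∧ Occ X q l (z - r) := by
  have hper : ∀ i, i + d < l → q i = q (i + d) := by
    intro i hi
    rw [← hz (i + d) hi, ← hzd i (by omega)]
    congr 1
    push_cast
    ring
  have hrd : r ≤ d := h.le_of_add_le hd (by omega) hper
  have hlN := h.le
  refine ⟨hrd, fun i hi => ?_⟩
  by_cases hir : i + r < l
  · rw [h.per i (by omega), ← hz (i + r) hir]
    congr 1
    push_cast
    ring
  · have e1 : i + r - d + d = i + r := by omega
    have e2 : i - d + r = i + r - d := by omega
    have h1 := hzd (i + r - d) (by omega)
    have h2 := h.per (i - d) (by omega)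
    have h3 := hper (i - d) (by omega)
    rw [e2] at h2
    rw [show i - d + d = i by omega] at h3
    rw [← h3, h2, ← h1]
    congr 1
    omega

/-- A non-special occurrence has a predecessor within $G$, hence one at distance exactly $r$. This
step cannot jump over $z_0$, since no two occurrences are closer than $r$. The number `n` only
serves the induction. -/
theorem exists_chain (h : LeastPeriod q N l r) (hr : r ≤ G) (hG : 2 * G ≤ l) {z₀ : ℤ} (n : ℕ) :
    ∀ {z : ℤ}, z ≤ z₀ + n → Occ X q l z → Special X q l G z₀ → z₀ ≤ z →
      (∀ y, Special X q l G y → y ≤ z → y ≤ z₀) →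
      ∃ c : ℕ, z = z₀ + (c * r : ℕ) ∧ ∀ i ≤ c, Occ X q l (z - (i * r : ℕ)) := by
  induction n with
  | zero =>
    intro z hn hz _ hle _
    refine ⟨0, by simp at hn ⊢; omega, fun i hi => ?_⟩
    obtain rfl : i = 0 := by omega
    simpa using hz
  | succ n ih =>
    intro z hn hz hz₀ hle hmax
    by_cases hs : Special X q l G z
    · have := hmax z hs le_rfl
      refine ⟨0, by simp; omega, fun i hi => ?_⟩
      obtain rfl : i = 0 := by omega
      simpa using hz
    · have : ∃ d : ℕ, 0 < d ∧ d ≤ G ∧ Occ X q l (z - d) := by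
        by_contra hno
        push Not at hno
        exact hs ⟨hz, hno⟩
      obtain ⟨d, hd, hdG, hzd⟩ := this
      have hzr := (h.occ_sub_period hr hG hz hd hdG hzd).2
      have hpos := h.pos
      have hle' : z₀ ≤ z - r := by
        by_contra hlt
        have hne : z₀ ≠ z := fun e => hs (e ▸ hz₀)
        obtain ⟨e, he⟩ : ∃ e : ℕ, z - z₀ = e := ⟨(z - z₀).toNat, by omega⟩
        have hze : z₀ = z - e := by omega
        have := (h.occ_sub_period hr hG hz (d := e) (by omega) (by omega) (hze ▸ hz₀.1)).1
        omega
      obtain ⟨c, hc, hcocc⟩ := ih (z := z - r) (by push_cast at hn; omega) hzr hz₀ hle'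
        (fun y hy hyz => hmax y hy (by omega))
      refine ⟨c + 1, ?_, fun i hi => ?_⟩
      · rw [Nat.succ_mul]
        push_cast at hc ⊢
        omega
      · cases i with
        | zero => simpa using hz
        | succ i =>
          have := hcocc i (by omega)
          rw [Nat.succ_mul]
          push_cast at this ⊢
          rwa [show z - (i * r + r : ℤ) = z - r - i * r by ring]

open Classical in
-- The run from $z_0$ to $z$ covers $l + (z - z_0)$ values. A longer string can reach back beyond
-- the run only by less than a period, since $z_0$ is special; the excess is then $(N-l) \bmod r$,
-- which is what the test at $z_0$ checks.
theorem occ_iff_of_small (h : LeastPeriod q N l r) (hr : r ≤ G) (hG : 2 * G ≤ l) {z₀ z : ℤ}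
    (hz : Occ X q l z) (hz₀ : Special X q l G z₀) (hle : z₀ ≤ z)
    (hmax : ∀ y, Special X q l G y → y ≤ z → y ≤ z₀) :
    Occ X q N z ↔
      (N : ℤ) ≤ l + (z - z₀) + (if Occ X q (l + (N - l) % r) z₀ then (N - l) % r else 0 : ℕ) := by
  obtain ⟨c, hc, hocc⟩ := h.exists_chain hr hG (z₀ := z₀) (z - z₀).toNat (by omega) hz hz₀ hle hmax
  have hpos := h.pos
  have hlN := h.le
  have e := Nat.mod_add_div (N - l) r
  have hmod := Nat.mod_lt (N - l) hpos
  set s := (N - l) % r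
  set t := (N - l) / r
  constructor
  · intro hN
    by_contra hlt
    have hcN : l + c * r < N := by
      have : (0 : ℤ) ≤ ((if Occ X q (l + s) z₀ then s else 0 : ℕ) : ℤ) := Nat.cast_nonneg _
      omega
    -- Otherwise the occurrence would contain $u$ ending $r$ positions before $z_0$.
    have htc : t ≤ c := by
      by_contra hct
      have h1 : (c + 1) * r ≤ r * t := by
        rw [mul_comm]
        exact Nat.mul_le_mul_left _ (by omega)
      have h2 : Occ X q l (z - ((c + 1) * r : ℕ)) := h.occ_sub hN (by omega)
      refine hz₀.2 r hpos hr ?_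
      rw [Nat.succ_mul] at h2
      rwa [show z₀ - (r : ℤ) = z - ((c * r + r : ℕ) : ℤ) by push_cast at hc ⊢; omega]
    have htc' : t = c := by
      refine le_antisymm htc ?_
      by_contra hct
      have h1 : r * (t + 1) ≤ c * r := by
        rw [mul_comm c]
        exact Nat.mul_le_mul_left _ (by omega)
      rw [Nat.mul_succ] at h1
      omega
    rw [htc', mul_comm] at e
    have h2 : Occ X q (l + s) (z - (c * r : ℕ)) := h.occ_sub hN (by omega)
    rw [show z - ((c * r : ℕ) : ℤ) = z₀ by omega] at h2
    rw [if_pos h2] at hlt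
    omega
  · intro hN
    by_cases hw : Occ X q (l + s) z₀
    · rw [if_pos hw] at hN
      have htc : t ≤ c := by
        by_contra hct
        have h1 : (c + 1) * r ≤ r * t := by
          rw [mul_comm]
          exact Nat.mul_le_mul_left _ (by omega)
        rw [Nat.succ_mul] at h1
        omega
      intro i hi
      by_cases hil : i < l + c * r
      · exact h.occ_of_chain le_rfl hocc (show min N (l + c * r) ≤ N by omega) (by omega) i
          (by omega)
      · have h1 := hw (i - c * r) (by omega)
        have h2 := h.add_mul (i := i - c * r) c (by omega)
        rw [show i - c * r + c * r = i by omega] at h2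
        rw [← h2, ← h1]
        congr 1
        omega
    · rw [if_neg hw] at hN
      exact h.occ_of_chain le_rfl hocc le_rfl (by push_cast at hN; omega)

/-- Both periods are at most $l/2$ and act on the same $l$ values, so they coincide. Read backwards,
the two strings continue the same periodic sequence, and the shorter is contained in the longer. -/
theorem occ_of_occ_of_small {q' : ℕ → ℕ} {N' r' : ℕ} (h : LeastPeriod q N l r)
    (h' : LeastPeriod q' N' l r') (hr : r ≤ G) (hr' : r' ≤ G) (hG : 2 * G ≤ l)
    (hq : ∀ i < l, q i = q' i) (hN : N ≤ N') {z : ℤ} (hz : Occ X q' N' z) : Occ X q N z := by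
  have hlN := h.le
  have hlN' := h'.le
  have e : r = r' := by
    refine le_antisymm ?_ ?_
    · refine h.le_of_add_le h'.pos (by omega) fun i hi => ?_
      rw [hq i (by omega), hq _ hi]
      exact h'.per i (by omega)
    · refine h'.le_of_add_le h.pos (by omega) fun i hi => ?_
      rw [← hq i (by omega), ← hq _ hi]
      exact h.per i (by omega)
  intro i hi
  have hm := Nat.mod_lt i h.pos
  have hl := h.lt
  rw [hz i (by omega), ← h.mod_eq hi, ← h'.mod_eq (by omega), ← e]
  exact (hq _ (by omega)).symm

end Small

end LeastPeriod


/-! ### Fingerprints -/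

/-- Fingerprint of the first `h` values of `q`. -/
def fp (p : ℕ) (r : ZMod p) (q : ℕ → ℕ) (h : ℕ) : ZMod p :=
  ∑ i ∈ Finset.range h, (q i : ZMod p) * r ^ i

/-- The text read backwards from position `z`. -/
def window (X : ℤ → ℕ) (z : ℤ) : ℕ → ℕ := fun i => X (z - i)

theorem fp_congr {p : ℕ} {r : ZMod p} {a b : ℕ → ℕ} {h : ℕ} (H : ∀ i < h, a i = b i) :
    fp p r a h = fp p r b h :=
  Finset.sum_congr rfl fun i hi => by rw [H i (Finset.mem_range.1 hi)]

theorem Occ.fp_eq {p : ℕ} {r : ZMod p} {X : ℤ → ℕ} {q : ℕ → ℕ} {h : ℕ} {z : ℤ}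
    (H : Occ X q h z) : fp p r (window X z) h = fp p r q h := fp_congr H

/-- Fingerprint of the prefix of the text that ends at position `t`. -/
def prefixFp (p : ℕ) (r : ZMod p) (X : ℤ → ℕ) (t : ℕ) : ZMod p := fp p r (window X t) (t + 1)

/-- Reading backwards makes the newest character the constant coefficient, so appending is a Horner
step. -/
theorem prefixFp_succ {p : ℕ} {r : ZMod p} {X : ℤ → ℕ} (t : ℕ) :
    prefixFp p r X (t + 1) = prefixFp p r X t * r + X ((t : ℤ) + 1) := by
  simp only [prefixFp, fp]
  rw [Finset.sum_range_succ' _ (t + 1), Finset.sum_mul]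
  congr 1
  · refine Finset.sum_congr rfl fun i _ => ?_
    have e : window X ((t + 1 : ℕ) : ℤ) (i + 1) = window X t i := by
      simp only [window]
      congr 1
      push_cast
      ring
    rw [e, pow_succ, ← mul_assoc]
  · simp [window]

/-- The window occupies the low coefficients, so its fingerprint is found from two prefix
fingerprints without division. -/
theorem prefixFp_add {p : ℕ} {r : ZMod p} {X : ℤ → ℕ} (t h : ℕ) :
    prefixFp p r X (t + h) = fp p r (window X ((t + h : ℕ) : ℤ)) h + r ^ h * prefixFp p r X t := by
  simp only [prefixFp, fp]
  rw [show t + h + 1 = h + (t + 1) by ring, Finset.sum_range_add, Finset.mul_sum]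
  congr 1
  refine Finset.sum_congr rfl fun i _ => ?_
  have e : window X ((t + h : ℕ) : ℤ) (h + i) = window X t i := by
    simp only [window]
    congr 1
    push_cast
    ring
  rw [e, pow_add]
  ring

theorem prefixFp_eq_zero {p : ℕ} {r : ZMod p} {X : ℤ → ℕ} {t : ℕ} (h : ∀ z : ℤ, z ≤ t → X z = 0) :
    prefixFp p r X t = 0 := by
  rw [prefixFp, fp]
  refine Finset.sum_eq_zero fun i _ => ?_
  simp only [window]
  rw [h _ (by omega)]
  simp

theorem natCast_inj_of_lt {p a b : ℕ} (ha : a < p) (hb : b < p) (h : (a : ZMod p) = b) : a = b := by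
  rw [ZMod.natCast_eq_natCast_iff', Nat.mod_eq_of_lt ha, Nat.mod_eq_of_lt hb] at h
  exact h

/-- The difference is a polynomial in the base. It is nonzero because the values are below $p$, so
it has no more roots than its degree. -/
theorem card_fp_eq_le {p : ℕ} [hp : Fact p.Prime] {a b : ℕ → ℕ} {h : ℕ} (ha : ∀ i < h, a i < p)
    (hb : ∀ i < h, b i < p) (hab : ∃ i < h, a i ≠ b i) :
    (Finset.univ.filter fun s : Fin p => fp p ((s : ℕ) : ZMod p) a h = fp p ((s : ℕ) : ZMod p) b h).card
      ≤ h := by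
  set P : Polynomial (ZMod p) :=
    ∑ i ∈ Finset.range h, Polynomial.monomial i ((a i : ZMod p) - b i) with hP
  have hcoeff : ∀ i < h, P.coeff i = (a i : ZMod p) - b i := by
    intro i hi
    rw [hP, Polynomial.finsetSum_coeff]
    simp only [Polynomial.coeff_monomial]
    rw [Finset.sum_ite_eq' (Finset.range h) i, if_pos (Finset.mem_range.2 hi)]
  have hP0 : P ≠ 0 := by
    obtain ⟨i, hi, hne⟩ := hab
    intro h0
    have := hcoeff i hi
    rw [h0, Polynomial.coeff_zero] at this
    exact hne (natCast_inj_of_lt (ha i hi) (hb i hi) (sub_eq_zero.1 this.symm))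
  have hdeg : P.natDegree ≤ h := by
    refine Polynomial.natDegree_sum_le_of_forall_le _ _ fun i hi => ?_
    exact (Polynomial.natDegree_monomial_le _).trans (Finset.mem_range.1 hi).le
  have heval : ∀ r : ZMod p, P.eval r = fp p r a h - fp p r b h := by
    intro r
    rw [hP, Polynomial.eval_finsetSum, fp, fp, ← Finset.sum_sub_distrib]
    exact Finset.sum_congr rfl fun i _ => by rw [Polynomial.eval_monomial, sub_mul]
  calc _ ≤ P.roots.toFinset.card := by
        refine Finset.card_le_card_of_injOn (fun s => ((s : ℕ) : ZMod p)) ?_ ?_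
        · intro s hs
          have hs' := (Finset.mem_filter.1 (Finset.mem_coe.1 hs)).2
          rw [Finset.mem_coe, Multiset.mem_toFinset, Polynomial.mem_roots hP0, Polynomial.IsRoot,
            heval, hs', sub_self]
        · intro s _ t _ hst
          exact Fin.ext (natCast_inj_of_lt s.2 t.2 hst)
    _ ≤ P.roots.card := Multiset.toFinset_card_le _
    _ ≤ P.natDegree := Polynomial.card_roots' _
    _ ≤ h := hdeg

theorem card_exists_collision_le {ι : Type*} {p : ℕ} [hp : Fact p.Prime] (T : Finset ι)
    (a b : ι → ℕ → ℕ) (h : ι → ℕ) {B : ℕ} (hB : ∀ i ∈ T, h i ≤ B)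
    (ha : ∀ i ∈ T, ∀ t < h i, a i t < p) (hb : ∀ i ∈ T, ∀ t < h i, b i t < p) :
    Nat.card {s : Fin p // ∃ i ∈ T, (∃ t < h i, a i t ≠ b i t) ∧
      fp p ((s : ℕ) : ZMod p) (a i) (h i) = fp p ((s : ℕ) : ZMod p) (b i) (h i)} ≤ T.card * B := by
  classical
  rw [Nat.card_eq_fintype_card, Fintype.card_subtype]
  calc _ ≤ (T.biUnion fun i => Finset.univ.filter fun s : Fin p => (∃ t < h i, a i t ≠ b i t) ∧
        fp p ((s : ℕ) : ZMod p) (a i) (h i) = fp p ((s : ℕ) : ZMod p) (b i) (h i)).card := by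
        refine Finset.card_le_card fun s hs => ?_
        obtain ⟨i, hi, hs⟩ := (Finset.mem_filter.1 hs).2
        exact Finset.mem_biUnion.2 ⟨i, hi, Finset.mem_filter.2 ⟨Finset.mem_univ _, hs⟩⟩
    _ ≤ T.card * B := by
        refine Finset.card_biUnion_le_card_mul _ _ _ fun i hi => ?_
        by_cases hne : ∃ t < h i, a i t ≠ b i t
        · refine le_trans (Finset.card_le_card fun s hs => ?_)
            ((card_fp_eq_le (ha i hi) (hb i hi) hne).trans (hB i hi))
          exact Finset.mem_filter.2 ⟨Finset.mem_univ _, ((Finset.mem_filter.1 hs).2).2⟩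
        · simp [hne]


/-! ### The streaming algorithm -/

/-- Precomputed data: the fingerprint modulus and base, a two-level hash table for fingerprints of
strings of lengths `l` and `2 * l`, and data for every pattern. -/
structure Params where
  p : ℕ
  base : ℕ
  l : ℕ
  k : ℕ
  pow1 : ℕ
  pow2 : ℕ
  mul1 : ℕ
  size1 : ℕ
  mult : ℕ → ℕ
  size : ℕ → ℕ
  off : ℕ → ℕ
  key : ℕ → ℕ
  small : ℕ → ℕ
  urec : ℕ → ℕ
  trec : ℕ → ℕ
  woff : ℕ → ℕ
  wpow : ℕ → ℕ
  wfp : ℕ → ℕ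
  per : ℕ → ℕ
  need : ℕ → ℕ
  len : ℕ → ℕ
  rest : ℕ → ℕ

/-- The part of the memory that changes. -/
structure State where
  time : ℕ
  hash : ℕ
  ring : ℕ → ℕ
  last : ℕ → ℕ
  start : ℕ → ℕ
  mark : ℕ → ℕ
  don : ℕ → ℕ
  lg : ℕ → ℕ
  first : ℕ → ℕ

namespace Params

/-- Table position of a fingerprint. -/
def slot (P : Params) (f : ℕ) : ℕ := hashSlot P.p P.mul1 P.size1 P.mult P.size P.off f

/-- Largest gap between consecutive members of a run of occurrences. -/
def gap (P : Params) : ℕ := P.l / 2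

/-- Delay with which occurrences of strings of length `l` are processed. -/
def delay (P : Params) : ℕ := P.l - P.l / 2

/-- Append a character to the text. -/
def push (P : Params) (a : ℕ) (s : State) : State :=
  { s with
    time := s.time + 1
    hash := (s.hash * P.base + (a + 1)) % P.p
    ring := Function.update s.ring (1 + (s.time + 1) % (5 * P.l))
      ((s.hash * P.base + (a + 1)) % P.p) }

/-- Fingerprint of the `h` characters that end at position `y`. -/
def win (P : Params) (s : State) (y pow h : ℕ) : ℕ :=
  (s.ring (1 + y % (5 * P.l)) +
    (P.p - s.ring (1 + (y + 5 * P.l - h) % (5 * P.l)) * pow % P.p)) % P.p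

/-- Does some pattern end at the current position? -/
def Answer (P : Params) (s : State) : Prop :=
  let f := P.win s s.time P.pow2 (2 * P.l)
  let t := P.slot f
  let z := s.time - P.l
  let j := P.small t
  let a := P.urec j
  -- The mark reports patterns with long period; the inequality is the criterion of
  -- `LeastPeriod.occ_iff_of_small` for the shortest short-period pattern of this class.
  P.key t = f ∧ (s.mark t = z ∨
    P.len j + s.start a ≤ z + (if s.lg j = s.start a then 1 else 0) * P.rest j)

/-- Record an occurrence of a string of length `l`. -/
def look (P : Params) (s : State) : State :=
  let y := s.time - P.delay
  let f := P.win s y P.pow1 P.l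
  let t := P.slot f
  if P.key t = f then
    { s with
      last := Function.update s.last t y
      start := if s.last t + P.gap < y then Function.update s.start t y else s.start }
  else s

/-- The fingerprint test for the suffix of the prefix of pattern `j` at position `z`. -/
def Test (P : Params) (s : State) (j z : ℕ) : Prop :=
  s.ring (1 + z % (5 * P.l)) =
    (s.ring (1 + (z + P.woff j) % (5 * P.l)) * P.wpow j + P.wfp j) % P.p

instance (P : Params) (s : State) (j z : ℕ) : Decidable (P.Test s j z) :=
  inferInstanceAs (Decidable (_ = _))

/-- Update the start of the run of pattern `j` after a successful test at `z`. -/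
def sweepFirst (P : Params) (s : State) (j z : ℕ) : ℕ → ℕ :=
  if s.lg j + P.per j = z then s.first else Function.update s.first j z

/-- Process one pattern, chosen in turn. -/
def sweep (P : Params) (s : State) : State :=
  let j := s.time % P.k + 1
  let z := s.start (P.urec j)
  if s.don j = z then s
  else if P.Test s j z then
    { s with
      don := Function.update s.don j z
      lg := Function.update s.lg j z
      first := P.sweepFirst s j z
      mark := if P.sweepFirst s j z j + P.need j ≤ z
        then Function.update s.mark (P.trec j) z else s.mark }
  else { s with don := Function.update s.don j z }

end Params

/-! ### Hypotheses and invariants for the correctness of the algorithm. -/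

/-- The string `a` without its first `l` values. -/
def tailFrom (l : ℕ) (a : ℕ → ℕ) : ℕ → ℕ := fun i => a (l + i)

theorem occ_add_iff {X : ℤ → ℕ} {a : ℕ → ℕ} {l N : ℕ} {z : ℤ} (hN : l ≤ N) :
    Occ X a (l + N) z ↔ Occ X a (2 * l) z ∧ Occ X (tailFrom l a) N (z - l) := by
  constructor
  · refine fun h => ⟨h.mono (by omega), fun i hi => ?_⟩
    rw [tailFrom, ← h (l + i) (by omega)]
    congr 1
    push_cast
    ring
  · rintro ⟨h1, h2⟩ i hi
    by_cases hil : i < 2 * l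
    · exact h1 i hil
    · have := h2 (i - l) (by omega)
      rw [tailFrom, show l + (i - l) = i by omega] at this
      rw [← this]
      congr 1
      omega

/-- The data in `P` belong to the reversed patterns `pat 1, …, pat k`, of lengths `l + N j`, and no
fingerprint collision occurs on the text `X` up to position `T`. -/
structure Setup (P : Params) (X : ℤ → ℕ) (T : ℕ) (pat : ℕ → ℕ → ℕ) (N W : ℕ → ℕ) : Prop where
  prime : Fact P.p.Prime
  k_pos : 1 ≤ P.k
  k_le : P.k ≤ P.l / 2
  -- Zero padding together with nonzero pattern characters removes all boundary cases at the
  -- beginning of the text.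
  text_zero : ∀ z : ℤ, z < 8 * P.l → X z = 0
  pat_pos : ∀ j, 1 ≤ j → j ≤ P.k → ∀ i < P.l + N j, 1 ≤ pat j i
  leastPeriod : ∀ j, 1 ≤ j → j ≤ P.k →
    LeastPeriod (tailFrom P.l (pat j)) (N j) P.l (P.per j)
  W_le : ∀ j, 1 ≤ j → j ≤ P.k → W j ≤ N j
  le_W : ∀ j, 1 ≤ j → j ≤ P.k → P.l ≤ W j
  W_lt : ∀ j, 1 ≤ j → j ≤ P.k → W j < 3 * P.l
  W_dvd : ∀ j, 1 ≤ j → j ≤ P.k → P.per j ∣ N j - W j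
  -- This is what makes every successful test of a long-period pattern special, through
  -- `LeastPeriod.special_of_occ`.
  W_large : ∀ j, 1 ≤ j → j ≤ P.k → P.gap < P.per j → W j = N j ∨ P.l + P.per j ≤ W j
  W_small : ∀ j, 1 ≤ j → j ≤ P.k → P.per j ≤ P.gap → W j = P.l + (N j - P.l) % P.per j
  need_eq : ∀ j, 1 ≤ j → j ≤ P.k → P.need j = N j - W j
  woff_eq : ∀ j, 1 ≤ j → j ≤ P.k → P.woff j = 5 * P.l - W j
  wpow_eq : ∀ j, 1 ≤ j → j ≤ P.k → P.wpow j = ((P.base : ZMod P.p) ^ W j).val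
  wfp_eq : ∀ j, 1 ≤ j → j ≤ P.k →
    P.wfp j = (fp P.p P.base (tailFrom P.l (pat j)) (W j)).val
  len_eq : ∀ j, 1 ≤ j → j ≤ P.k → P.len j = N j - P.l
  rest_eq : ∀ j, 1 ≤ j → j ≤ P.k → P.rest j = (N j - P.l) % P.per j
  pow1_eq : P.pow1 = ((P.base : ZMod P.p) ^ P.l).val
  pow2_eq : P.pow2 = ((P.base : ZMod P.p) ^ (2 * P.l)).val
  urec_eq : ∀ j, 1 ≤ j → j ≤ P.k →
    P.urec j = P.slot (fp P.p P.base (tailFrom P.l (pat j)) P.l).val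
  trec_eq : ∀ j, 1 ≤ j → j ≤ P.k → P.trec j = P.slot (fp P.p P.base (pat j) (2 * P.l)).val
  key_urec : ∀ j, 1 ≤ j → j ≤ P.k →
    P.key (P.urec j) = (fp P.p P.base (tailFrom P.l (pat j)) P.l).val
  key_trec : ∀ j, 1 ≤ j → j ≤ P.k → P.key (P.trec j) = (fp P.p P.base (pat j) (2 * P.l)).val
  -- The second alternative is a dummy pattern for classes without short periods: its required
  -- length exceeds every position.
  small_spec : ∀ t, (1 ≤ P.small t ∧ P.small t ≤ P.k ∧ P.trec (P.small t) = t ∧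
    P.per (P.small t) ≤ P.gap) ∨ (T ≤ P.len (P.small t) ∧ P.rest (P.small t) = 0)
  small_le : ∀ j, 1 ≤ j → j ≤ P.k → P.per j ≤ P.gap →
    1 ≤ P.small (P.trec j) ∧ P.small (P.trec j) ≤ P.k ∧
      P.trec (P.small (P.trec j)) = P.trec j ∧ P.per (P.small (P.trec j)) ≤ P.gap ∧
      N (P.small (P.trec j)) ≤ N j
  -- Only false positives have to be excluded; true occurrences always have equal fingerprints.
  good_u : ∀ j, 1 ≤ j → j ≤ P.k → ∀ z : ℕ, 7 * P.l ≤ z → z < T →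
    fp P.p P.base (window X z) P.l = fp P.p P.base (tailFrom P.l (pat j)) P.l →
    Occ X (tailFrom P.l (pat j)) P.l z
  good_t : ∀ j, 1 ≤ j → j ≤ P.k → ∀ z : ℕ, 7 * P.l ≤ z → z < T →
    fp P.p P.base (window X z) (2 * P.l) = fp P.p P.base (pat j) (2 * P.l) →
    Occ X (pat j) (2 * P.l) z
  good_w : ∀ j, 1 ≤ j → j ≤ P.k → ∀ z : ℕ, 7 * P.l ≤ z → z < T →
    fp P.p P.base (window X z) (W j) = fp P.p P.base (tailFrom P.l (pat j)) (W j) →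
    Occ X (tailFrom P.l (pat j)) (W j) z

/-- The stored fingerprints are those of the text up to position `x`. -/
structure HashInv (P : Params) (X : ℤ → ℕ) (x : ℕ) (s : State) : Prop where
  time : s.time = x
  hash : s.hash = (prefixFp P.p P.base X x).val
  ring : ∀ t ≤ x, x < t + 5 * P.l → s.ring (1 + t % (5 * P.l)) = (prefixFp P.p P.base X t).val

/-- Occurrences of strings of length `l` up to position `x - delay` have been recorded. -/
structure LookInv (P : Params) (X : ℤ → ℕ) (pat : ℕ → ℕ → ℕ) (x : ℕ) (s : State) (j : ℕ) :
    Prop where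
  le_last : ∀ y : ℕ, y + P.delay ≤ x → Occ X (tailFrom P.l (pat j)) P.l y →
    y ≤ s.last (P.urec j)
  last : s.last (P.urec j) = 0 ∨
    Occ X (tailFrom P.l (pat j)) P.l (s.last (P.urec j)) ∧ s.last (P.urec j) + P.delay ≤ x
  le_start : ∀ y : ℕ, y + P.delay ≤ x → Special X (tailFrom P.l (pat j)) P.l P.gap y →
    y ≤ s.start (P.urec j)
  start : s.start (P.urec j) = 0 ∨
    Special X (tailFrom P.l (pat j)) P.l P.gap (s.start (P.urec j)) ∧
      s.start (P.urec j) + P.delay ≤ x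

/-- State of pattern `j` after position `x`. -/
structure SweepInv (P : Params) (X : ℤ → ℕ) (pat : ℕ → ℕ → ℕ) (N W : ℕ → ℕ) (x : ℕ) (s : State)
    (j : ℕ) : Prop where
  -- The number `v` is the last turn of pattern `j`, fewer than `k` arrivals ago.
  visit : ∃ v ≤ x, x < v + P.k ∧ v % P.k + 1 = j ∧
    ∀ y : ℕ, y + P.delay ≤ v → Special X (tailFrom P.l (pat j)) P.l P.gap y → y ≤ s.don j
  don : s.don j = 0 ∨
    Special X (tailFrom P.l (pat j)) P.l P.gap (s.don j) ∧ s.don j + P.delay ≤ x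
  lg : s.lg j = 0 ∨ Special X (tailFrom P.l (pat j)) P.l P.gap (s.lg j) ∧
    Occ X (tailFrom P.l (pat j)) (W j) (s.lg j) ∧ s.lg j ≤ s.don j
  le_lg : ∀ y : ℕ, y ≤ s.don j → Special X (tailFrom P.l (pat j)) P.l P.gap y →
    Occ X (tailFrom P.l (pat j)) (W j) y → y ≤ s.lg j
  chain : s.lg j ≠ 0 → ∃ i, s.lg j = s.first j + i * P.per j ∧
    ∀ i' ≤ i, Occ X (tailFrom P.l (pat j)) (W j) (s.lg j - (i' * P.per j : ℕ))
  first : s.lg j ≠ 0 → P.gap < P.per j →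
    ¬ (Special X (tailFrom P.l (pat j)) P.l P.gap ((s.first j : ℤ) - P.per j) ∧
      Occ X (tailFrom P.l (pat j)) (W j) ((s.first j : ℤ) - P.per j))
  -- Patterns sharing a table entry may overwrite each other's marks; the proviso ensures that they
  -- then write the same position.
  mark : (∀ j', 1 ≤ j' → j' ≤ P.k → P.trec j' = P.trec j → P.urec j' = P.urec j) →
    P.gap < P.per j → s.don j = s.start (P.urec j) →
    Occ X (tailFrom P.l (pat j)) (N j) (s.don j) → s.mark (P.trec j) = s.don j

/-- Every mark is justified by an occurrence. -/
def MarkInv (P : Params) (X : ℤ → ℕ) (pat : ℕ → ℕ → ℕ) (N : ℕ → ℕ) (s : State) : Prop :=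
  ∀ t, s.mark t = 0 ∨ ∃ j, 1 ≤ j ∧ j ≤ P.k ∧ P.trec j = t ∧
    Occ X (tailFrom P.l (pat j)) (N j) (s.mark t)

namespace Setup

variable {P : Params} {X : ℤ → ℕ} {T : ℕ} {pat : ℕ → ℕ → ℕ} {N W : ℕ → ℕ}

theorem two_le_l (S : Setup P X T pat N W) : 2 ≤ P.l := by
  have := S.k_pos
  have := S.k_le
  omega

theorem pos_of_occ (S : Setup P X T pat N W) {j : ℕ} (hj : 1 ≤ j) (hjk : j ≤ P.k) {h : ℕ} {z : ℤ}
    (hh : 1 ≤ h) (hz : Occ X (tailFrom P.l (pat j)) h z) : 8 * (P.l : ℤ) ≤ z := by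
  by_contra hlt
  have h1 := hz 0 hh
  have h2 := (S.leastPeriod j hj hjk).le
  have h3 := S.two_le_l
  have h4 := S.pat_pos j hj hjk (P.l + 0) (by omega)
  rw [S.text_zero _ (by simp; omega)] at h1
  simp only [tailFrom] at h1
  omega

theorem val_inj (S : Setup P X T pat N W) {a b : ZMod P.p} : a.val = b.val ↔ a = b := by
  have := S.prime
  exact (ZMod.val_injective _).eq_iff

theorem cast_val (S : Setup P X T pat N W) (a : ZMod P.p) : (a.val : ZMod P.p) = a := by
  have := S.prime
  simp

theorem mod_eq_val (S : Setup P X T pat N W) {m : ℕ} {a : ZMod P.p} (h : (m : ZMod P.p) = a) :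
    m % P.p = a.val := by
  rw [← h, ZMod.val_natCast]

theorem hashInv_push (S : Setup P X T pat N W) {x a : ℕ} {s : State} (h : HashInv P X x s)
    (ha : X ((x : ℤ) + 1) = a + 1) : HashInv P X (x + 1) (P.push a s) := by
  have e : (s.hash * P.base + (a + 1)) % P.p = (prefixFp P.p P.base X (x + 1)).val := by
    refine S.mod_eq_val ?_
    rw [prefixFp_succ, ha, h.hash]
    push_cast [S.cast_val]
    rfl
  have hl := S.two_le_l
  refine ⟨by simp [Params.push, h.time], e, fun t ht hxt => ?_⟩
  simp only [Params.push]
  rw [e, h.time]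
  by_cases htx : t = x + 1
  · rw [htx, Function.update_self]
  · rw [Function.update_of_ne]
    · exact h.ring t (by omega) (by omega)
    · intro heq
      have h1 : t % (5 * P.l) = (x + 1) % (5 * P.l) := by omega
      have h2 := (Nat.modEq_iff_dvd' (show t ≤ x + 1 by omega)).1 h1
      have := Nat.le_of_dvd (by omega) h2
      omega

theorem win_eq (S : Setup P X T pat N W) {x y h : ℕ} {s : State} (H : HashInv P X x s)
    (hy : y ≤ x) (hhy : h ≤ y) (hxy : x + h < y + 5 * P.l) {pow : ℕ}
    (hpow : pow = ((P.base : ZMod P.p) ^ h).val) :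
    P.win s y pow h = (fp P.p P.base (window X y) h).val := by
  have hp := S.prime.out.pos
  rw [Params.win, show y + 5 * P.l - h = (y - h) + 5 * P.l by omega, Nat.add_mod_right,
    H.ring y hy (by omega), H.ring (y - h) (by omega) (by omega), hpow]
  refine S.mod_eq_val ?_
  rw [Nat.cast_add, Nat.cast_sub (Nat.mod_lt _ hp).le]
  push_cast [S.cast_val, ZMod.natCast_mod]
  have := prefixFp_add (p := P.p) (r := P.base) (X := X) (y - h) h
  rw [show y - h + h = y by omega] at this
  rw [this, ZMod.natCast_self]
  ring

/-- Since $W < 3l$ and $x < z + l$, both prefix fingerprints needed are still among the last $5l$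
stored ones. -/
theorem test_iff (S : Setup P X T pat N W) {x z j : ℕ} {s : State} (H : HashInv P X x s)
    (hj : 1 ≤ j) (hjk : j ≤ P.k) (hz : z ≤ x) (h7 : 7 * P.l ≤ z) (hzT : z < T)
    (hxz : x < z + P.l) :
    P.Test s j z ↔ Occ X (tailFrom P.l (pat j)) (W j) z := by
  have hp := S.prime.out.pos
  have hW := S.W_lt j hj hjk
  have key : P.Test s j z ↔ fp P.p P.base (window X z) (W j) =
      fp P.p P.base (tailFrom P.l (pat j)) (W j) := by
    rw [Params.Test, S.woff_eq j hj hjk, show z + (5 * P.l - W j) = (z - W j) + 5 * P.l by omega,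
      Nat.add_mod_right, H.ring z hz (by omega), H.ring (z - W j) (by omega) (by omega),
      S.wpow_eq j hj hjk, S.wfp_eq j hj hjk]
    have h1 := prefixFp_add (p := P.p) (r := P.base) (X := X) (z - W j) (W j)
    rw [show z - W j + W j = z by omega] at h1
    rw [S.mod_eq_val (a := prefixFp P.p P.base X (z - W j) * P.base ^ W j +
      fp P.p P.base (tailFrom P.l (pat j)) (W j)) (by push_cast [S.cast_val]; rfl), S.val_inj, h1]
    constructor
    · intro h
      linear_combination h
    · intro h
      linear_combination h
  rw [key]
  exact ⟨S.good_w j hj hjk z h7 hzT, Occ.fp_eq⟩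

/-! #### Recording occurrences -/

/-- Without collisions, the entry of the string of pattern `j` is changed exactly when that string
occurs at the delayed position. -/
theorem look_spec (S : Setup P X T pat N W) {x j : ℕ} {s : State} (H : HashInv P X x s)
    (hj : 1 ≤ j) (hjk : j ≤ P.k) (hx : 8 * P.l ≤ x) (hxT : x < T) :
    (Occ X (tailFrom P.l (pat j)) P.l (x - P.delay : ℕ) →
      (P.look s).last (P.urec j) = x - P.delay ∧
      (P.look s).start (P.urec j) = if s.last (P.urec j) + P.gap < x - P.delay then x - P.delay
        else s.start (P.urec j)) ∧
    (¬ Occ X (tailFrom P.l (pat j)) P.l (x - P.delay : ℕ) →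
      (P.look s).last (P.urec j) = s.last (P.urec j) ∧
      (P.look s).start (P.urec j) = s.start (P.urec j)) := by
  have hd : P.delay ≤ P.l := Nat.sub_le _ _
  have hl := S.two_le_l
  have hwin := S.win_eq H (y := x - P.delay) (h := P.l) (by omega) (by omega) (by omega) S.pow1_eq
  simp only [Params.look, H.time, hwin]
  set f := (fp P.p P.base (window X (x - P.delay : ℕ)) P.l) with hf
  constructor
  · intro hocc
    have e : f = fp P.p P.base (tailFrom P.l (pat j)) P.l := hocc.fp_eq
    rw [e, ← S.urec_eq j hj hjk, if_pos (S.key_urec j hj hjk)]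
    simp only [Function.update_self, true_and]
    split_ifs <;> simp
  · intro hocc
    split_ifs with hkey h2
    · have hne : P.urec j ≠ P.slot f.val := by
        intro h
        rw [← h, S.key_urec j hj hjk, S.val_inj] at hkey
        exact hocc (S.good_u j hj hjk _ (by omega) (by omega) hkey.symm)
      simp [Function.update_of_ne hne]
    · have hne : P.urec j ≠ P.slot f.val := by
        intro h
        rw [← h, S.key_urec j hj hjk, S.val_inj] at hkey
        exact hocc (S.good_u j hj hjk _ (by omega) (by omega) hkey.symm)
      simp [Function.update_of_ne hne]
    · simp

/-- Remembering the last occurrence is enough to recognise special ones: it is the closest earlier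
occurrence. -/
theorem lookInv_look (S : Setup P X T pat N W) {x j : ℕ} {s : State}
    (H : HashInv P X (x + 1) s) (hj : 1 ≤ j) (hjk : j ≤ P.k) (hx : 8 * P.l ≤ x + 1)
    (hxT : x + 1 < T) (h : LookInv P X pat x s j) : LookInv P X pat (x + 1) (P.look s) j := by
  have hd : P.delay ≤ P.l := Nat.sub_le _ _
  have hg : P.gap ≤ P.l := Nat.div_le_self _ _
  have hl := S.two_le_l
  obtain ⟨h1, h2⟩ := S.look_spec H hj hjk hx hxT
  set y := x + 1 - P.delay with hy
  by_cases hocc : Occ X (tailFrom P.l (pat j)) P.l (y : ℕ)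
  · obtain ⟨e1, e2⟩ := h1 hocc
    have hlast : s.last (P.urec j) < y := by
      rcases h.last with h0 | h0
      · omega
      · omega
    refine ⟨fun y' hy' _ => by omega, Or.inr ⟨by rw [e1]; exact hocc, by omega⟩, ?_, ?_⟩
    · intro y' hy' hs
      rw [e2]
      split_ifs with hlt
      · omega
      · by_cases hyy : y' = y
        · exfalso
          rcases h.last with h0 | h0
          · omega
          · refine hs.2 (y' - s.last (P.urec j)) (by omega) (by omega) ?_
            have := h0.1
            rwa [show (y' : ℤ) - (y' - s.last (P.urec j) : ℕ) = s.last (P.urec j) by omega]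
        · exact h.le_start y' (by omega) hs
    · rw [e2]
      split_ifs with hlt
      · refine Or.inr ⟨⟨hocc, fun d hd0 hdg hod => ?_⟩, by omega⟩
        rw [show (y : ℤ) - d = (y - d : ℕ) by omega] at hod
        have := h.le_last (y - d) (by omega) hod
        omega
      · rcases h.start with h0 | h0
        · exact Or.inl h0
        · exact Or.inr ⟨h0.1, by omega⟩
  · obtain ⟨e1, e2⟩ := h2 hocc
    refine ⟨?_, ?_, ?_, ?_⟩
    · intro y' hy' ho
      rw [e1]
      refine h.le_last y' ?_ ho
      by_contra hlt
      exact hocc (by rwa [show y = y' by omega])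
    · rw [e1]
      rcases h.last with h0 | h0
      · exact Or.inl h0
      · exact Or.inr ⟨h0.1, by omega⟩
    · intro y' hy' ho
      rw [e2]
      refine h.le_start y' ?_ ho
      by_contra hlt
      exact hocc (by rw [show y = y' by omega]; exact ho.1)
    · rw [e2]
      rcases h.start with h0 | h0
      · exact Or.inl h0
      · exact Or.inr ⟨h0.1, by omega⟩

theorem look_fields (P : Params) (s : State) : (P.look s).time = s.time ∧
    (P.look s).hash = s.hash ∧ (P.look s).ring = s.ring ∧ (P.look s).mark = s.mark ∧
    (P.look s).don = s.don ∧ (P.look s).lg = s.lg ∧ (P.look s).first = s.first := by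
  simp only [Params.look]
  split_ifs <;> simp

theorem hashInv_look {x : ℕ} {s : State} (H : HashInv P X x s) : HashInv P X x (P.look s) := by
  obtain ⟨h1, h2, h3, -⟩ := look_fields P s
  exact ⟨h1.trans H.time, h2.trans H.hash, by rw [h3]; exact H.ring⟩

theorem sweepInv_look (S : Setup P X T pat N W) {x j : ℕ} {s : State}
    (H : HashInv P X (x + 1) s) (hj : 1 ≤ j) (hjk : j ≤ P.k) (hx : 8 * P.l ≤ x + 1)
    (hxT : x + 1 < T) (h : SweepInv P X pat N W x s j) :
    SweepInv P X pat N W x (P.look s) j := by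
  obtain ⟨-, -, -, h4, h5, h6, h7⟩ := look_fields P s
  have hd : P.delay ≤ P.l := Nat.sub_le _ _
  have hl := S.two_le_l
  refine ⟨by rw [h5]; exact h.visit, by rw [h5]; exact h.don, by rw [h5, h6]; exact h.lg,
    by rw [h5, h6]; exact h.le_lg, by rw [h6, h7]; exact h.chain, by rw [h6, h7]; exact h.first, ?_⟩
  rw [h4, h5]
  intro hall hlarge hstart hocc
  refine h.mark hall hlarge ?_ hocc
  -- If `start` has just moved to the new delayed position, then `don` differs from it and the claim
  -- about marks is vacuous.
  have hdon : s.don j < x + 1 - P.delay := by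
    rcases h.don with h0 | h0 <;> omega
  obtain ⟨g1, g2⟩ := S.look_spec H hj hjk hx hxT
  by_cases ho : Occ X (tailFrom P.l (pat j)) P.l (x + 1 - P.delay : ℕ)
  · rw [(g1 ho).2] at hstart
    split_ifs at hstart
    · omega
    · exact hstart
  · rwa [(g2 ho).2] at hstart

theorem markInv_look {s : State} (h : MarkInv P X pat N s) : MarkInv P X pat N (P.look s) := by
  obtain ⟨-, -, -, h4, -⟩ := look_fields P s
  intro t
  rw [h4]
  exact h t

end Setup


namespace Setup

variable {P : Params} {X : ℤ → ℕ} {T : ℕ} {pat : ℕ → ℕ → ℕ} {N W : ℕ → ℕ}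

/-! #### Processing a pattern -/

theorem sweep_fields (P : Params) (s : State) : (P.sweep s).time = s.time ∧
    (P.sweep s).hash = s.hash ∧ (P.sweep s).ring = s.ring ∧ (P.sweep s).last = s.last ∧
    (P.sweep s).start = s.start := by
  simp only [Params.sweep]
  split_ifs <;> simp

theorem sweep_of_ne {s : State} {j : ℕ} (hj : s.time % P.k + 1 ≠ j) :
    (P.sweep s).don j = s.don j ∧ (P.sweep s).lg j = s.lg j ∧ (P.sweep s).first j = s.first j := by
  simp only [Params.sweep, Params.sweepFirst]
  split_ifs <;> simp [Function.update_of_ne hj.symm]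

theorem hashInv_sweep {x : ℕ} {s : State} (H : HashInv P X x s) : HashInv P X x (P.sweep s) := by
  obtain ⟨h1, h2, h3, -⟩ := sweep_fields P s
  exact ⟨h1.trans H.time, h2.trans H.hash, by rw [h3]; exact H.ring⟩

theorem lookInv_sweep {x j : ℕ} {s : State} (H : LookInv P X pat x s j) :
    LookInv P X pat x (P.sweep s) j := by
  obtain ⟨-, -, -, h4, h5⟩ := sweep_fields P s
  exact ⟨by rw [h4]; exact H.le_last, by rw [h4]; exact H.last, by rw [h5]; exact H.le_start,
    by rw [h5]; exact H.start⟩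

theorem occ_of_chain (S : Setup P X T pat N W) {j i : ℕ} (hj : 1 ≤ j) (hjk : j ≤ P.k) {z : ℤ}
    (hz : ∀ i' ≤ i, Occ X (tailFrom P.l (pat j)) (W j) (z - (i' * P.per j : ℕ)))
    (hi : P.need j ≤ i * P.per j) : Occ X (tailFrom P.l (pat j)) (N j) z := by
  have := S.W_le j hj hjk
  have := S.need_eq j hj hjk
  exact (S.leastPeriod j hj hjk).occ_of_chain (S.le_W j hj hjk) hz le_rfl (by omega)

/-- If the chain were too short, divisibility of $N - W$ by the period would leave room for one more
tested suffix a period before its first member. That position would be special, contradicting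
maximality of the chain. -/
theorem need_le_of_occ (S : Setup P X T pat N W) {j i f : ℕ} (hj : 1 ≤ j) (hjk : j ≤ P.k) {z : ℤ}
    (hlarge : P.gap < P.per j) (hocc : Occ X (tailFrom P.l (pat j)) (N j) z)
    (hz : z = f + (i * P.per j : ℕ))
    (hf : ¬ (Special X (tailFrom P.l (pat j)) P.l P.gap ((f : ℤ) - P.per j) ∧
      Occ X (tailFrom P.l (pat j)) (W j) ((f : ℤ) - P.per j))) : P.need j ≤ i * P.per j := by
  by_contra hlt
  have hW := S.W_le j hj hjk
  have hn := S.need_eq j hj hjk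
  have hlp := S.leastPeriod j hj hjk
  obtain ⟨c, hc⟩ := S.W_dvd j hj hjk
  have hic : i < c := by
    by_contra h
    have := Nat.mul_le_mul_left (P.per j) (not_lt.1 h)
    rw [mul_comm _ i] at this
    omega
  have h1 : (i + 1) * P.per j ≤ P.per j * c := by
    rw [mul_comm]
    exact Nat.mul_le_mul_left _ hic
  have h2 := hlp.occ_sub hocc (m := W j) (c := i + 1) (by omega)
  rw [show z - ((i + 1) * P.per j : ℕ) = f - P.per j by rw [hz, Nat.succ_mul]; push_cast; ring] at h2
  exact hf ⟨hlp.special_of_occ (S.W_large j hj hjk hlarge) h2 hlarge, h2⟩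

section Visit

variable {x : ℕ} {s : State}

/-- When pattern `j` is processed, all its earlier special positions have been processed. -/
theorem le_don_of_lt_start (S : Setup P X T pat N W) {j : ℕ} (L : LookInv P X pat (x + 1) s j)
    (V : SweepInv P X pat N W x s j) {y : ℕ} (hy : y < s.start (P.urec j))
    (hs : Special X (tailFrom P.l (pat j)) P.l P.gap y) : y ≤ s.don j := by
  have hl := S.two_le_l
  have hk := S.k_le
  have hd : P.delay + P.l / 2 = P.l := Nat.sub_add_cancel (Nat.div_le_self _ _)
  have hg : P.gap = P.l / 2 := rfl
  obtain ⟨v, hvx, hxv, -, hv⟩ := V.visit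
  rcases L.start with h0 | ⟨h0, h1⟩
  · omega
  · have : y + P.gap < s.start (P.urec j) := by
      by_contra hlt
      refine h0.2 (s.start (P.urec j) - y) (by omega) (by omega) ?_
      rw [show (s.start (P.urec j) : ℤ) - (s.start (P.urec j) - y : ℕ) = y by omega]
      exact hs.1
    exact hv y (by omega) hs

theorem don_le_start {j : ℕ} (L : LookInv P X pat (x + 1) s j) (V : SweepInv P X pat N W x s j) :
    s.don j ≤ s.start (P.urec j) := by
  rcases V.don with h | h
  · omega
  · exact L.le_start _ (by omega) h.1

/-- Every pattern has a turn within $k \le l/2$ arrivals of the recording, so an unprocessed start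
is less than $l$ positions old. -/
theorem start_fresh (S : Setup P X T pat N W) {j : ℕ} (L : LookInv P X pat (x + 1) s j)
    (V : SweepInv P X pat N W x s j) (hne : s.don j ≠ s.start (P.urec j)) :
    Special X (tailFrom P.l (pat j)) P.l P.gap (s.start (P.urec j)) ∧
    s.start (P.urec j) + P.delay ≤ x + 1 ∧ x + 1 < s.start (P.urec j) + P.l := by
  have hk := S.k_le
  have hd : P.delay + P.l / 2 = P.l := Nat.sub_add_cancel (Nat.div_le_self _ _)
  have hle := don_le_start L V
  obtain ⟨v, hvx, hxv, -, hv⟩ := V.visit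
  rcases L.start with h0 | ⟨h0, h1⟩
  · omega
  · refine ⟨h0, h1, ?_⟩
    by_contra hlt
    have := hv _ (by omega) h0
    omega

/-- The run of pattern `j` after a successful test. -/
theorem chain_sweepFirst (S : Setup P X T pat N W) {j : ℕ} (hj : 1 ≤ j) (hjk : j ≤ P.k)
    (L : LookInv P X pat (x + 1) s j) (V : SweepInv P X pat N W x s j)
    (hne : s.don j ≠ s.start (P.urec j))
    (hocc : Occ X (tailFrom P.l (pat j)) (W j) (s.start (P.urec j))) :
    (∃ i, s.start (P.urec j) = P.sweepFirst s j (s.start (P.urec j)) j + i * P.per j ∧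
      ∀ i' ≤ i, Occ X (tailFrom P.l (pat j)) (W j)
        (s.start (P.urec j) - (i' * P.per j : ℕ))) ∧
    (P.gap < P.per j →
      ¬ (Special X (tailFrom P.l (pat j)) P.l P.gap
          ((P.sweepFirst s j (s.start (P.urec j)) j : ℤ) - P.per j) ∧
        Occ X (tailFrom P.l (pat j)) (W j)
          ((P.sweepFirst s j (s.start (P.urec j)) j : ℤ) - P.per j))) := by
  have hlp := S.leastPeriod j hj hjk
  have hl := S.two_le_l
  have hperl := hlp.lt
  have hpos := hlp.pos
  have hdon := don_le_start L V
  obtain ⟨hsp, -, -⟩ := S.start_fresh L V hne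
  have h8 := S.pos_of_occ hj hjk (by omega) hsp.1
  set z := s.start (P.urec j)
  by_cases hz : s.lg j + P.per j = z
  · have hlg : s.lg j ≠ 0 := by omega
    obtain ⟨i, hi, hchain⟩ := V.chain hlg
    simp only [Params.sweepFirst, if_pos hz]
    refine ⟨⟨i + 1, by rw [Nat.succ_mul]; omega, fun i' hi' => ?_⟩, V.first hlg⟩
    cases i' with
    | zero => simpa using hocc
    | succ i' =>
      have := hchain i' (by omega)
      rwa [show (z : ℤ) - ((i' + 1) * P.per j : ℕ) = s.lg j - (i' * P.per j : ℕ) by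
        rw [Nat.succ_mul]; push_cast; omega]
  · simp only [Params.sweepFirst, if_neg hz, Function.update_self]
    refine ⟨⟨0, by simp, fun i' hi' => ?_⟩, fun hlarge => ?_⟩
    · obtain rfl : i' = 0 := by omega
      simpa using hocc
    -- A success one period earlier would have been processed, so `lg` is at least that position; it
    -- cannot be later, by `LeastPeriod.le_of_occ`. Thus the test for extending the chain would have
    -- held.
    · rintro ⟨h1, h2⟩
      rw [show (z : ℤ) - P.per j = (z - P.per j : ℕ) by omega] at h1 h2
      have h3 := S.le_don_of_lt_start L V (y := z - P.per j) (by omega) h1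
      have h4 := V.le_lg _ h3 h1 h2
      have hlg : s.lg j ≠ 0 := by omega
      rcases V.lg with h0 | ⟨h5, h6, h7⟩
      · omega
      · have h9 := hlp.le_of_occ (d := z - s.lg j) (S.W_large j hj hjk hlarge) hocc (by omega) (by
          rw [show (z : ℤ) - (z - s.lg j : ℕ) = s.lg j by omega]
          exact h5.1)
        omega

theorem mark_justified (S : Setup P X T pat N W) {j : ℕ} (hj : 1 ≤ j) (hjk : j ≤ P.k)
    (L : LookInv P X pat (x + 1) s j) (V : SweepInv P X pat N W x s j)
    (hne : s.don j ≠ s.start (P.urec j))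
    (hocc : Occ X (tailFrom P.l (pat j)) (W j) (s.start (P.urec j)))
    (hn : P.sweepFirst s j (s.start (P.urec j)) j + P.need j ≤ s.start (P.urec j)) :
    Occ X (tailFrom P.l (pat j)) (N j) (s.start (P.urec j)) := by
  obtain ⟨⟨i, hi, hchain⟩, -⟩ := S.chain_sweepFirst hj hjk L V hne hocc
  exact S.occ_of_chain hj hjk hchain (by omega)

end Visit

theorem markInv_sweep (S : Setup P X T pat N W) {x : ℕ} {s : State}
    (H : HashInv P X (x + 1) s) (hx : 8 * P.l ≤ x + 1) (hxT : x + 1 < T)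
    (L : ∀ j, 1 ≤ j → j ≤ P.k → LookInv P X pat (x + 1) s j)
    (V : ∀ j, 1 ≤ j → j ≤ P.k → SweepInv P X pat N W x s j) (h : MarkInv P X pat N s) :
    MarkInv P X pat N (P.sweep s) := by
  have hk := S.k_pos
  have hjk : s.time % P.k + 1 ≤ P.k := Nat.mod_lt _ hk
  have hj : 1 ≤ s.time % P.k + 1 := by omega
  simp only [Params.sweep]
  split_ifs with h1 h2 h3
  · exact h
  · intro t
    by_cases ht : t = P.trec (s.time % P.k + 1)
    · right
      refine ⟨_, hj, hjk, ht.symm, ?_⟩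
      obtain ⟨f1, f2, f3⟩ := S.start_fresh (L _ hj hjk) (V _ hj hjk) h1
      have h8 := S.pos_of_occ hj hjk (by have := S.two_le_l; omega) f1.1
      rw [ht]
      simp only [Function.update_self]
      exact S.mark_justified hj hjk (L _ hj hjk) (V _ hj hjk) h1
        ((S.test_iff H hj hjk (by omega) (by omega) (by omega) (by omega)).1 h2) h3
    · simp only [Function.update_of_ne ht]
      exact h t
  · exact h
  · exact h

/-- Another pattern that overwrites the mark has the same `urec`, hence the same start position, and
writes the same value. -/
theorem mark_sweep (S : Setup P X T pat N W) {j : ℕ} {s : State}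
    (hall : ∀ j', 1 ≤ j' → j' ≤ P.k → P.trec j' = P.trec j → P.urec j' = P.urec j)
    (hstart : s.don j = s.start (P.urec j)) (h : s.mark (P.trec j) = s.don j) :
    (P.sweep s).mark (P.trec j) = s.don j := by
  have hjk : s.time % P.k + 1 ≤ P.k := Nat.mod_lt _ S.k_pos
  simp only [Params.sweep]
  split_ifs with h1 h2 h3
  · exact h
  · by_cases ht : P.trec j = P.trec (s.time % P.k + 1)
    · rw [ht]
      simp only [Function.update_self]
      rw [hall _ (by omega) hjk ht.symm, hstart]
    · simp only [Function.update_of_ne ht]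
      exact h
  · exact h
  · exact h

theorem sweepInv_sweep (S : Setup P X T pat N W) {x j : ℕ} {s : State}
    (H : HashInv P X (x + 1) s) (hj : 1 ≤ j) (hjk : j ≤ P.k)
    (hxT : x + 1 < T) (L : LookInv P X pat (x + 1) s j) (V : SweepInv P X pat N W x s j) :
    SweepInv P X pat N W (x + 1) (P.sweep s) j := by
  have hl := S.two_le_l
  have hkpos := S.k_pos
  obtain ⟨v, hvx, hxv, hvj, hv⟩ := V.visit
  obtain ⟨-, -, -, f4, f5⟩ := sweep_fields P s
  have hlarger : ∀ {b : ℕ} {A : Prop}, (A ∧ b + P.delay ≤ x) → (A ∧ b + P.delay ≤ x + 1) :=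
    fun h => ⟨h.1, by omega⟩
  by_cases hjj : s.time % P.k + 1 = j
  swap
  · obtain ⟨e1, e2, e3⟩ := sweep_of_ne (P := P) hjj
    refine ⟨⟨v, by omega, ?_, hvj, by rw [e1]; exact hv⟩, by rw [e1]; exact V.don.imp id hlarger,
      by rw [e1, e2]; exact V.lg, by rw [e1, e2]; exact V.le_lg, by rw [e2, e3]; exact V.chain,
      by rw [e2, e3]; exact V.first, ?_⟩
    -- After exactly `k` further arrivals the rotation would be back at `j`.
    · by_contra hlt
      rw [H.time, show x + 1 = v + P.k by omega, Nat.add_mod_right] at hjj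
      exact hjj hvj
    · rw [e1, f5]
      intro hall hlarge hstart hocc
      exact S.mark_sweep hall hstart (V.mark hall hlarge hstart hocc)
  · have hxj : (x + 1) % P.k + 1 = j := by rw [← H.time]; exact hjj
    by_cases hne : s.don j = s.start (P.urec j)
    · have e : P.sweep s = s := by simp only [Params.sweep, hjj, if_pos hne]
      rw [e]
      refine ⟨⟨x + 1, le_rfl, by omega, hxj, ?_⟩, V.don.imp id hlarger, V.lg, V.le_lg, V.chain,
        V.first, V.mark⟩
      intro y hy hs
      rw [hne]
      exact L.le_start y hy hs
    · obtain ⟨g1, g2, g3⟩ := S.start_fresh L V hne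
      have h8 := S.pos_of_occ hj hjk (by omega) g1.1
      have htest := S.test_iff H hj hjk (z := s.start (P.urec j)) (by omega) (by omega) (by omega)
        (by omega)
      have hvisit : ∀ y : ℕ, y + P.delay ≤ x + 1 →
          Special X (tailFrom P.l (pat j)) P.l P.gap y → y ≤ s.start (P.urec j) := L.le_start
      have hdon := don_le_start L V
      by_cases ht : P.Test s j (s.start (P.urec j))
      · have hocc := htest.1 ht
        obtain ⟨hc1, hc2⟩ := S.chain_sweepFirst hj hjk L V hne hocc
        have e : P.sweep s = { s with
            don := Function.update s.don j (s.start (P.urec j))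
            lg := Function.update s.lg j (s.start (P.urec j))
            first := P.sweepFirst s j (s.start (P.urec j))
            mark := if P.sweepFirst s j (s.start (P.urec j)) j + P.need j ≤ s.start (P.urec j)
              then Function.update s.mark (P.trec j) (s.start (P.urec j)) else s.mark } := by
          simp only [Params.sweep, hjj, if_neg hne, if_pos ht]
        rw [e]
        refine ⟨⟨x + 1, le_rfl, by omega, hxj, ?_⟩, ?_, ?_, ?_, ?_, ?_, ?_⟩ <;>
          simp only [Function.update_self]
        · exact hvisit
        · exact Or.inr ⟨g1, g2⟩
        · exact Or.inr ⟨g1, hocc, le_rfl⟩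
        · exact fun y hy _ _ => hy
        · exact fun _ => hc1
        · exact fun _ => hc2
        · intro hall hlarge _ hoccN
          obtain ⟨i, hi, -⟩ := hc1
          have := S.need_le_of_occ hj hjk hlarge hoccN (by exact_mod_cast hi) (hc2 hlarge)
          rw [if_pos (by omega), Function.update_self]
      · have hnocc : ¬ Occ X (tailFrom P.l (pat j)) (W j) (s.start (P.urec j)) :=
          fun h => ht (htest.2 h)
        have e : P.sweep s = { s with don := Function.update s.don j (s.start (P.urec j)) } := by
          simp only [Params.sweep, hjj, if_neg hne, if_neg ht]
        rw [e]
        refine ⟨⟨x + 1, le_rfl, by omega, hxj, ?_⟩, ?_, ?_, ?_, V.chain, V.first, ?_⟩ <;>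
          simp only [Function.update_self]
        · exact hvisit
        · exact Or.inr ⟨g1, g2⟩
        · exact V.lg.imp id fun h => ⟨h.1, h.2.1, by omega⟩
        · intro y hy hs ho
          rcases Nat.lt_or_ge y (s.start (P.urec j)) with hlt | hge
          · exact V.le_lg y (S.le_don_of_lt_start L V hlt hs) hs ho
          · rw [show y = s.start (P.urec j) by omega] at ho
            exact absurd ho hnocc
        · intro _ _ _ hoccN
          exact absurd (hoccN.mono (S.W_le j hj hjk)) hnocc

/-! #### The answer -/

theorem exists_special_le (S : Setup P X T pat N W) {j : ℕ} (hj : 1 ≤ j) (hjk : j ≤ P.k) (z : ℕ)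
    (hz : Occ X (tailFrom P.l (pat j)) P.l z) :
    ∃ y ≤ z, Special X (tailFrom P.l (pat j)) P.l P.gap y := by
  induction z using Nat.strong_induction_on with
  | _ z ih =>
    by_cases hs : Special X (tailFrom P.l (pat j)) P.l P.gap z
    · exact ⟨z, le_rfl, hs⟩
    · have : ∃ d : ℕ, 0 < d ∧ d ≤ P.gap ∧ Occ X (tailFrom P.l (pat j)) P.l (z - d) := by
        by_contra hno
        push Not at hno
        exact hs ⟨hz, hno⟩
      obtain ⟨d, hd, -, hzd⟩ := this
      have h8 := S.pos_of_occ hj hjk (by have := S.two_le_l; omega) hzd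
      rw [show (z : ℤ) - d = (z - d : ℕ) by omega] at hzd
      obtain ⟨y, hy, h⟩ := ih (z - d) (by omega) hzd
      exact ⟨y, by omega, h⟩

/-- At time $z + l - 1$ the recording may have advanced past $z$, but by less than $l/2$, and an
occurrence that close after $z$ is not special. So `start` is still the beginning of the run of $z$,
and the rotation has had time to process it. -/
theorem start_spec (S : Setup P X T pat N W) {x j z : ℕ} {s : State} (hj : 1 ≤ j) (hjk : j ≤ P.k)
    (L : LookInv P X pat x s j) (V : SweepInv P X pat N W x s j) (hzx : z + P.l = x + 1)
    (hz : Occ X (tailFrom P.l (pat j)) P.l z) :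
    Special X (tailFrom P.l (pat j)) P.l P.gap (s.start (P.urec j)) ∧ s.start (P.urec j) ≤ z ∧
    (∀ y : ℤ, Special X (tailFrom P.l (pat j)) P.l P.gap y → y ≤ z → y ≤ s.start (P.urec j)) ∧
    s.don j = s.start (P.urec j) := by
  have hl := S.two_le_l
  have hk := S.k_le
  have hkpos := S.k_pos
  have hd : P.delay + P.l / 2 = P.l := Nat.sub_add_cancel (Nat.div_le_self _ _)
  have hg : P.gap = P.l / 2 := rfl
  obtain ⟨y, hyz, hy⟩ := S.exists_special_le hj hjk z hz
  have hy8 := S.pos_of_occ hj hjk (by omega) hy.1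
  have hys := L.le_start y (by omega) hy
  rcases L.start with h0 | ⟨h0, h1⟩
  · omega
  have hsz : s.start (P.urec j) ≤ z := by
    by_contra hlt
    refine h0.2 (s.start (P.urec j) - z) (by omega) (by omega) ?_
    rwa [show (s.start (P.urec j) : ℤ) - (s.start (P.urec j) - z : ℕ) = z by omega]
  refine ⟨h0, hsz, fun y' hy' hyz' => ?_, ?_⟩
  · have h8' := S.pos_of_occ hj hjk (by omega) hy'.1
    obtain ⟨m, rfl⟩ : ∃ m : ℕ, y' = m := ⟨y'.toNat, by omega⟩
    have := L.le_start m (by omega) hy'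
    omega
  · obtain ⟨v, hvx, hxv, -, hv⟩ := V.visit
    have h2 := hv _ (by omega) h0
    rcases V.don with h3 | ⟨h3, h4⟩
    · omega
    · have := L.le_start _ (by omega) h3
      omega

theorem small_iff (S : Setup P X T pat N W) {x j z : ℕ} {s : State} (hj : 1 ≤ j) (hjk : j ≤ P.k)
    (hsmall : P.per j ≤ P.gap) (L : LookInv P X pat x s j) (V : SweepInv P X pat N W x s j)
    (hzx : z + P.l = x + 1) (hz : Occ X (tailFrom P.l (pat j)) P.l z) :
    Occ X (tailFrom P.l (pat j)) (N j) z ↔ P.len j + s.start (P.urec j) ≤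
      z + (if s.lg j = s.start (P.urec j) then 1 else 0) * P.rest j := by
  have hl := S.two_le_l
  obtain ⟨h1, h2, h3, h4⟩ := S.start_spec hj hjk L V hzx hz
  have h8 := S.pos_of_occ hj hjk (by omega) h1.1
  have hlp := S.leastPeriod j hj hjk
  have hle := hlp.le
  have hgap : 2 * P.gap ≤ P.l := Nat.mul_div_le _ _
  have hlg : s.lg j = s.start (P.urec j) ↔
      Occ X (tailFrom P.l (pat j)) (P.l + (N j - P.l) % P.per j) (s.start (P.urec j)) := by
    rw [← S.W_small j hj hjk hsmall]
    constructor
    · intro h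
      rcases V.lg with h0 | h0
      · omega
      · rw [← h]
        exact h0.2.1
    · intro h
      have h5 := V.le_lg _ h4.ge h1 h
      rcases V.lg with h0 | h0 <;> omega
  rw [hlp.occ_iff_of_small hsmall hgap hz h1 (by omega) h3, S.len_eq j hj hjk, S.rest_eq j hj hjk]
  by_cases h : s.lg j = s.start (P.urec j)
  · rw [if_pos (hlg.1 h), if_pos h]
    omega
  · rw [if_neg (fun h' => h (hlg.2 h')), if_neg h]
    omega

/-- Marks are justified by `MarkInv`, which gives soundness together with `small_iff`. For
completeness, a long period makes $z$ itself the start that was tested; for a short one the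
occurrence passes to the shortest pattern of the class. -/
theorem answer_iff (S : Setup P X T pat N W) {x : ℕ} {s : State} (H : HashInv P X (x + 1) s)
    (hx : 8 * P.l ≤ x + 1) (hxT : x + 1 < T)
    (L : ∀ j, 1 ≤ j → j ≤ P.k → LookInv P X pat x s j)
    (V : ∀ j, 1 ≤ j → j ≤ P.k → SweepInv P X pat N W x s j) (M : MarkInv P X pat N s) :
    P.Answer s ↔ ∃ j, 1 ≤ j ∧ j ≤ P.k ∧ Occ X (pat j) (P.l + N j) (x + 1 : ℕ) := by
  have hl := S.two_le_l
  have hwin := S.win_eq H (y := x + 1) (h := 2 * P.l) le_rfl (by omega) (by omega) S.pow2_eq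
  obtain ⟨z, hz⟩ : ∃ z, z + P.l = x + 1 := ⟨x + 1 - P.l, by omega⟩
  have hzeq : x + 1 - P.l = z := by omega
  have hzcast : ((x + 1 : ℕ) : ℤ) - P.l = z := by omega
  simp only [Params.Answer, H.time, hwin, hzeq]
  set f := fp P.p P.base (window X (x + 1 : ℕ)) (2 * P.l) with hf
  have htail : ∀ j, 1 ≤ j → j ≤ P.k → P.key (P.trec j) = f.val →
      Occ X (pat j) (2 * P.l) (x + 1 : ℕ) := by
    intro j hj hjk h
    rw [S.key_trec j hj hjk, S.val_inj] at h
    exact S.good_t j hj hjk _ (by omega) hxT h.symm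
  have hu : ∀ j, Occ X (pat j) (2 * P.l) (x + 1 : ℕ) → Occ X (tailFrom P.l (pat j)) P.l z := by
    intro j h
    have := (occ_add_iff (l := P.l) (N := P.l) (a := pat j) le_rfl).1 (by rwa [← two_mul])
    rw [← hzcast]
    exact this.2
  constructor
  · rintro ⟨hkey, h⟩
    rcases h with h | h
    · rcases M (P.slot f.val) with h0 | ⟨j, hj, hjk, hjt, hocc⟩
      · omega
      · refine ⟨j, hj, hjk, (occ_add_iff (S.leastPeriod j hj hjk).le).2 ⟨?_, ?_⟩⟩
        · exact htail j hj hjk (by rw [hjt, hkey])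
        · rw [hzcast, ← h]
          exact hocc
    · rcases S.small_spec (P.slot f.val) with ⟨hj, hjk, hjt, hsm⟩ | ⟨h1, h2⟩
      · have ht := htail _ hj hjk (by rw [hjt, hkey])
        refine ⟨_, hj, hjk, (occ_add_iff (S.leastPeriod _ hj hjk).le).2 ⟨ht, ?_⟩⟩
        rw [hzcast]
        exact (S.small_iff hj hjk hsm (L _ hj hjk) (V _ hj hjk) hz (hu _ ht)).2 h
      · rw [h2] at h
        omega
  · rintro ⟨j, hj, hjk, hocc⟩
    obtain ⟨h1, h2⟩ := (occ_add_iff (S.leastPeriod j hj hjk).le).1 hocc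
    rw [hzcast] at h2
    have hfj : f = fp P.p P.base (pat j) (2 * P.l) := h1.fp_eq
    have hslot : P.slot f.val = P.trec j := by rw [hfj, ← S.trec_eq j hj hjk]
    rw [hslot]
    refine ⟨by rw [S.key_trec j hj hjk, hfj], ?_⟩
    rcases Nat.lt_or_ge P.gap (P.per j) with hlarge | hsmall
    · left
      have hsp := (S.leastPeriod j hj hjk).special_of_occ (Or.inl rfl) h2 hlarge
      obtain ⟨g1, g2, g3, g4⟩ := S.start_spec hj hjk (L j hj hjk) (V j hj hjk) hz (hu j h1)
      have g5 := g3 z hsp le_rfl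
      have g6 : s.don j = z := by omega
      rw [← g6]
      refine (V j hj hjk).mark ?_ hlarge g4 (by rw [g6]; exact h2)
      -- The text itself shows that patterns with this table entry agree on the last $2l$
      -- characters, hence on $u$.
      intro j' hj' hjk' ht
      have ht' := htail j' hj' hjk' (by rw [ht, S.key_trec j hj hjk, hfj])
      rw [S.urec_eq j' hj' hjk', S.urec_eq j hj hjk]
      congr 2
      refine fp_congr fun i hi => ?_
      rw [← hu j h1 i hi, ← hu j' ht' i hi]
    · right
      obtain ⟨hj', hjk', ht, hsm, hN⟩ := S.small_le j hj hjk hsmall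
      have ht' := htail _ hj' hjk' (by rw [ht, S.key_trec j hj hjk, hfj])
      refine (S.small_iff hj' hjk' hsm (L _ hj' hjk') (V _ hj' hjk') hz (hu _ ht')).1 ?_
      refine (S.leastPeriod _ hj' hjk').occ_of_occ_of_small (S.leastPeriod j hj hjk) hsm hsmall
        (Nat.mul_div_le _ _) (fun i hi => ?_) hN h2
      rw [← hu j h1 i hi, ← hu _ ht' i hi]

end Setup


/-! ### The program -/

/-- Running `c` from `s` is safe and leads to a store that satisfies `Q`. -/
def Cmd.Ok (w Z : ℕ) (c : Cmd) (s : Store) (Q : Store → Prop) : Prop :=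
  c.Safe w Z s ∧ Q (c.run s)

theorem Cmd.Ok.seq {w Z : ℕ} {c d : Cmd} {s : Store} {Q : Store → Prop}
    (h : c.Ok w Z s fun s' => d.Ok w Z s' Q) : (Cmd.seq c d).Ok w Z s Q :=
  ⟨⟨h.1, h.2.1⟩, h.2.2⟩

theorem Cmd.Ok.imp {w Z : ℕ} {c : Cmd} {s : Store} {Q R : Store → Prop} (h : c.Ok w Z s Q)
    (hQ : ∀ s', Q s' → R s') : c.Ok w Z s R :=
  ⟨h.1, hQ _ h.2⟩

theorem Cmd.Ok.asg {w Z i : ℕ} {e : Expr} {s : Store} {Q : Store → Prop} (he : e.Safe w Z s)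
    (h : ∀ s' : Store, s'.a = s.a → s'.v i = e.eval s → (∀ j ≠ i, s'.v j = s.v j) → Q s') :
    (Cmd.asg i e).Ok w Z s Q :=
  ⟨he, h _ rfl (by simp [Cmd.run]) fun j hj => by simp [Cmd.run, Function.update_of_ne hj]⟩

theorem Cmd.Ok.cond {w Z : ℕ} {e : Expr} {c : Cmd} {s : Store} {Q : Store → Prop}
    (he : e.Safe w Z s) (h1 : e.eval s ≠ 0 → c.Ok w Z s Q) (h0 : e.eval s = 0 → Q s) :
    (Cmd.cond e c).Ok w Z s Q := by
  refine ⟨⟨he, fun h => (h1 h).1⟩, ?_⟩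
  by_cases h : e.eval s = 0
  · simpa [Cmd.run, h] using h0 h
  · simpa [Cmd.run, h] using (h1 h).2

theorem Cmd.Ok.write {w Z c : ℕ} {e f : Expr} {s : Store} {Q : Store → Prop} (he : e.Safe w Z s)
    (hf : f.Safe w Z s) (h1 : 1 ≤ e.eval s) (h2 : e.eval s < Z)
    (h : Q ⟨s.v, Function.update s.a c (Function.update (s.a c) (e.eval s) (f.eval s))⟩) :
    (Cmd.write c e f).Ok w Z s Q :=
  ⟨⟨he, hf, h1, h2⟩, h⟩

/-! ### Memory representation and safety of the program. -/

/-- Bounds for the precomputed data that make all operations safe. -/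
structure Bdd (P : Params) (w Z T : ℕ) : Prop where
  two_le_Z : 2 ≤ Z
  Z_le : 64 * Z ≤ 2 ^ w
  p_pos : 0 < P.p
  p_le : P.p * P.p + P.p ≤ 2 ^ w
  base : P.base < P.p
  pow1 : P.pow1 < P.p
  pow2 : P.pow2 < P.p
  mul1 : P.mul1 < P.p
  l_pos : 0 < P.l
  l_lt : 5 * P.l < Z
  k_lt : P.k < Z
  k_pos : 0 < P.k
  size1_pos : 0 < P.size1
  size1_lt : P.size1 < Z
  mult : ∀ i, P.mult i < P.p
  slot : ∀ f, 1 ≤ P.slot f ∧ P.slot f < Z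
  small : ∀ i, 1 ≤ P.small i ∧ P.small i < Z
  urec : ∀ i, 1 ≤ P.urec i ∧ P.urec i < Z
  trec : ∀ i, 1 ≤ P.trec i ∧ P.trec i < Z
  wpow : ∀ i, P.wpow i < P.p
  wfp : ∀ i, P.wfp i < P.p
  woff : ∀ i, T + P.woff i < 2 ^ w
  per : ∀ i, T + P.per i < 2 ^ w
  need : ∀ i, T + P.need i < 2 ^ w
  len : ∀ i, T + P.len i < 2 ^ w
  rest : ∀ i, T + P.rest i < 2 ^ w
  T_lt : T + 10 * P.l < 2 ^ w

/-- Bounds for the changing part of the memory. -/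
structure StateBdd (P : Params) (T : ℕ) (s : State) : Prop where
  time : s.time ≤ T
  le_time : 8 * P.l ≤ s.time + 1
  hash : s.hash < P.p
  ring : ∀ i, s.ring i < P.p
  last : ∀ i, s.last i ≤ T
  start : ∀ i, s.start i ≤ T
  lg : ∀ i, s.lg i ≤ T
  first : ∀ i, s.first i ≤ T

/-- The store `s` holds the precomputed data `P` and the state `S`. -/
structure Rep (P : Params) (S : State) (s : Store) : Prop where
  p : s.v 2 = P.p
  base : s.v 3 = P.base
  ringSize : s.v 4 = 5 * P.l
  l : s.v 5 = P.l
  twoL : s.v 6 = 2 * P.l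
  delay : s.v 7 = P.delay
  gap : s.v 8 = P.gap
  k : s.v 9 = P.k
  pow1 : s.v 10 = P.pow1
  pow2 : s.v 11 = P.pow2
  mul1 : s.v 12 = P.mul1
  size1 : s.v 13 = P.size1
  time : s.v 14 = S.time
  hash : s.v 15 = S.hash
  ring : s.a 0 = S.ring
  mult : s.a 1 = P.mult
  size : s.a 2 = P.size
  off : s.a 3 = P.off
  key : s.a 4 = P.key
  small : s.a 5 = P.small
  urec : s.a 6 = P.urec
  trec : s.a 7 = P.trec
  woff : s.a 8 = P.woff
  wpow : s.a 9 = P.wpow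
  wfp : s.a 10 = P.wfp
  per : s.a 11 = P.per
  need : s.a 12 = P.need
  len : s.a 13 = P.len
  rest : s.a 14 = P.rest
  last : s.a 15 = S.last
  start : s.a 16 = S.start
  mark : s.a 17 = S.mark
  don : s.a 18 = S.don
  lg : s.a 19 = S.lg
  first : s.a 20 = S.first

theorem Rep.congr {P : Params} {S : State} {s s' : Store} (h : Rep P S s) (ha : s'.a = s.a)
    (hv : ∀ i, 2 ≤ i → i ≤ 15 → s'.v i = s.v i) : Rep P S s' := by
  constructor <;> first
    | (rw [hv _ (by norm_num) (by norm_num)]; first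
        | exact h.p | exact h.base | exact h.ringSize | exact h.l | exact h.twoL | exact h.delay
        | exact h.gap | exact h.k | exact h.pow1 | exact h.pow2 | exact h.mul1 | exact h.size1
        | exact h.time | exact h.hash)
    | (rw [ha]; first
        | exact h.ring | exact h.mult | exact h.size | exact h.off | exact h.key | exact h.small
        | exact h.urec | exact h.trec | exact h.woff | exact h.wpow | exact h.wfp | exact h.per
        | exact h.need | exact h.len | exact h.rest | exact h.last | exact h.start | exact h.mark
        | exact h.don | exact h.lg | exact h.first)

open StreamMatch.Expr (var const read)

/-- Sum of expressions. -/
abbrev Expr.plus (e f : Expr) : Expr := .bin .add e f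
/-- Difference of expressions. -/
abbrev Expr.minus (e f : Expr) : Expr := .bin .sub e f
/-- Product of expressions. -/
abbrev Expr.times (e f : Expr) : Expr := .bin .mul e f
/-- Remainder of expressions. -/
abbrev Expr.rem (e f : Expr) : Expr := .bin .mod e f
/-- Equality test. -/
abbrev Expr.equal (e f : Expr) : Expr := .bin .eq e f
/-- Order test. -/
abbrev Expr.less (e f : Expr) : Expr := .bin .lt e f
/-- Negation of a test. -/
abbrev Expr.neg (e : Expr) : Expr := .bin .eq e (.const 0)

/-- Fingerprint of the prefix that ends at position `y`. -/
def ringExpr (y : Expr) : Expr := read 0 ((const 1).plus (y.rem (var 4)))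

/-- Fingerprint of the `h` characters that end at `y`. -/
def winExpr (y pow h : Expr) : Expr :=
  ((ringExpr y).plus ((var 2).minus
    (((ringExpr ((y.plus (var 4)).minus h)).times pow).rem (var 2)))).rem (var 2)

/-- Append the character in cell `0`. -/
def pushCmd : Cmd :=
  .seq (.asg 14 ((var 14).plus (const 1)))
    (.seq (.asg 15 ((((var 15).times (var 3)).plus ((var 0).plus (const 1))).rem (var 2)))
      (.write 0 ((const 1).plus ((var 14).rem (var 4))) (var 15)))

/-- Compute the table position of the fingerprint in cell `16`. -/
def slotCmd : Cmd :=
  .seq (.asg 17 (((((var 12).times (var 16)).rem (var 2)).rem (var 13)).plus (const 1)))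
    (.asg 18 ((read 3 (var 17)).plus
      ((((read 1 (var 17)).times (var 16)).rem (var 2)).rem (read 2 (var 17)))))

/-- Compute the answer in cell `1`. -/
def answerCmd : Cmd :=
  .seq (.asg 1 (const 0)) <|
  .seq (.asg 16 (winExpr (var 14) (var 11) (var 6))) <|
  .seq slotCmd <|
  .seq (.asg 19 ((var 14).minus (var 5))) <|
  .seq (.asg 20 (read 5 (var 18))) <|
  .seq (.asg 21 (read 6 (var 20))) <|
  .cond ((read 4 (var 18)).equal (var 16)) <|
  .seq (.cond ((read 17 (var 18)).equal (var 19)) (.asg 1 (const 1))) <|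
  .cond (((var 19).plus (((read 19 (var 20)).equal (read 16 (var 21))).times
      (read 14 (var 20)))).less ((read 13 (var 20)).plus (read 16 (var 21)))).neg
    (.asg 1 (const 1))

/-- Record an occurrence of a string of length `l`. -/
def lookCmd : Cmd :=
  .seq (.asg 19 ((var 14).minus (var 7))) <|
  .seq (.asg 16 (winExpr (var 19) (var 10) (var 5))) <|
  .seq slotCmd <|
  .cond ((read 4 (var 18)).equal (var 16)) <|
  .seq (.cond (((read 15 (var 18)).plus (var 8)).less (var 19)) (.write 16 (var 18) (var 19)))
    (.write 15 (var 18) (var 19))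

/-- Process one pattern. -/
def sweepCmd : Cmd :=
  .seq (.asg 20 (((var 14).rem (var 9)).plus (const 1))) <|
  .seq (.asg 21 (read 6 (var 20))) <|
  .seq (.asg 19 (read 16 (var 21))) <|
  .cond ((read 18 (var 20)).equal (var 19)).neg <|
  .seq (.write 18 (var 20) (var 19)) <|
  .cond ((ringExpr (var 19)).equal ((((ringExpr ((var 19).plus (read 8 (var 20)))).times
      (read 9 (var 20))).plus (read 10 (var 20))).rem (var 2))) <|
  .seq (.cond (((read 19 (var 20)).plus (read 11 (var 20))).equal (var 19)).neg
    (.write 20 (var 20) (var 19))) <|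
  .seq (.write 19 (var 20) (var 19)) <|
  .cond ((var 19).less ((read 20 (var 20)).plus (read 12 (var 20)))).neg
    (.write 17 (read 7 (var 20)) (var 19))

/-- What is done for every character. -/
def matchCmd : Cmd := .seq pushCmd (.seq answerCmd (.seq lookCmd sweepCmd))

theorem matchCmd_wf : matchCmd.WF := by decide

section

variable {P : Params} {w Z T : ℕ} {S : State} {s : Store}

theorem Bdd.one_lt (B : Bdd P w Z T) : 1 < 2 ^ w := by
  have := B.two_le_Z
  have := B.Z_le
  omega

theorem Bdd.mul_lt (B : Bdd P w Z T) {a b : ℕ} (ha : a < P.p) (hb : b < P.p) :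
    a * b + P.p ≤ 2 ^ w := by
  have := Nat.mul_le_mul ha.le hb.le
  have := B.p_le
  omega

theorem ringExpr_ok (B : Bdd P w Z T) (R : Rep P S s) {e : Expr} (he : e.Safe w Z s) :
    (ringExpr e).Safe w Z s ∧
      (ringExpr e).eval s = S.ring (1 + e.eval s % (5 * P.l)) := by
  have h1 := B.l_lt
  have h2 := B.Z_le
  have h3 := B.one_lt
  have h5 := B.l_pos
  have h4 : e.eval s % (5 * P.l) < 5 * P.l := Nat.mod_lt _ (by omega)
  simp only [ringExpr, Expr.Safe, Expr.eval, Op.Safe, Op.val, R.ringSize, R.ring]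
  exact ⟨⟨⟨h3, ⟨he, trivial, trivial⟩, by omega⟩, by omega, by omega⟩, trivial⟩

theorem winExpr_ok (B : Bdd P w Z T) (R : Rep P S s) (SB : StateBdd P T S) {y pow h : Expr}
    (hy : y.Safe w Z s) (hpow : pow.Safe w Z s) (hh : h.Safe w Z s)
    (hyT : y.eval s ≤ T) (hp : pow.eval s < P.p) (hhl : h.eval s ≤ 5 * P.l) :
    (winExpr y pow h).Safe w Z s ∧
      (winExpr y pow h).eval s = P.win S (y.eval s) (pow.eval s) (h.eval s) := by
  have hT := B.T_lt
  have e1 := ringExpr_ok B R hy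
  have e2 := ringExpr_ok B R (e := (y.plus (var 4)).minus h) (by
    simp only [Expr.Safe, Expr.eval, Op.Safe, Op.val, R.ringSize]
    exact ⟨⟨hy, trivial, by omega⟩, hh, by omega, by omega⟩)
  have hpp := B.p_pos
  have h1 := SB.ring (1 + y.eval s % (5 * P.l))
  have h2 := SB.ring (1 + (y.eval s + 5 * P.l - h.eval s) % (5 * P.l))
  have h3 := B.mul_lt h2 hp
  have h4 := B.mul_lt hpp h1
  have h6 := B.p_le
  have h5 := Nat.mod_lt (S.ring (1 + (y.eval s + 5 * P.l - h.eval s) % (5 * P.l)) * pow.eval s) hpp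
  have h7 : P.p ≤ P.p * P.p := Nat.le_mul_self _
  have e3 : (ringExpr ((y.plus (var 4)).minus h)).eval s =
      S.ring (1 + (y.eval s + 5 * P.l - h.eval s) % (5 * P.l)) := by
    rw [e2.2]
    simp only [Expr.eval, Op.val, R.ringSize]
  constructor
  · simp only [winExpr, Expr.Safe, Expr.eval, Op.Safe, Op.val, R.p, e1.2, e3]
    exact ⟨⟨e1.1, ⟨trivial, ⟨⟨e2.1, hpow, by omega⟩, trivial, trivial⟩, by omega⟩, by omega⟩,
      trivial, trivial⟩
  · simp only [winExpr, Expr.eval, Op.val, R.p, e1.2, e3]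
    rfl

theorem pushCmd_ok (B : Bdd P w Z T) (R : Rep P S s) (SB : StateBdd P T S) {a : ℕ}
    (ha : s.v 0 = a) (hap : a + 1 ≤ P.p) (hT : S.time + 1 ≤ T) :
    pushCmd.Ok w Z s fun s' => Rep P (P.push a S) s' := by
  have hT' := B.T_lt
  have h1 := B.one_lt
  have h2 := B.mul_lt SB.hash B.base
  have h3 := B.p_le
  have hpp := B.p_pos
  have h4 := Nat.mod_lt (S.hash * P.base + (a + 1)) hpp
  have h5 : P.p ≤ P.p * P.p := Nat.le_mul_self _
  have hl := B.l_pos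
  have hlZ := B.l_lt
  have h6 := Nat.mod_lt (S.time + 1) (show 0 < 5 * P.l by omega)
  -- The generic product bound would allow equality with $2^w$; the sharper $(p-1)^2 < p^2$ excludes
  -- it.
  by_cases hlt : S.hash * P.base + (a + 1) < 2 ^ w
  swap
  · have h7 : S.hash * P.base ≤ (P.p - 1) * (P.p - 1) :=
      Nat.mul_le_mul (Nat.le_sub_one_of_lt SB.hash) (Nat.le_sub_one_of_lt B.base)
    have h8 : (P.p - 1) * (P.p - 1) < P.p * P.p := Nat.mul_self_lt_mul_self (by omega)
    omega
  refine Cmd.Ok.seq (Cmd.Ok.asg ?_ fun s1 a1 v1 o1 => Cmd.Ok.seq (Cmd.Ok.asg ?_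
    fun s2 a2 v2 o2 => Cmd.Ok.write ?_ ?_ ?_ ?_ ?_))
  · simp only [Expr.Safe, Expr.eval, Op.Safe, R.time]
    exact ⟨trivial, h1, by omega⟩
  · simp only [Expr.Safe, Expr.eval, Op.Safe, Op.val, o1 15 (by decide), o1 3 (by decide),
      o1 0 (by decide), R.hash, R.base, ha]
    exact ⟨⟨⟨trivial, trivial, by omega⟩, ⟨trivial, h1, by omega⟩, by omega⟩, trivial, trivial⟩
  all_goals
    simp only [Expr.eval, Op.val, o1 15 (by decide), o1 3 (by decide), o1 2 (by decide),
      o1 0 (by decide), R.hash, R.base, R.p, ha] at v2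
    simp only [Expr.eval, Op.val, R.time] at v1
    have e14 : s2.v 14 = S.time + 1 := (o2 14 (by decide)).trans v1
    have e4 : s2.v 4 = 5 * P.l := ((o2 4 (by decide)).trans (o1 4 (by decide))).trans R.ringSize
  · simp only [Expr.Safe, Expr.eval, Op.Safe, Op.val, e14, e4]
    exact ⟨h1, ⟨trivial, trivial, trivial⟩, by omega⟩
  · trivial
  · simp only [Expr.eval, Op.val, e14, e4]
    omega
  · simp only [Expr.eval, Op.val, e14, e4]
    omega
  · simp only [Expr.eval, Op.val, e14, e4, v2]
    have hv : ∀ i, i ≠ 14 → i ≠ 15 → s2.v i = s.v i := fun i hi hi' =>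
      (o2 i hi').trans (o1 i hi)
    have haa : s2.a = s.a := a2.trans a1
    constructor <;> simp (disch := decide) only [haa, hv, Function.update_self,
      Function.update_of_ne, Params.push, R.p, R.base, R.ringSize, R.l, R.twoL, R.delay,
      R.gap, R.k, R.pow1, R.pow2, R.mul1, R.size1, R.ring, R.mult, R.size, R.off, R.key, R.small,
      R.urec, R.trec, R.woff, R.wpow, R.wfp, R.per, R.need, R.len, R.rest, R.last, R.start,
      R.mark, R.don, R.lg, R.first, e14, v2]

theorem slotCmd_ok (B : Bdd P w Z T) (R : Rep P S s) {f : ℕ} (hf : s.v 16 = f) (hfp : f < P.p) :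
    slotCmd.Ok w Z s fun s' => Rep P S s' ∧ s'.v 18 = P.slot f ∧
      ∀ i, i ≠ 17 → i ≠ 18 → s'.v i = s.v i := by
  have h1 := B.one_lt
  have h2 := B.mul_lt B.mul1 hfp
  have hpp := B.p_pos
  have h3 := Nat.mod_lt (P.mul1 * f % P.p) B.size1_pos
  have h4 := B.size1_lt
  have h5 := B.Z_le
  have h6 := B.slot f
  refine Cmd.Ok.seq (Cmd.Ok.asg ?_ fun s1 a1 v1 o1 => Cmd.Ok.asg ?_ fun s2 a2 v2 o2 => ?_)
  · simp only [Expr.Safe, Expr.eval, Op.Safe, Op.val, R.mul1, R.p, R.size1, hf]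
    exact ⟨⟨⟨⟨trivial, trivial, by omega⟩, trivial, trivial⟩, trivial, trivial⟩, h1, by omega⟩
  all_goals
    simp only [Expr.eval, Op.val, R.mul1, R.p, R.size1, hf] at v1
    have R1 : Rep P S s1 := R.congr a1 fun i hi hi' => o1 i (by omega)
    have f1 : s1.v 16 = f := (o1 16 (by decide)).trans hf
  · have h7 := B.mul_lt (B.mult (P.mul1 * f % P.p % P.size1 + 1)) hfp
    simp only [Expr.Safe, Expr.eval, Op.Safe, Op.val, v1, f1, R1.mult, R1.size, R1.off, R1.p]
    refine ⟨⟨trivial, by omega, by omega⟩, ⟨⟨⟨⟨trivial, by omega, by omega⟩, trivial, by omega⟩,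
      trivial, trivial⟩, ⟨trivial, by omega, by omega⟩, trivial⟩, ?_⟩
    have : P.off (P.mul1 * f % P.p % P.size1 + 1) + P.mult (P.mul1 * f % P.p % P.size1 + 1) * f
      % P.p % P.size (P.mul1 * f % P.p % P.size1 + 1) = P.slot f := rfl
    omega
  · simp only [Expr.eval, Op.val, v1, f1, R1.mult, R1.size, R1.off, R1.p] at v2
    exact ⟨R1.congr a2 fun i hi hi' => o2 i (by omega), v2,
      fun i hi hi' => (o2 i hi').trans (o1 i hi)⟩

end


open StreamMatch.Expr (var const read)

section

variable {P : Params} {w Z T : ℕ} {S : State} {s : Store}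

theorem answerCmd_ok (B : Bdd P w Z T) (R : Rep P S s) (SB : StateBdd P T S)
    (htime : 8 * P.l ≤ S.time) :
    answerCmd.Ok w Z s fun s' => Rep P S s' ∧ (s'.v 1 ≠ 0 ↔ P.Answer S) := by
  have h1 := B.one_lt
  have hpp := B.p_pos
  have hZ := B.Z_le
  have hT := B.T_lt
  have hST := SB.time
  refine Cmd.Ok.seq (Cmd.Ok.asg ?_ fun s1 a1 v1 o1 => ?_)
  · simp only [Expr.Safe]
    omega
  simp only [Expr.eval] at v1
  have R1 : Rep P S s1 := R.congr a1 fun i hi _ => o1 i (by omega)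
  obtain ⟨w1, w2⟩ := winExpr_ok B R1 SB (y := var 14) (pow := var 11) (h := var 6) trivial trivial
    trivial (by simpa only [Expr.eval, R1.time] using hST)
    (by simpa only [Expr.eval, R1.pow2] using B.pow2) (by simp only [Expr.eval, R1.twoL]; omega)
  simp only [Expr.eval, R1.time, R1.pow2, R1.twoL] at w2
  refine Cmd.Ok.seq (Cmd.Ok.asg w1 fun s2 a2 v2 o2 => ?_)
  rw [w2] at v2
  have hf : P.win S S.time P.pow2 (2 * P.l) < P.p := Nat.mod_lt _ hpp
  have R2 : Rep P S s2 := R1.congr a2 fun i hi _ => o2 i (by omega)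
  refine Cmd.Ok.seq ((slotCmd_ok B R2 v2 hf).imp fun s3 h3 => ?_)
  obtain ⟨R3, v3, o3⟩ := h3
  set f := P.win S S.time P.pow2 (2 * P.l) with hfdef
  have hslot := B.slot f
  refine Cmd.Ok.seq (Cmd.Ok.asg ?_ fun s4 a4 v4 o4 => ?_)
  · simp only [Expr.Safe, Expr.eval, Op.Safe, R3.time, R3.l]
    exact ⟨trivial, trivial, by omega, by omega⟩
  simp only [Expr.eval, Op.val, R3.time, R3.l] at v4
  have R4 : Rep P S s4 := R3.congr a4 fun i hi _ => o4 i (by omega)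
  have e4 : s4.v 18 = P.slot f := (o4 18 (by decide)).trans v3
  refine Cmd.Ok.seq (Cmd.Ok.asg ?_ fun s5 a5 v5 o5 => ?_)
  · simp only [Expr.Safe, Expr.eval, e4]
    exact ⟨trivial, by omega, by omega⟩
  simp only [Expr.eval, R4.small, e4] at v5
  have R5 : Rep P S s5 := R4.congr a5 fun i hi _ => o5 i (by omega)
  have hsmall := B.small (P.slot f)
  set j := P.small (P.slot f) with hj
  refine Cmd.Ok.seq (Cmd.Ok.asg ?_ fun s6 a6 v6 o6 => ?_)
  · simp only [Expr.Safe, Expr.eval, v5]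
    exact ⟨trivial, by omega, by omega⟩
  simp only [Expr.eval, R5.urec, v5] at v6
  have R6 : Rep P S s6 := R5.congr a6 fun i hi _ => o6 i (by omega)
  have e1 : s6.v 1 = 0 := by
    rw [o6 1 (by decide), o5 1 (by decide), o4 1 (by decide), o3 1 (by decide) (by decide),
      o2 1 (by decide), v1]
  have e16 : s6.v 16 = f := by
    rw [o6 16 (by decide), o5 16 (by decide), o4 16 (by decide), o3 16 (by decide) (by decide), v2]
  have e18 : s6.v 18 = P.slot f := by rw [o6 18 (by decide), o5 18 (by decide), e4]
  have e19 : s6.v 19 = S.time - P.l := by rw [o6 19 (by decide), o5 19 (by decide), v4]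
  have e20 : s6.v 20 = j := by rw [o6 20 (by decide), v5]
  have hurec := B.urec j
  have hans : P.Answer S ↔ P.key (P.slot f) = f ∧ (S.mark (P.slot f) = S.time - P.l ∨
    P.len j + S.start (P.urec j) ≤ S.time - P.l +
      (if S.lg j = S.start (P.urec j) then 1 else 0) * P.rest j) := Iff.rfl
  refine Cmd.Ok.cond ?_ (fun hkey => ?_) fun hkey => ⟨R6, ?_⟩
  · simp only [Expr.Safe, Expr.eval, Op.Safe, e18]
    exact ⟨⟨trivial, by omega, by omega⟩, trivial, trivial⟩
  swap
  · simp only [Expr.eval, Op.val, R6.key, e18, e16] at hkey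
    have : P.key (P.slot f) ≠ f := by
      intro h
      simp [h] at hkey
    rw [e1, hans]
    simp [this]
  simp only [Expr.eval, Op.val, R6.key, e18, e16] at hkey
  have hk : P.key (P.slot f) = f := by
    by_contra h
    simp [h] at hkey
  rw [hans]
  simp only [hk, true_and]
  refine Cmd.Ok.seq ?_
  -- The short-period test follows whether or not the mark test succeeded, so it is treated once for
  -- both stores.
  have key : ∀ s7 : Store, Rep P S s7 → s7.v 19 = S.time - P.l → s7.v 20 = j →
      s7.v 21 = P.urec j → (s7.v 1 ≠ 0 ↔ S.mark (P.slot f) = S.time - P.l) →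
      (Cmd.cond (((var 19).plus (((read 19 (var 20)).equal (read 16 (var 21))).times
      (read 14 (var 20)))).less ((read 13 (var 20)).plus (read 16 (var 21)))).neg
      (.asg 1 (const 1))).Ok w Z s7 fun s' => Rep P S s' ∧ (s'.v 1 ≠ 0 ↔
        (S.mark (P.slot f) = S.time - P.l ∨ P.len j + S.start (P.urec j) ≤ S.time - P.l +
      (if S.lg j = S.start (P.urec j) then 1 else 0) * P.rest j)) := by
    intro s7 R7 f19 f20 f21 f1
    have hb1 := B.rest j
    have hb2 := B.len j
    have hb3 := SB.start (P.urec j)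
    have hb4 : (if S.lg j = S.start (P.urec j) then 1 else 0) * P.rest j ≤ P.rest j := by
      split_ifs <;> omega
    refine Cmd.Ok.cond ?_ (fun hc => Cmd.Ok.asg ?_ fun s8 a8 v8 o8 => ?_) fun hc => ⟨R7, ?_⟩
    · simp only [Expr.Safe, Expr.eval, Op.Safe, Op.val, f19, f20, f21, R7.lg, R7.start, R7.rest,
        R7.len]
      refine ⟨⟨⟨trivial, ⟨⟨⟨trivial, ?_, ?_⟩, ⟨trivial, ?_, ?_⟩, trivial⟩, ⟨trivial, ?_, ?_⟩, ?_⟩, ?_⟩,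
        ⟨⟨trivial, ?_, ?_⟩, ⟨trivial, ?_, ?_⟩, ?_⟩, trivial⟩, ?_, trivial⟩ <;> omega
    · exact h1
    · refine ⟨R7.congr a8 fun i hi _ => o8 i (by omega), ?_⟩
      simp only [Expr.eval, Op.val, f19, f20, f21, R7.lg, R7.start, R7.rest, R7.len] at hc v8
      rw [v8]
      refine iff_of_true one_ne_zero (Or.inr ?_)
      by_contra hlt
      rw [if_pos (not_le.1 hlt)] at hc
      simp at hc
    · simp only [Expr.eval, Op.val, f19, f20, f21, R7.lg, R7.start, R7.rest, R7.len] at hc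
      rw [f1]
      refine ⟨Or.inl, fun h => h.resolve_right fun hle => ?_⟩
      rw [if_neg (not_lt.2 hle)] at hc
      simp at hc
  refine Cmd.Ok.cond ?_ (fun hc => Cmd.Ok.asg h1 fun s7 a7 v7 o7 => ?_) fun hc => ?_
  · simp only [Expr.Safe, Expr.eval, Op.Safe, e18]
    exact ⟨⟨trivial, by omega, by omega⟩, trivial, trivial⟩
  · refine key s7 (R6.congr a7 fun i hi _ => o7 i (by omega)) ((o7 19 (by decide)).trans e19)
      ((o7 20 (by decide)).trans e20) ((o7 21 (by decide)).trans v6) ?_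
    simp only [Expr.eval, Op.val, R6.mark, e18, e19] at hc v7
    rw [v7]
    refine iff_of_true one_ne_zero ?_
    by_contra h
    simp [h] at hc
  · refine key s6 R6 e19 e20 v6 ?_
    simp only [Expr.eval, Op.val, R6.mark, e18, e19] at hc
    rw [e1]
    refine iff_of_false (by simp) fun h => ?_
    simp [h] at hc

theorem Rep.write_last (R : Rep P S s) (t y : ℕ) :
    Rep P { S with last := Function.update S.last t y }
      ⟨s.v, Function.update s.a 15 (Function.update (s.a 15) t y)⟩ := by
  obtain ⟨⟩ := R
  constructor <;> simp (disch := decide) only [Function.update_self, Function.update_of_ne, *]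

theorem Rep.write_start (R : Rep P S s) (t y : ℕ) :
    Rep P { S with start := Function.update S.start t y }
      ⟨s.v, Function.update s.a 16 (Function.update (s.a 16) t y)⟩ := by
  obtain ⟨⟩ := R
  constructor <;> simp (disch := decide) only [Function.update_self, Function.update_of_ne, *]

theorem Rep.write_mark (R : Rep P S s) (t y : ℕ) :
    Rep P { S with mark := Function.update S.mark t y }
      ⟨s.v, Function.update s.a 17 (Function.update (s.a 17) t y)⟩ := by
  obtain ⟨⟩ := R
  constructor <;> simp (disch := decide) only [Function.update_self, Function.update_of_ne, *]

theorem Rep.write_don (R : Rep P S s) (t y : ℕ) :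
    Rep P { S with don := Function.update S.don t y }
      ⟨s.v, Function.update s.a 18 (Function.update (s.a 18) t y)⟩ := by
  obtain ⟨⟩ := R
  constructor <;> simp (disch := decide) only [Function.update_self, Function.update_of_ne, *]

theorem Rep.write_lg (R : Rep P S s) (t y : ℕ) :
    Rep P { S with lg := Function.update S.lg t y }
      ⟨s.v, Function.update s.a 19 (Function.update (s.a 19) t y)⟩ := by
  obtain ⟨⟩ := R
  constructor <;> simp (disch := decide) only [Function.update_self, Function.update_of_ne, *]

theorem Rep.write_first (R : Rep P S s) (t y : ℕ) :
    Rep P { S with first := Function.update S.first t y }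
      ⟨s.v, Function.update s.a 20 (Function.update (s.a 20) t y)⟩ := by
  obtain ⟨⟩ := R
  constructor <;> simp (disch := decide) only [Function.update_self, Function.update_of_ne, *]

theorem lookCmd_ok (B : Bdd P w Z T) (R : Rep P S s) (SB : StateBdd P T S)
    (htime : 8 * P.l ≤ S.time) :
    lookCmd.Ok w Z s fun s' => Rep P (P.look S) s' ∧ s'.v 1 = s.v 1 := by
  have h1 := B.one_lt
  have hpp := B.p_pos
  have hZ := B.Z_le
  have hT := B.T_lt
  have hST := SB.time
  have hd : P.delay ≤ P.l := Nat.sub_le _ _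
  have hg : P.gap ≤ P.l := Nat.div_le_self _ _
  refine Cmd.Ok.seq (Cmd.Ok.asg ?_ fun s1 a1 v1 o1 => ?_)
  · simp only [Expr.Safe, Expr.eval, Op.Safe, R.time, R.delay]
    exact ⟨trivial, trivial, by omega, by omega⟩
  simp only [Expr.eval, Op.val, R.time, R.delay] at v1
  have R1 : Rep P S s1 := R.congr a1 fun i hi _ => o1 i (by omega)
  obtain ⟨w1, w2⟩ := winExpr_ok B R1 SB (y := var 19) (pow := var 10) (h := var 5) trivial trivial
    trivial (by simp only [Expr.eval, v1]; omega)
    (by simpa only [Expr.eval, R1.pow1] using B.pow1) (by simp only [Expr.eval, R1.l]; omega)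
  simp only [Expr.eval, v1, R1.pow1, R1.l] at w2
  refine Cmd.Ok.seq (Cmd.Ok.asg w1 fun s2 a2 v2 o2 => ?_)
  rw [w2] at v2
  have hf : P.win S (S.time - P.delay) P.pow1 P.l < P.p := Nat.mod_lt _ hpp
  have R2 : Rep P S s2 := R1.congr a2 fun i hi _ => o2 i (by omega)
  refine Cmd.Ok.seq ((slotCmd_ok B R2 v2 hf).imp fun s3 h3 => ?_)
  obtain ⟨R3, v3, o3⟩ := h3
  simp only [Params.look]
  set f := P.win S (S.time - P.delay) P.pow1 P.l with hfdef
  have hslot := B.slot f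
  have e1 : s3.v 1 = s.v 1 := by
    rw [o3 1 (by decide) (by decide), o2 1 (by decide), o1 1 (by decide)]
  have e16 : s3.v 16 = f := by rw [o3 16 (by decide) (by decide), v2]
  have e19 : s3.v 19 = S.time - P.delay := by
    rw [o3 19 (by decide) (by decide), o2 19 (by decide), v1]
  set y := S.time - P.delay with hy
  refine Cmd.Ok.cond ?_ (fun hkey => ?_) fun hkey => ?_
  · simp only [Expr.Safe, Expr.eval, Op.Safe, v3]
    exact ⟨⟨trivial, by omega, by omega⟩, trivial, trivial⟩
  swap
  · simp only [Expr.eval, Op.val, R3.key, v3, e16] at hkey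
    have : P.key (P.slot f) ≠ f := by
      intro h
      simp [h] at hkey
    rw [if_neg this]
    exact ⟨R3, e1⟩
  simp only [Expr.eval, Op.val, R3.key, v3, e16] at hkey
  have hk : P.key (P.slot f) = f := by
    by_contra h
    simp [h] at hkey
  rw [if_pos hk]
  have hlast := SB.last (P.slot f)
  refine Cmd.Ok.seq (Cmd.Ok.cond ?_ (fun hc => Cmd.Ok.write trivial trivial ?_ ?_
    (Cmd.Ok.write trivial trivial ?_ ?_ ?_)) fun hc => Cmd.Ok.write trivial trivial ?_ ?_ ?_)
  · simp only [Expr.Safe, Expr.eval, Op.Safe, v3, R3.last, R3.gap]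
    exact ⟨⟨⟨trivial, by omega, by omega⟩, trivial, by omega⟩, trivial, trivial⟩
  · simp only [Expr.eval, v3]
    omega
  · simp only [Expr.eval, v3]
    omega
  · simp only [Expr.eval, v3]
    omega
  · simp only [Expr.eval, v3]
    omega
  · simp only [Expr.eval, Op.val, v3, R3.last, R3.gap, e19] at hc
    have hlt : S.last (P.slot f) + P.gap < y := by
      by_contra h
      simp [h] at hc
    rw [if_pos hlt]
    simp only [Expr.eval, v3, e19]
    exact ⟨(R3.write_start (P.slot f) y).write_last (P.slot f) y, e1⟩
  · simp only [Expr.eval, v3]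
    omega
  · simp only [Expr.eval, v3]
    omega
  · simp only [Expr.eval, Op.val, v3, R3.last, R3.gap, e19] at hc
    have hlt : ¬ S.last (P.slot f) + P.gap < y := by
      intro h
      simp [h] at hc
    rw [if_neg hlt]
    simp only [Expr.eval, v3, e19]
    exact ⟨R3.write_last (P.slot f) y, e1⟩

theorem sweepCmd_ok (B : Bdd P w Z T) (R : Rep P S s) (SB : StateBdd P T S) :
    sweepCmd.Ok w Z s fun s' => Rep P (P.sweep S) s' ∧ s'.v 1 = s.v 1 := by
  have h1 := B.one_lt
  have hpp := B.p_pos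
  have hZ := B.Z_le
  have hT := B.T_lt
  have hST := SB.time
  have hk := Nat.mod_lt S.time B.k_pos
  have hkZ := B.k_lt
  refine Cmd.Ok.seq (Cmd.Ok.asg ?_ fun s1 a1 v1 o1 => ?_)
  · simp only [Expr.Safe, Expr.eval, Op.Safe, Op.val, R.time, R.k]
    exact ⟨⟨trivial, trivial, trivial⟩, h1, by omega⟩
  simp only [Expr.eval, Op.val, R.time, R.k] at v1
  simp only [Params.sweep]
  set j := S.time % P.k + 1 with hj
  have R1 : Rep P S s1 := R.congr a1 fun i hi _ => o1 i (by omega)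
  refine Cmd.Ok.seq (Cmd.Ok.asg ?_ fun s2 a2 v2 o2 => ?_)
  · simp only [Expr.Safe, Expr.eval, v1]
    exact ⟨trivial, by omega, by omega⟩
  simp only [Expr.eval, v1, R1.urec] at v2
  have R2 : Rep P S s2 := R1.congr a2 fun i hi _ => o2 i (by omega)
  have hurec := B.urec j
  have htrec := B.trec j
  refine Cmd.Ok.seq (Cmd.Ok.asg ?_ fun s3 a3 v3 o3 => ?_)
  · simp only [Expr.Safe, Expr.eval, v2]
    exact ⟨trivial, by omega, by omega⟩
  simp only [Expr.eval, v2, R2.start] at v3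
  have R3 : Rep P S s3 := R2.congr a3 fun i hi _ => o3 i (by omega)
  have hstart := SB.start (P.urec j)
  set z := S.start (P.urec j) with hz
  have e1 : s3.v 1 = s.v 1 := by rw [o3 1 (by decide), o2 1 (by decide), o1 1 (by decide)]
  have e20 : s3.v 20 = j := by rw [o3 20 (by decide), o2 20 (by decide), v1]
  have g1 : 1 ≤ j := by omega
  have g2 : j < Z := by omega
  have b1 := B.woff j
  have b2 := B.per j
  have b3 := B.need j
  have b4 := SB.lg j
  refine Cmd.Ok.cond ?_ (fun hc => Cmd.Ok.seq (Cmd.Ok.write trivial trivial ?_ ?_ ?_)) fun hc => ?_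
  · simp only [Expr.Safe, Expr.eval, Op.Safe, e20]
    exact ⟨⟨⟨trivial, by omega, by omega⟩, trivial, trivial⟩, by omega, trivial⟩
  · simp only [Expr.eval, e20]
    omega
  · simp only [Expr.eval, e20]
    omega
  swap
  · simp only [Expr.eval, Op.val, R3.don, e20, v3] at hc
    have : S.don j = z := by
      by_contra h
      simp [h] at hc
    rw [if_pos this]
    exact ⟨R3, e1⟩
  simp only [Expr.eval, Op.val, R3.don, e20, v3] at hc
  have hne : S.don j ≠ z := by
    intro h
    simp [h] at hc
  rw [if_neg hne]
  have R4 := R3.write_don j z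
  simp only [Expr.eval, e20, v3]
  set s4 : Store := ⟨s3.v, Function.update s3.a 18 (Function.update (s3.a 18) j z)⟩ with hs4
  have f1 : s4.v 1 = s.v 1 := e1
  have f19 : s4.v 19 = z := v3
  have f20 : s4.v 20 = j := e20
  clear_value s4
  obtain ⟨r1, r2⟩ := ringExpr_ok B R4 (e := var 19) trivial
  obtain ⟨r3, r4⟩ := ringExpr_ok B R4 (e := (var 19).plus (read 8 (var 20))) (by
    simp only [Expr.Safe, Expr.eval, Op.Safe, f19, f20, R4.woff]
    exact ⟨trivial, ⟨trivial, by omega, by omega⟩, by omega⟩)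
  simp only [Expr.eval, Op.val, f19, f20, R4.woff] at r2 r4
  have htest : P.Test S j z ↔ S.ring (1 + z % (5 * P.l)) =
    (S.ring (1 + (z + P.woff j) % (5 * P.l)) * P.wpow j + P.wfp j) % P.p := Iff.rfl
  refine Cmd.Ok.cond ?_ (fun hc => ?_) fun hc => ?_
  · have m1 := B.mul_lt (SB.ring (1 + (z + P.woff j) % (5 * P.l))) (B.wpow j)
    have m2 := B.wfp j
    simp only [Expr.Safe, Expr.eval, Op.Safe, Op.val, f20, r4, R4.wpow, R4.wfp]
    exact ⟨r1, ⟨⟨⟨r3, ⟨trivial, by omega, by omega⟩, by omega⟩, ⟨trivial, by omega, by omega⟩,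
      by omega⟩, trivial, trivial⟩, trivial⟩
  swap
  · simp only [Expr.eval, Op.val, r2, r4, f20, R4.wpow, R4.wfp, R4.p] at hc
    rw [if_neg]
    · exact ⟨R4, f1⟩
    · intro h
      rw [if_pos (htest.1 h)] at hc
      exact one_ne_zero hc
  simp only [Expr.eval, Op.val, r2, r4, f20, R4.wpow, R4.wfp, R4.p] at hc
  rw [if_pos (htest.2 (by
    by_contra h
    rw [if_neg h] at hc
    exact hc rfl))]
  set S4 : State := { S with don := Function.update S.don j z } with hS4
  have elg : S4.lg = S.lg := rfl
  have key : ∀ s5 : Store, Rep P { S4 with first := P.sweepFirst S j z } s5 → s5.v 1 = s.v 1 →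
      s5.v 19 = z → s5.v 20 = j → (Cmd.seq (.write 19 (var 20) (var 19)) <|
      .cond ((var 19).less ((read 20 (var 20)).plus (read 12 (var 20)))).neg
      (.write 17 (read 7 (var 20)) (var 19))).Ok w Z s5 fun s' =>
        Rep P { S with
          don := Function.update S.don j z
          lg := Function.update S.lg j z
          first := P.sweepFirst S j z
          mark := if P.sweepFirst S j z j + P.need j ≤ z
            then Function.update S.mark (P.trec j) z else S.mark } s' ∧ s'.v 1 = s.v 1 := by
    intro s5 R5 i1 i19 i20
    refine Cmd.Ok.seq (Cmd.Ok.write trivial trivial ?_ ?_ ?_)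
    · simp only [Expr.eval, i20]
      omega
    · simp only [Expr.eval, i20]
      omega
    simp only [Expr.eval, i20, i19]
    have R6 := R5.write_lg j z
    have hfirst : P.sweepFirst S j z j ≤ T := by
      simp only [Params.sweepFirst]
      split_ifs
      · exact SB.first j
      · simpa using hstart
    set s6 : Store := ⟨s5.v, Function.update s5.a 19 (Function.update (s5.a 19) j z)⟩
    have k1 : s6.v 1 = s.v 1 := i1
    have k19 : s6.v 19 = z := i19
    have k20 : s6.v 20 = j := i20
    clear_value s6
    refine Cmd.Ok.cond ?_ (fun hc => Cmd.Ok.write ?_ trivial ?_ ?_ ?_) fun hc => ?_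
    · simp only [Expr.Safe, Expr.eval, Op.Safe, k20, R6.first, R6.need]
      exact ⟨⟨trivial, ⟨⟨trivial, by omega, by omega⟩, ⟨trivial, by omega, by omega⟩, by omega⟩,
        trivial⟩, by omega, trivial⟩
    · simp only [Expr.Safe, Expr.eval, k20]
      exact ⟨trivial, by omega, by omega⟩
    · simp only [Expr.eval, k20, R6.trec]
      omega
    · simp only [Expr.eval, k20, R6.trec]
      omega
    · simp only [Expr.eval, Op.val, k19, k20, R6.first, R6.need, R6.trec] at hc ⊢
      rw [if_pos]
      · exact ⟨R6.write_mark (P.trec j) z, k1⟩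
      · by_contra h
        rw [if_pos (not_le.1 h)] at hc
        simp at hc
    · simp only [Expr.eval, Op.val, k19, k20, R6.first, R6.need] at hc
      rw [if_neg]
      · exact ⟨R6, k1⟩
      · intro h
        rw [if_neg (not_lt.2 h)] at hc
        simp at hc
  -- The chain start is updated while `lg` still holds the previous success.
  refine Cmd.Ok.seq (Cmd.Ok.cond ?_ (fun hc => Cmd.Ok.write trivial trivial ?_ ?_ ?_) fun hc => ?_)
  · simp only [Expr.Safe, Expr.eval, Op.Safe, f20, R4.lg, elg, R4.per]
    exact ⟨⟨⟨⟨trivial, by omega, by omega⟩, ⟨trivial, by omega, by omega⟩, by omega⟩, trivial,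
      trivial⟩, by omega, trivial⟩
  · simp only [Expr.eval, f20]
    omega
  · simp only [Expr.eval, f20]
    omega
  · simp only [Expr.eval, Op.val, f19, f20, R4.lg, elg, R4.per] at hc ⊢
    refine key _ ?_ f1 f19 f20
    rw [Params.sweepFirst, if_neg]
    · exact R4.write_first j z
    · intro h
      simp [h] at hc
  · simp only [Expr.eval, Op.val, f19, f20, R4.lg, elg, R4.per] at hc
    refine key _ ?_ f1 f19 f20
    rw [Params.sweepFirst, if_pos]
    · exact R4
    · by_contra h
      simp [h] at hc

/-! ### Bounds are preserved -/

theorem stateBdd_push (B : Bdd P w Z T) (SB : StateBdd P T S) (hT : S.time + 1 ≤ T) (a : ℕ) :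
    StateBdd P T (P.push a S) := by
  have h := SB.le_time
  have hp : (S.hash * P.base + (a + 1)) % P.p < P.p := Nat.mod_lt _ B.p_pos
  refine ⟨hT, by simp only [Params.push]; omega, hp, fun i => ?_, SB.last, SB.start, SB.lg,
    SB.first⟩
  simp only [Params.push, Function.update_apply]
  split_ifs
  · exact hp
  · exact SB.ring i

theorem stateBdd_look (SB : StateBdd P T S) : StateBdd P T (P.look S) := by
  have hT := SB.time
  simp only [Params.look]
  split_ifs
  · refine ⟨SB.time, SB.le_time, SB.hash, SB.ring, fun i => ?_, fun i => ?_, SB.lg, SB.first⟩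
    · simp only [Function.update_apply]
      split_ifs
      · omega
      · exact SB.last i
    · simp only [Function.update_apply]
      split_ifs
      · omega
      · exact SB.start i
  · refine ⟨SB.time, SB.le_time, SB.hash, SB.ring, fun i => ?_, SB.start, SB.lg, SB.first⟩
    simp only [Function.update_apply]
    split_ifs
    · omega
    · exact SB.last i
  · exact SB

theorem stateBdd_sweep (SB : StateBdd P T S) : StateBdd P T (P.sweep S) := by
  have hupd : ∀ (g : ℕ → ℕ) (j z i : ℕ), g i ≤ T → z ≤ T → Function.update g j z i ≤ T := by
    intro g j z i hg hz
    rw [Function.update_apply]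
    split_ifs <;> assumption
  have hfirst : ∀ j z i, z ≤ T → P.sweepFirst S j z i ≤ T := by
    intro j z i hz
    simp only [Params.sweepFirst]
    split_ifs
    · exact SB.first i
    · exact hupd _ _ _ _ (SB.first i) hz
  simp only [Params.sweep]
  split_ifs
  · exact SB
  · exact ⟨SB.time, SB.le_time, SB.hash, SB.ring, SB.last, SB.start,
      fun i => hupd _ _ _ _ (SB.lg i) (SB.start _), fun i => hfirst _ _ _ (SB.start _)⟩
  · exact ⟨SB.time, SB.le_time, SB.hash, SB.ring, SB.last, SB.start,
      fun i => hupd _ _ _ _ (SB.lg i) (SB.start _), fun i => hfirst _ _ _ (SB.start _)⟩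
  · exact ⟨SB.time, SB.le_time, SB.hash, SB.ring, SB.last, SB.start, SB.lg, SB.first⟩

end


/-! ### Streaming -/

/-- State after one more character. -/
def Params.next (P : Params) (a : ℕ) (S : State) : State := P.sweep (P.look (P.push a S))

open Classical in
/-- Answers for a text, starting from a given state. -/
noncomputable def Params.outputs (P : Params) : State → List ℕ → List Bool
  | _, [] => []
  | S, a :: t => decide (P.Answer (P.push a S)) :: P.outputs (P.next a S) t

section

variable {P : Params} {w Z T : ℕ} {S : State} {s : Store}

theorem matchCmd_ok (B : Bdd P w Z T) (R : Rep P S s) (SB : StateBdd P T S) {a : ℕ}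
    (ha : s.v 0 = a) (hap : a + 1 ≤ P.p) (hT : S.time + 1 ≤ T) :
    matchCmd.Ok w Z s fun s' => Rep P (P.next a S) s' ∧
      (s'.v 1 ≠ 0 ↔ P.Answer (P.push a S)) := by
  have SB1 := stateBdd_push B SB hT a
  have htime : 8 * P.l ≤ (P.push a S).time := SB.le_time
  refine Cmd.Ok.seq ((pushCmd_ok B R SB ha hap hT).imp fun s1 R1 => Cmd.Ok.seq
    ((answerCmd_ok B R1 SB1 htime).imp fun s2 R2 => Cmd.Ok.seq
      ((lookCmd_ok B R2.1 SB1 htime).imp fun s3 R3 =>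
        (sweepCmd_ok B R3.1 (stateBdd_look SB1)).imp fun s4 R4 => ⟨R4.1, ?_⟩)))
  rw [R4.2, R3.2]
  exact R2.2

theorem stateBdd_next (B : Bdd P w Z T) (SB : StateBdd P T S) {a : ℕ} (hT : S.time + 1 ≤ T) :
    StateBdd P T (P.next a S) :=
  stateBdd_sweep (stateBdd_look (stateBdd_push B SB hT a))

theorem next_time (P : Params) (a : ℕ) (S : State) : (P.next a S).time = S.time + 1 := by
  rw [Params.next, (Setup.sweep_fields P _).1, (Setup.look_fields P _).1]
  rfl

theorem stream_eq (B : Bdd P w Z T) {C : ℕ} (hC : matchCmd.prog.length ≤ C) (text : List ℕ) :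
    ∀ {S : State} {s : Store} {M : ℕ → ℕ}, Rep P S s → StateBdd P T S → Agree Z s M →
      (∀ a ∈ text, a + 1 ≤ P.p) → S.time + text.length ≤ T →
      stream matchCmd.prog w (64 * Z) C M text = some (P.outputs S text) := by
  induction text with
  | nil => intros; rfl
  | cons a text ih =>
    intro S s M R SB A hp hT
    rw [List.length_cons] at hT
    have A' : Agree Z ⟨Function.update s.v 0 a, s.a⟩ (Function.update M 0 a) := by
      refine ⟨fun i hi => ?_, fun c hc i h1 hi => ?_⟩
      · simp only [Function.update_apply]
        rw [A.1 i hi]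
      · rw [Function.update_of_ne (by omega)]
        exact A.2 c hc i h1 hi
    have R' : Rep P S ⟨Function.update s.v 0 a, s.a⟩ :=
      R.congr rfl fun i hi _ => Function.update_of_ne (by omega) _ _
    obtain ⟨hsafe, hrep, hans⟩ := matchCmd_ok B R' SB (a := a) (by simp) (hp a (by simp)) (by omega)
    obtain ⟨M', hM', A2⟩ := matchCmd.exec_prog B.Z_le (by have := B.two_le_Z; omega) A' hsafe
      matchCmd_wf hC
    rw [stream, hM']
    simp only
    rw [ih hrep (stateBdd_next B SB (by omega)) A2 (fun b hb => hp b (by simp [hb]))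
      (by rw [next_time]; omega)]
    simp only [Option.map_some, Params.outputs, Option.some.injEq, List.cons.injEq, and_true]
    rw [A2.1 1 (by decide), Bool.eq_iff_iff]
    simp only [bne_iff_ne, decide_eq_true_eq]
    exact hans

end

namespace Setup

variable {P : Params} {X : ℤ → ℕ} {T : ℕ} {pat : ℕ → ℕ → ℕ} {N W : ℕ → ℕ}

/-- All invariants. -/
structure Inv (P : Params) (X : ℤ → ℕ) (pat : ℕ → ℕ → ℕ) (N W : ℕ → ℕ) (x : ℕ) (s : State) :
    Prop where
  hash : HashInv P X x s
  look : ∀ j, 1 ≤ j → j ≤ P.k → LookInv P X pat x s j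
  sweep : ∀ j, 1 ≤ j → j ≤ P.k → SweepInv P X pat N W x s j
  mark : MarkInv P X pat N s

theorem inv_push {x a : ℕ} {s : State} (I : Inv P X pat N W x s) :
    (∀ j, 1 ≤ j → j ≤ P.k → LookInv P X pat x (P.push a s) j) ∧
    (∀ j, 1 ≤ j → j ≤ P.k → SweepInv P X pat N W x (P.push a s) j) ∧
    MarkInv P X pat N (P.push a s) :=
  ⟨fun j hj hjk => ⟨(I.look j hj hjk).le_last, (I.look j hj hjk).last, (I.look j hj hjk).le_start,
      (I.look j hj hjk).start⟩,
    fun j hj hjk => ⟨(I.sweep j hj hjk).visit, (I.sweep j hj hjk).don, (I.sweep j hj hjk).lg,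
      (I.sweep j hj hjk).le_lg, (I.sweep j hj hjk).chain, (I.sweep j hj hjk).first,
      (I.sweep j hj hjk).mark⟩, I.mark⟩

theorem inv_next (S : Setup P X T pat N W) {x a : ℕ} {s : State} (I : Inv P X pat N W x s)
    (ha : X ((x : ℤ) + 1) = a + 1) (hx : 8 * P.l ≤ x + 1) (hxT : x + 1 < T) :
    Inv P X pat N W (x + 1) (P.next a s) := by
  have H1 := S.hashInv_push I.hash ha
  obtain ⟨L1, V1, M1⟩ := inv_push (a := a) I
  have H2 := hashInv_look H1
  have L2 : ∀ j, 1 ≤ j → j ≤ P.k → LookInv P X pat (x + 1) (P.look (P.push a s)) j :=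
    fun j hj hjk => S.lookInv_look H1 hj hjk hx hxT (L1 j hj hjk)
  have V2 : ∀ j, 1 ≤ j → j ≤ P.k → SweepInv P X pat N W x (P.look (P.push a s)) j :=
    fun j hj hjk => S.sweepInv_look H1 hj hjk hx hxT (V1 j hj hjk)
  exact ⟨hashInv_sweep H2, fun j hj hjk => lookInv_sweep (L2 j hj hjk),
    fun j hj hjk => S.sweepInv_sweep H2 hj hjk hxT (L2 j hj hjk) (V2 j hj hjk),
    S.markInv_sweep H2 hx hxT L2 V2 (markInv_look M1)⟩

open Classical in
theorem outputs_eq (S : Setup P X T pat N W) (text : List ℕ) :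
    ∀ {x : ℕ} {s : State}, Inv P X pat N W x s → 8 * P.l ≤ x + 1 → x + text.length < T →
      (∀ i (hi : i < text.length), X ((x : ℤ) + 1 + i) = text[i] + 1) →
      P.outputs s text = (List.range text.length).map fun i => decide
        (∃ j, 1 ≤ j ∧ j ≤ P.k ∧ Occ X (pat j) (P.l + N j) (x + 1 + i : ℕ)) := by
  induction text with
  | nil => intros; rfl
  | cons a text ih =>
    intro x s I hx hT hX
    rw [List.length_cons] at hT
    have ha : X ((x : ℤ) + 1) = a + 1 := by
      have h0 := hX 0 (by simp)
      rw [List.getElem_cons_zero] at h0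
      rw [← h0]
      simp
    obtain ⟨L1, V1, M1⟩ := inv_push (a := a) I
    have hans := S.answer_iff (S.hashInv_push I.hash ha) hx (by omega) L1 V1 M1
    rw [Params.outputs, List.length_cons, List.range_succ_eq_map, List.map_cons, List.map_map]
    congr 1
    · rw [decide_eq_decide]
      exact hans
    · rw [ih (S.inv_next I ha hx (by omega)) (by omega) (by omega) fun i hi => ?_]
      · refine List.map_congr_left fun i _ => ?_
        simp only [Function.comp]
        rw [show x + 1 + 1 + i = x + 1 + i.succ by omega]
      · have := hX (i + 1) (by simpa using hi)
        rw [List.getElem_cons_succ] at this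
        rw [← this]
        congr 1
        push_cast
        ring

/-- The state before the first character. -/
def initState (l : ℕ) : State where
  time := 8 * l - 1
  hash := 0
  ring _ := 0
  last _ := 0
  start _ := 0
  mark _ := 0
  don _ := 0
  lg _ := 0
  first _ := 0

theorem inv_initState (S : Setup P X T pat N W) :
    Inv P X pat N W (8 * P.l - 1) (initState P.l) := by
  have hl := S.two_le_l
  have hk := S.k_le
  have hkp := S.k_pos
  have hzero : ∀ t : ℕ, t ≤ 8 * P.l - 1 → prefixFp P.p P.base X t = 0 := fun t ht =>
    prefixFp_eq_zero fun z hz => S.text_zero z (by omega)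
  have hnone : ∀ j, 1 ≤ j → j ≤ P.k → ∀ h, 1 ≤ h → ∀ y : ℕ, y ≤ 8 * P.l - 1 →
      ¬ Occ X (tailFrom P.l (pat j)) h y := by
    intro j hj hjk h hh y hy ho
    have := S.pos_of_occ hj hjk hh ho
    omega
  refine ⟨⟨rfl, ?_, fun t ht _ => ?_⟩, fun j hj hjk => ⟨?_, Or.inl rfl, ?_, Or.inl rfl⟩,
    fun j hj hjk => ⟨?_, Or.inl rfl, Or.inl rfl, ?_, fun h => absurd rfl h,
      fun h => absurd rfl h, fun _ _ _ ho => ?_⟩, fun t => Or.inl rfl⟩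
  · rw [hzero _ le_rfl]
    simp [initState]
  · rw [hzero t ht]
    simp [initState]
  · exact fun y hy ho => absurd ho (hnone j hj hjk _ (by omega) y (by omega))
  · exact fun y hy ho => absurd ho.1 (hnone j hj hjk _ (by omega) y (by omega))
  -- The fictitious last turn of `j` before the text lies in the current block of `k` positions or
  -- in the previous one.
  · have e := Nat.div_add_mod (8 * P.l - 1) P.k
    have hm := Nat.mod_lt (8 * P.l - 1) hkp
    set c := (8 * P.l - 1) / P.k with hc
    have hc1 : 1 ≤ c := by
      rw [hc, Nat.one_le_div_iff hkp]
      omega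
    have hvis : ∀ v : ℕ, v ≤ 8 * P.l - 1 → ∀ y : ℕ, y + P.delay ≤ v →
        Special X (tailFrom P.l (pat j)) P.l P.gap y → y ≤ (initState P.l).don j :=
      fun v hv y hy ho => absurd ho.1 (hnone j hj hjk _ (by omega) y (by omega))
    have hmod : ∀ b, (P.k * b + (j - 1)) % P.k + 1 = j := by
      intro b
      rw [Nat.mul_add_mod, Nat.mod_eq_of_lt (by omega)]
      omega
    by_cases h : j - 1 ≤ (8 * P.l - 1) % P.k
    · exact ⟨P.k * c + (j - 1), by omega, by omega, hmod c, hvis _ (by omega)⟩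
    · obtain ⟨b, hb⟩ : ∃ b, c = b + 1 := ⟨c - 1, by omega⟩
      rw [hb, Nat.mul_succ] at e
      exact ⟨P.k * b + (j - 1), by omega, by omega, hmod b, hvis _ (by omega)⟩
  · exact fun y hy ho => absurd ho.1
      (hnone j hj hjk _ (by omega) y (by simp only [initState] at hy; omega))
  · exact absurd ho (hnone j hj hjk _ (by have := (S.leastPeriod j hj hjk).le; omega) 0 (by omega))

end Setup


/-! ### Preprocessing -/

/-- Length of the suffix that is tested for a string of length `N` and period `r`. -/
def testLen (l N r : ℕ) : ℕ := l + (N - l) % r + if l / 2 < r ∧ r ≤ N - l then r else 0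

/-- The remainder modulo $r$ makes the untested length a multiple of the period. A further $r$ is
added for long periods when it fits; when it does not, $N - l < r$ and the whole string is tested.
-/
theorem LeastPeriod.testLen_spec {q : ℕ → ℕ} {N l r : ℕ} (h : LeastPeriod q N l r) :
    testLen l N r ≤ N ∧ l ≤ testLen l N r ∧ testLen l N r < 3 * l ∧ r ∣ N - testLen l N r ∧
    (l / 2 < r → testLen l N r = N ∨ l + r ≤ testLen l N r) ∧
    (r ≤ l / 2 → testLen l N r = l + (N - l) % r) := by
  have e := Nat.mod_add_div (N - l) r
  have hm := Nat.mod_lt (N - l) h.pos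
  have hle := h.le
  have hlt := h.lt
  unfold testLen
  split_ifs with hc
  · obtain ⟨b, hb⟩ : ∃ b, (N - l) / r = b + 1 :=
      ⟨(N - l) / r - 1, by have := (Nat.one_le_div_iff h.pos).2 hc.2; omega⟩
    rw [hb, Nat.mul_succ] at e
    refine ⟨by omega, by omega, by omega, ⟨b, by omega⟩, fun _ => Or.inr (by omega),
      fun _ => by omega⟩
  · refine ⟨by omega, by omega, by omega, ⟨(N - l) / r, by omega⟩,
      fun hr => Or.inl ?_, fun _ => rfl⟩
    rw [Nat.mod_eq_of_lt (by omega)]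
    omega

/-- Index `k + 1` is the dummy used for an empty class. -/
theorem exists_shortest (k t : ℕ) (trec N per : ℕ → ℕ) (G : ℕ) :
    ∃ j, 1 ≤ j ∧ j ≤ k + 1 ∧ ((j ≤ k ∧ trec j = t ∧ per j ≤ G) ∨ j = k + 1) ∧
      ∀ i, 1 ≤ i → i ≤ k → trec i = t → per i ≤ G → j ≤ k ∧ N j ≤ N i := by
  classical
  set A := (Finset.Icc 1 k).filter fun j => trec j = t ∧ per j ≤ G with hA
  by_cases hne : A.Nonempty
  · obtain ⟨j, hj, hmin⟩ := Finset.exists_min_image A N hne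
    obtain ⟨h1, h2⟩ := Finset.mem_filter.1 hj
    rw [Finset.mem_Icc] at h1
    refine ⟨j, h1.1, by omega, Or.inl ⟨h1.2, h2⟩, fun i hi hik ht hp => ⟨h1.2, hmin i ?_⟩⟩
    exact Finset.mem_filter.2 ⟨Finset.mem_Icc.2 ⟨hi, hik⟩, ht, hp⟩
  · refine ⟨k + 1, by omega, le_rfl, Or.inr rfl, fun i hi hik ht hp => ?_⟩
    exact absurd ⟨i, Finset.mem_filter.2 ⟨Finset.mem_Icc.2 ⟨hi, hik⟩, ht, hp⟩⟩ hne

/-- Values that do not occur in `Bdd` but have to fit into words. -/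
structure TableBdd (P : Params) (w : ℕ) : Prop where
  size : ∀ i, P.size i < 2 ^ w
  off : ∀ i, P.off i < 2 ^ w
  key : ∀ i, P.key i < 2 ^ w

/-- The quantifier order matters: the data depend on the dictionary and the base only, and the text
enters afterwards through the absence of collisions. -/
theorem exists_params {p base l k w T m : ℕ} [hp : Fact p.Prime] {pat : ℕ → ℕ → ℕ}
    {N per : ℕ → ℕ} (hbase : base < p) (hk : 1 ≤ k) (hkl : k ≤ l / 2)
    (hper : ∀ j, 1 ≤ j → j ≤ k → LeastPeriod (tailFrom l (pat j)) (N j) l (per j))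
    (hpos : ∀ j, 1 ≤ j → j ≤ k → ∀ i < l + N j, 1 ≤ pat j i)
    (hN : ∀ j, N j ≤ m) (hperm : ∀ j, per j ≤ m)
    (hpw : p * p + p ≤ 2 ^ w) (hTw : T + T + 10 * l + m < 2 ^ w) (hlw : 384 * l ≤ 2 ^ w) :
    ∃ P : Params, P.p = p ∧ P.base = base ∧ P.l = l ∧ P.k = k ∧ Bdd P w (6 * l) T ∧
      TableBdd P w ∧ ∀ X : ℤ → ℕ, (∀ z : ℤ, z < 8 * l → X z = 0) →
        (∀ j, 1 ≤ j → j ≤ k → ∀ z : ℕ, 7 * l ≤ z → z < T →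
          fp p base (window X z) l = fp p base (tailFrom l (pat j)) l →
          Occ X (tailFrom l (pat j)) l z) →
        (∀ j, 1 ≤ j → j ≤ k → ∀ z : ℕ, 7 * l ≤ z → z < T →
          fp p base (window X z) (2 * l) = fp p base (pat j) (2 * l) →
          Occ X (pat j) (2 * l) z) →
        (∀ j, 1 ≤ j → j ≤ k → ∀ z : ℕ, 7 * l ≤ z → z < T →
          fp p base (window X z) (testLen l (N j) (per j)) =
            fp p base (tailFrom l (pat j)) (testLen l (N j) (per j)) →
          Occ X (tailFrom l (pat j)) (testLen l (N j) (per j)) z) →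
        Setup P X T pat N fun j => testLen l (N j) (per j) := by
  classical
  have hp0 := hp.out.pos
  have hpw' : p ≤ 2 ^ w := by omega
  have hlt : ∀ a : ZMod p, a.val < p := ZMod.val_lt
  set ukey : ℕ → ℕ := fun j => (fp p base (tailFrom l (pat j)) l).val with hukey
  set tkey : ℕ → ℕ := fun j => (fp p base (pat j) (2 * l)).val with htkey
  set S : Finset ℕ := (Finset.Icc 1 k).image ukey ∪ (Finset.Icc 1 k).image tkey with hS
  have hSp : ∀ f ∈ S, f < p := by
    intro f hf
    rcases Finset.mem_union.1 hf with h | h <;> obtain ⟨j, -, rfl⟩ := Finset.mem_image.1 h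
    · exact hlt _
    · exact hlt _
  have hScard : S.card ≤ 2 * k := by
    refine (Finset.card_union_le _ _).trans ?_
    have h1 : ((Finset.Icc 1 k).image ukey).card ≤ _ := Finset.card_image_le
    have h2 : ((Finset.Icc 1 k).image tkey).card ≤ _ := Finset.card_image_le
    rw [Nat.card_Icc] at h1 h2
    omega
  -- Each pattern contributes two keys, so $K = 2k$, and the table of size $10k \le 5l$ fits into
  -- arrays of length $6l$.
  obtain ⟨mul1, mult, size, off, hmul1, hbd, hfit, hinj⟩ :=
    exists_hashSlot_injOn S hSp hScard (by omega)
  set slot := hashSlot p mul1 (2 * k) mult size off with hslot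
  have hslotbd : ∀ f, 1 ≤ slot f ∧ slot f < 6 * l := by
    intro f
    have h1 := Nat.mod_lt (mul1 * f % p) (show 0 < 2 * k by omega)
    have h2 := hfit (mul1 * f % p % (2 * k) + 1) (by omega) (by omega)
    have h3 := hbd (mul1 * f % p % (2 * k) + 1)
    have h4 := Nat.mod_lt (mult (mul1 * f % p % (2 * k) + 1) * f % p)
      (show 0 < size (mul1 * f % p % (2 * k) + 1) by omega)
    simp only [hslot, hashSlot]
    omega
  have hkeyex : ∀ i, ∃ g, g < p ∧ ∀ f ∈ S, slot f = i → g = f := by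
    intro i
    by_cases h : ∃ f ∈ S, slot f = i
    · obtain ⟨f, hf, hfi⟩ := h
      exact ⟨f, hSp f hf, fun f' hf' hfi' => hinj hf hf' (hfi.trans hfi'.symm)⟩
    · exact ⟨0, hp0, fun f hf hfi => absurd ⟨f, hf, hfi⟩ h⟩
  choose key hkeyp hkey using hkeyex
  have hu : ∀ j, 1 ≤ j → j ≤ k → key (slot (ukey j)) = ukey j := fun j h1 h2 =>
    hkey _ _ (Finset.mem_union_left _ (Finset.mem_image_of_mem _ (Finset.mem_Icc.2 ⟨h1, h2⟩))) rfl
  have ht : ∀ j, 1 ≤ j → j ≤ k → key (slot (tkey j)) = tkey j := fun j h1 h2 =>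
    hkey _ _ (Finset.mem_union_right _ (Finset.mem_image_of_mem _ (Finset.mem_Icc.2 ⟨h1, h2⟩))) rfl
  choose small hs1 hsk hs2 hs3 using fun t =>
    exists_shortest k t (fun j => slot (tkey j)) N per (l / 2)
  refine ⟨{
      p := p
      base := base
      l := l
      k := k
      pow1 := ((base : ZMod p) ^ l).val
      pow2 := ((base : ZMod p) ^ (2 * l)).val
      mul1 := mul1
      size1 := 2 * k
      mult := mult
      size := size
      off := off
      key := key
      small := small
      urec := fun j => slot (ukey j)
      trec := fun j => slot (tkey j)
      woff := fun j => 5 * l - testLen l (N j) (per j)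
      wpow := fun j => ((base : ZMod p) ^ testLen l (N j) (per j)).val
      wfp := fun j => (fp p base (tailFrom l (pat j)) (testLen l (N j) (per j))).val
      per := per
      need := fun j => N j - testLen l (N j) (per j)
      len := fun j => if j = k + 1 then T else N j - l
      rest := fun j => if j = k + 1 then 0 else (N j - l) % per j },
    rfl, rfl, rfl, rfl, ?_, ?_, ?_⟩
  · constructor
    case two_le_Z => omega
    case Z_le => omega
    case p_pos => exact hp0
    case p_le => exact hpw
    case base => exact hbase
    case pow1 => exact hlt _
    case pow2 => exact hlt _
    case mul1 => exact hmul1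
    case l_pos => show 0 < l; omega
    case l_lt => show 5 * l < 6 * l; omega
    case k_lt => show k < 6 * l; omega
    case k_pos => show 0 < k; omega
    case size1_pos => show 0 < 2 * k; omega
    case size1_lt => show 2 * k < 6 * l; omega
    case mult => exact fun i => (hbd i).1
    case slot => exact hslotbd
    case small =>
      intro i
      have := hs1 i
      have := hsk i
      show 1 ≤ small i ∧ small i < 6 * l
      omega
    case urec => exact fun i => hslotbd _
    case trec => exact fun i => hslotbd _
    case wpow => exact fun i => hlt _
    case wfp => exact fun i => hlt _
    case woff =>
      intro i
      show T + (5 * l - testLen l (N i) (per i)) < 2 ^ w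
      omega
    case per =>
      intro i
      have := hperm i
      show T + per i < 2 ^ w
      omega
    case need =>
      intro i
      have := hN i
      show T + (N i - testLen l (N i) (per i)) < 2 ^ w
      omega
    case len =>
      intro i
      have := hN i
      show T + (if i = k + 1 then T else N i - l) < 2 ^ w
      split_ifs <;> omega
    case rest =>
      intro i
      have := hN i
      have := Nat.mod_le (N i - l) (per i)
      show T + (if i = k + 1 then 0 else (N i - l) % per i) < 2 ^ w
      split_ifs <;> omega
    case T_lt => show T + 10 * l < 2 ^ w; omega
  · refine ⟨fun i => ?_, fun i => ?_, fun i => (hkeyp i).trans_le hpw'⟩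
    · have := hbd i
      show size i < 2 ^ w
      omega
    · have := hbd i
      show off i < 2 ^ w
      omega
  · intro X hX hgu hgt hgw
    constructor
    case prime => exact hp
    case k_pos => exact hk
    case k_le => exact hkl
    case text_zero => exact hX
    case pat_pos => exact hpos
    case leastPeriod => exact hper
    case W_le => exact fun j h1 h2 => (hper j h1 h2).testLen_spec.1
    case le_W => exact fun j h1 h2 => (hper j h1 h2).testLen_spec.2.1
    case W_lt => exact fun j h1 h2 => (hper j h1 h2).testLen_spec.2.2.1
    case W_dvd => exact fun j h1 h2 => (hper j h1 h2).testLen_spec.2.2.2.1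
    case W_large => exact fun j h1 h2 => (hper j h1 h2).testLen_spec.2.2.2.2.1
    case W_small => exact fun j h1 h2 => (hper j h1 h2).testLen_spec.2.2.2.2.2
    case need_eq => exact fun j _ _ => rfl
    case woff_eq => exact fun j _ _ => rfl
    case wpow_eq => exact fun j _ _ => rfl
    case wfp_eq => exact fun j _ _ => rfl
    case len_eq => exact fun j _ (h2 : j ≤ k) => if_neg (by omega)
    case rest_eq => exact fun j _ (h2 : j ≤ k) => if_neg (by omega)
    case pow1_eq => rfl
    case pow2_eq => rfl
    case urec_eq => exact fun j _ _ => rfl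
    case trec_eq => exact fun j _ _ => rfl
    case key_urec => exact hu
    case key_trec => exact ht
    case small_spec =>
      intro t
      rcases hs2 t with h | h
      · exact Or.inl ⟨hs1 t, h⟩
      · exact Or.inr ⟨(if_pos h).ge, if_pos h⟩
    case small_le =>
      intro j h1 h2 h3
      obtain ⟨h4, h5⟩ := hs3 (slot (tkey j)) j h1 h2 rfl h3
      rcases hs2 (slot (tkey j)) with h | h
      · exact ⟨hs1 _, h.1, h.2.1, h.2.2, h5⟩
      · omega
    case good_u => exact hgu
    case good_t => exact hgt
    case good_w => exact hgw

/-! ### The initial memory -/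

/-- Initial values of variables and arrays. -/
def initStore (P : Params) : Store where
  v i := match i with
    | 2 => P.p | 3 => P.base | 4 => 5 * P.l | 5 => P.l | 6 => 2 * P.l | 7 => P.delay | 8 => P.gap
    | 9 => P.k | 10 => P.pow1 | 11 => P.pow2 | 12 => P.mul1 | 13 => P.size1 | 14 => 8 * P.l - 1
    | _ => 0
  a c := match c with
    | 1 => P.mult | 2 => P.size | 3 => P.off | 4 => P.key | 5 => P.small | 6 => P.urec
    | 7 => P.trec | 8 => P.woff | 9 => P.wpow | 10 => P.wfp | 11 => P.per | 12 => P.need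
    | 13 => P.len | 14 => P.rest | _ => fun _ => 0

theorem rep_initStore (P : Params) : Rep P (Setup.initState P.l) (initStore P) := by
  constructor <;> rfl

theorem initStore_lt {P : Params} {w Z T : ℕ} (B : Bdd P w Z T) (TB : TableBdd P w) :
    (∀ i, (initStore P).v i < 2 ^ w) ∧ ∀ c i, (initStore P).a c i < 2 ^ w := by
  have hp := B.p_le
  have h0 := B.one_lt
  have h1 := B.l_lt
  have h2 := B.Z_le
  have h3 := B.T_lt
  constructor
  · intro i
    have := B.base
    have := B.pow1
    have := B.pow2
    have := B.mul1
    have := B.k_lt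
    have := B.size1_lt
    have : P.delay ≤ P.l := Nat.sub_le _ _
    have : P.gap ≤ P.l := Nat.div_le_self _ _
    have : 0 < P.p * P.p := Nat.mul_pos B.p_pos B.p_pos
    simp only [initStore]
    split <;> omega
  · intro c i
    have := B.mult i
    have := TB.size i
    have := TB.off i
    have := TB.key i
    have := B.small i
    have := B.urec i
    have := B.trec i
    have := B.woff i
    have := B.wpow i
    have := B.wfp i
    have := B.per i
    have := B.need i
    have := B.len i
    have := B.rest i
    simp only [initStore]
    split <;> (try dsimp only) <;> omega

/-- Memory contents that represent a store. -/
def Store.toMem (s : Store) (x : ℕ) : ℕ := if x < 64 then s.v x else s.a (x % 64) (x / 64)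

theorem agree_toMem (Z : ℕ) (s : Store) : Agree Z s s.toMem := by
  refine ⟨fun i hi => if_pos (by omega), fun c hc i h1 _ => ?_⟩
  rw [Store.toMem, if_neg (by omega), show (64 * i + c) % 64 = c by omega,
    show (64 * i + c) / 64 = i by omega]

theorem stateBdd_initState {P : Params} {w Z T : ℕ} (B : Bdd P w Z T) (hT : 8 * P.l ≤ T) :
    StateBdd P T (Setup.initState P.l) := by
  have := B.l_pos
  constructor
  case time => simp only [Setup.initState]; omega
  case le_time => simp only [Setup.initState]; omega
  case hash => exact B.p_pos
  case ring => exact fun _ => B.p_pos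
  all_goals exact fun _ => Nat.zero_le _

/-! ### Patterns and texts -/

/-- The characters of a string, increased by one, from the last one to the first. -/
def revFun {σ : ℕ} (s : List (Fin σ)) (i : ℕ) : ℕ := (s.reverse[i]?.map fun c => c.val + 1).getD 0

theorem revFun_pos {σ : ℕ} {s : List (Fin σ)} {i : ℕ} (hi : i < s.length) : 1 ≤ revFun s i := by
  rw [revFun, List.getElem?_eq_getElem (by simpa using hi)]
  simp

theorem revFun_le {σ : ℕ} (s : List (Fin σ)) (i : ℕ) : revFun s i ≤ σ := by
  rw [revFun]
  cases h : s.reverse[i]? with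
  | none => simp
  | some c => simp

theorem period_le_length {α : Type*} (x : List α) : period x ≤ x.length := by
  by_cases h : {p : ℕ | 0 < p ∧ p ≤ x.length ∧ x.HasPeriod p}.Nonempty
  · exact (Nat.sInf_mem h).2.1
  · rw [Set.not_nonempty_iff_eq_empty] at h
    rw [period, h]
    simp

theorem tailFrom_revFun_eq_iff {σ : ℕ} {s : List (Fin σ)} {l i j : ℕ} (hl : l ≤ s.length)
    (hi : i < s.length - l) (hj : j < s.length - l) :
    tailFrom l (revFun s) i = tailFrom l (revFun s) j ↔
      (s.take (s.length - l))[s.length - l - 1 - i]? = (s.take (s.length - l))[s.length - l - 1 - j]? := by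
  have key : ∀ i, i < s.length - l → s.reverse[l + i]? =
      (s.take (s.length - l))[s.length - l - 1 - i]? := by
    intro i hi
    rw [List.getElem?_reverse (by omega), List.getElem?_take_of_lt (by omega)]
    congr 1
    omega
  have hs : ∀ i, i < s.length - l → ∃ c : Fin σ, s.reverse[l + i]? = some c := fun i hi =>
    ⟨_, List.getElem?_eq_getElem (by rw [List.length_reverse]; omega)⟩
  obtain ⟨c, hc⟩ := hs i hi
  obtain ⟨d, hd⟩ := hs j hj
  simp only [tailFrom, revFun, ← key i hi, ← key j hj, hc, hd]
  simp [Fin.ext_iff]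

/-- Reversing a string preserves its periods; discarding the first $l$ reversed values leaves the
reversal of $Q$. -/
theorem leastPeriod_tailFrom {σ : ℕ} {s : List (Fin σ)} {l : ℕ} (hs : 2 * l ≤ s.length)
    (hl : 0 < l) (hp : period (s.take (s.length - l)) < l) :
    LeastPeriod (tailFrom l (revFun s)) (s.length - l) l (period (s.take (s.length - l))) := by
  set Q := s.take (s.length - l) with hQ
  have hlen : Q.length = s.length - l := by
    rw [hQ, List.length_take]
    omega
  have hmem : period Q ∈ {p : ℕ | 0 < p ∧ p ≤ Q.length ∧ Q.HasPeriod p} := by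
    refine Nat.sInf_mem ⟨Q.length, ?_, le_rfl, List.hasPeriod_of_length_le _ _ le_rfl⟩
    omega
  obtain ⟨h1, h2, h3⟩ := hmem
  refine ⟨h1, hp, by omega, fun i hi => ?_, fun d hd H => ?_⟩
  · rw [tailFrom_revFun_eq_iff (by omega) (by omega) (by omega)]
    rw [List.hasPeriod_iff_getElem?] at h3
    have := h3 (s.length - l - 1 - (i + period Q)) (by omega)
    rw [show s.length - l - 1 - (i + period Q) + period Q = s.length - l - 1 - i by omega] at this
    exact this.symm
  · by_contra hlt
    refine hlt (Nat.sInf_le ⟨hd, by omega, List.hasPeriod_iff_getElem?.2 fun i hi => ?_⟩)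
    rw [hlen] at hi
    have := H (s.length - l - 1 - (i + d)) (by omega)
    rw [tailFrom_revFun_eq_iff (by omega) (by omega) (by omega),
      show s.length - l - 1 - (s.length - l - 1 - (i + d)) = i + d by omega,
      show s.length - l - 1 - (s.length - l - 1 - (i + d) + d) = i by omega] at this
    exact this.symm

/-- The text, with zeros around it, starting at position `8 * l`. -/
def textFun {σ : ℕ} (l : ℕ) (text : List (Fin σ)) (z : ℤ) : ℕ :=
  if z < 8 * l then 0 else (text[(z - 8 * l).toNat]?.map fun c => c.val + 1).getD 0

theorem textFun_le {σ : ℕ} (l : ℕ) (text : List (Fin σ)) (z : ℤ) : textFun l text z ≤ σ := by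
  rw [textFun]
  split_ifs
  · omega
  · cases h : text[(z - 8 * l).toNat]? with
    | none => simp
    | some c => simp

/-- Where a string would stick out of the text, it meets padding zeros, which differ from all
shifted characters. -/
theorem occ_textFun_iff {σ : ℕ} {l : ℕ} {text s : List (Fin σ)} {i : ℕ} (hi : i < text.length) :
    Occ (textFun l text) (revFun s) s.length (8 * l + i : ℕ) ↔ s <:+ text.take (i + 1) := by
  rw [← List.reverse_prefix, List.prefix_iff_getElem?]
  have hlen : (text.take (i + 1)).length = i + 1 := by
    rw [List.length_take]
    omega
  have key : ∀ t, t < s.length → (textFun l text ((8 * l + i : ℕ) - t) = revFun s t ↔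
      (text.take (i + 1)).reverse[t]? = s.reverse[t]?) := by
    intro t ht
    obtain ⟨c, hc⟩ : ∃ c : Fin σ, s.reverse[t]? = some c :=
      ⟨_, List.getElem?_eq_getElem (by simpa using ht)⟩
    by_cases hti : t ≤ i
    · have e1 : (text.take (i + 1)).reverse[t]? = text[i - t]? := by
        rw [List.getElem?_reverse (by omega), List.getElem?_take_of_lt (by omega), hlen]
        congr 1
      obtain ⟨d, hd⟩ : ∃ d : Fin σ, text[i - t]? = some d :=
        ⟨_, List.getElem?_eq_getElem (by omega)⟩
      rw [textFun, if_neg (by omega), show (((8 * l + i : ℕ) : ℤ) - t - 8 * l).toNat = i - t by omega,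
        revFun, e1, hc, hd]
      simp [Fin.ext_iff]
    · rw [textFun, if_pos (by omega), revFun, hc, List.getElem?_eq_none (by simp; omega)]
      simp
  constructor
  · intro h t ht
    have ht' : t < s.length := by simpa using ht
    rw [(key t ht').1 (h t ht'), List.getElem?_eq_getElem ht]
  · intro h t ht
    have ht' : t < s.reverse.length := by simpa using ht
    rw [key t ht, h t ht', List.getElem?_eq_getElem ht']


/-! ### Numerical bounds and enumeration of the dictionary. -/

theorem two_le_rlog {m : ℕ} (hm : 4 ≤ m) : 2 ≤ rlog m := by
  have h1 : (2 : ℝ) ≤ Real.logb 2 m := by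
    rw [Real.le_logb_iff_rpow_le (by norm_num) (by positivity)]
    norm_num
    exact hm
  have h2 : (2 : ℤ) ≤ round (Real.logb 2 (m : ℝ)) := by
    rw [round_eq, Int.le_floor]
    push_cast
    linarith
  rw [rlog]
  omega

/-- The three fingerprint comparisons made for a pattern. -/
def testString (l : ℕ) (pat : ℕ → ℕ → ℕ) (e : Fin 3) (j : ℕ) : ℕ → ℕ :=
  if e = 1 then pat j else tailFrom l (pat j)

/-- The lengths of the strings in `testString`. -/
def testStringLen (l : ℕ) (N per : ℕ → ℕ) (e : Fin 3) (j : ℕ) : ℕ :=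
  if e = 0 then l else if e = 1 then 2 * l else testLen l (N j) (per j)

/-- Indices out of range yield a default pattern, so that length bounds hold for every index. -/
theorem exists_enum {α : Type*} (s : Finset (List α)) (hs : s.Nonempty) :
    ∃ f : ℕ → List α, (∀ j, f j ∈ s) ∧ ∀ x ∈ s, ∃ j, 1 ≤ j ∧ j ≤ s.card ∧ f j = x := by
  obtain ⟨x₀, hx₀⟩ := hs
  refine ⟨fun j => (s.toList[j - 1]?).getD x₀, fun j => ?_, fun x hx => ?_⟩
  · dsimp only
    cases h : s.toList[j - 1]? with
    | none => exact hx₀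
    | some y => exact Finset.mem_toList.1 (List.mem_of_getElem? h)
  · obtain ⟨i, hi, rfl⟩ := List.getElem_of_mem (Finset.mem_toList.2 hx)
    refine ⟨i + 1, by omega, by simpa using hi, ?_⟩
    simp only [Nat.add_sub_cancel]
    rw [List.getElem?_eq_getElem hi, Option.getD_some]

theorem outputs_eq_expected {σ : ℕ} {patterns : Finset (List (Fin σ))} {text : List (Fin σ)}
    {Pt : ℕ → List (Fin σ)} {P : Params} {T : ℕ} {N W : ℕ → ℕ}
    (hPt : ∀ j, Pt j ∈ patterns)
    (hPs : ∀ x ∈ patterns, ∃ j, 1 ≤ j ∧ j ≤ P.k ∧ Pt j = x) (hN : ∀ j, P.l + N j = (Pt j).length)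
    (hT : 8 * P.l + text.length ≤ T)
    (S : Setup P (textFun P.l text) T (fun j => revFun (Pt j)) N W) :
    P.outputs (Setup.initState P.l) (text.map Fin.val) = expected patterns text := by
  have hl := S.two_le_l
  rw [S.outputs_eq (text.map Fin.val) S.inv_initState (by omega)
    (by rw [List.length_map]; omega) ?_, expected, List.length_map]
  · refine List.map_congr_left fun i hi => ?_
    rw [List.mem_range] at hi
    rw [decide_eq_decide, show 8 * P.l - 1 + 1 + i = 8 * P.l + i by omega]
    constructor
    · rintro ⟨j, -, -, h⟩
      rw [hN, occ_textFun_iff hi] at h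
      exact ⟨Pt j, hPt j, h⟩
    · rintro ⟨x, hx, h⟩
      obtain ⟨j, h1, h2, rfl⟩ := hPs x hx
      exact ⟨j, h1, h2, by rw [hN, occ_textFun_iff hi]; exact h⟩
  · intro i hi
    rw [List.length_map] at hi
    rw [textFun, if_neg (by omega),
      show (((8 * P.l - 1 : ℕ) : ℤ) + 1 + i - 8 * P.l).toNat = i by omega,
      List.getElem?_eq_getElem hi]
    simp

/-- Bertrand's postulate above $x^4$ gives $p^2 + p \le 6x^8 \le x^9$; this is the source of the
exponent 9. -/
theorem exists_prime_bounds {n m σ w : ℕ} (h : 6 ≤ n + m + σ) (hw : (n + m + σ) ^ 9 ≤ 2 ^ w) :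
    ∃ p, p.Prime ∧ (n + m + σ) ^ 4 < p ∧ p * p + p ≤ 2 ^ w ∧ 384 * (n + m + σ) ≤ 2 ^ w := by
  set x := n + m + σ
  obtain ⟨p, hp, h1, h2⟩ := Nat.exists_prime_lt_and_le_two_mul (x ^ 4) (by positivity)
  refine ⟨p, hp, h1, le_trans ?_ hw, le_trans ?_ hw⟩
  · calc p * p + p ≤ (2 * x ^ 4) * (2 * x ^ 4) + 2 * x ^ 4 := by gcongr
      _ = 4 * x ^ 8 + 2 * x ^ 4 := by ring
      _ ≤ 4 * x ^ 8 + 2 * x ^ 8 := by gcongr <;> omega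
      _ = 6 * x ^ 8 := by ring
      _ ≤ x * x ^ 8 := by gcongr
      _ = x ^ 9 := by ring
  · calc 384 * x ≤ 6 ^ 8 * x := by gcongr; norm_num
      _ ≤ x ^ 8 * x := by gcongr
      _ = x ^ 9 := by ring

end StreamMatch

/-! ### Assembly of the main theorem. -/

theorem mainTheorem3 :
    -- one program and absolute constants: `C` for time, space and error, `c` for the word length
    ∃ (prog : List StreamMatch.Instr) (C c : ℕ),
      ∀ (n m σ w : ℕ) (patterns : Finset (List (Fin σ))),
        1 ≤ n →
        (n + m + σ) ^ c ≤ 2 ^ w →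
        patterns.Nonempty →
        (∀ P ∈ patterns, P.length ≤ m) →
        (∀ P ∈ patterns, 2 * (patterns.card * StreamMatch.rlog m) ≤ P.length) →
        (∀ P ∈ patterns,
          StreamMatch.period (P.take (P.length - patterns.card * StreamMatch.rlog m))
            < patterns.card * StreamMatch.rlog m) →
        -- `S` words of memory, preloaded depending on the dictionary and a uniform seed
        ∃ (S N : ℕ) (init : Fin N → ℕ → ℕ),
          2 ≤ S ∧ S ≤ C * (patterns.card * StreamMatch.rlog m) ∧ 0 < N ∧
          (∀ seed a, init seed a < 2 ^ w) ∧
          ∀ text : List (Fin σ), text.length = n →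
            -- every arrival takes at most `C` steps, whatever the seed
            (∀ seed, (StreamMatch.stream prog w S C (init seed) (text.map Fin.val)).isSome) ∧
            -- all answers are correct, except with probability at most `C / n`
            (Nat.card {seed : Fin N //
                StreamMatch.stream prog w S C (init seed) (text.map Fin.val)
                  ≠ some (StreamMatch.expected patterns text)} : ℝ) / N ≤ C / n := by
  open StreamMatch in
  -- The program length bounds the time, $384 = 64 \cdot 6$ is for the space, and the error needs
  -- only the constant 9.
  refine ⟨matchCmd.prog, matchCmd.prog.length + 384, 9, ?_⟩
  intro n m σ w patterns hn hw hne hlen hmin hper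
  obtain ⟨Pt, hPt, hPs⟩ := exists_enum patterns hne
  have hk0 : 1 ≤ patterns.card := hne.card_pos
  -- This yields $k \le l/2$, on which the rotation depends; $m \ge 4$ will follow from $2 \le l$
  -- and $2l \le m$.
  have hkl : 4 ≤ m → 2 * patterns.card ≤ patterns.card * rlog m := fun h => by
    rw [mul_comm]
    exact Nat.mul_le_mul_left _ (two_le_rlog h)
  generalize hk : patterns.card = k at *
  generalize hl : k * rlog m = l at *
  have hlen' : ∀ j, (Pt j).length ≤ m := fun j => hlen _ (hPt j)
  have hmin' : ∀ j, 2 * l ≤ (Pt j).length := fun j => hmin _ (hPt j)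
  have hl0 : 0 < l := (Nat.zero_le _).trans_lt (hper _ (hPt 0))
  have hLP : ∀ j, LeastPeriod (tailFrom l (revFun (Pt j))) ((Pt j).length - l) l
      (period ((Pt j).take ((Pt j).length - l))) := fun j =>
    leastPeriod_tailFrom (hmin' j) hl0 (hper _ (hPt j))
  have hl2 : 2 ≤ l := by
    have := (hLP 0).pos
    have := (hLP 0).lt
    omega
  have hm4 : 2 * l ≤ m := (hmin' 0).trans (hlen' 0)
  have hkl' := hkl (by omega)
  have hσ : 1 ≤ σ := by
    obtain ⟨c, -⟩ := List.exists_mem_of_length_pos (show 0 < (Pt 0).length by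
      have := hmin' 0
      omega)
    exact c.pos
  obtain ⟨p, hp, hpx, hpw, hxw⟩ := exists_prime_bounds (by omega) hw
  have : Fact p.Prime := ⟨hp⟩
  have hpx1 : n + m + σ ≤ p := (Nat.le_self_pow (by norm_num) _).trans hpx.le
  set N : ℕ → ℕ := fun j => (Pt j).length - l with hN
  set per : ℕ → ℕ := fun j => period ((Pt j).take ((Pt j).length - l)) with hperd
  have hex : ∀ seed : Fin p, _ := fun seed =>
    exists_params (p := p) (base := seed) (l := l) (k := k) (w := w) (T := 8 * l + n) (m := m)
      (pat := fun j => revFun (Pt j)) (N := N) (per := per) seed.2 hk0 (by omega)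
      (fun j _ _ => hLP j)
      (fun j _ _ i hi => revFun_pos (by have := hmin' j; simp only [hN] at hi; omega))
      (fun j => (Nat.sub_le _ _).trans (hlen' j))
      (fun j => (period_le_length _).trans
        (((List.length_take_le _ _).trans (Nat.sub_le _ _)).trans (hlen' j)))
      hpw (by omega) (by omega)
  choose P hPp hPb hPl hPk B TB hS using hex
  refine ⟨64 * (6 * l), p, fun seed => (initStore (P seed)).toMem, by omega, ?_, hp.pos, ?_, ?_⟩
  · calc 64 * (6 * l) = 384 * l := by ring
      _ ≤ _ := by gcongr; omega
  · intro seed a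
    simp only [Store.toMem]
    split_ifs
    · exact (initStore_lt (B seed) (TB seed)).1 _
    · exact (initStore_lt (B seed) (TB seed)).2 _ _
  intro text htext
  have hstream : ∀ seed, stream matchCmd.prog w (64 * (6 * l)) (matchCmd.prog.length + 384)
      (initStore (P seed)).toMem (text.map Fin.val) =
      some ((P seed).outputs (Setup.initState (P seed).l) (text.map Fin.val)) := by
    intro seed
    refine stream_eq (B seed) (by omega) _ (rep_initStore _)
      (stateBdd_initState (B seed) (by rw [hPl]; omega)) (agree_toMem _ _) ?_ ?_
    · intro a ha
      obtain ⟨c, -, rfl⟩ := List.mem_map.1 ha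
      have := c.2
      rw [hPp]
      omega
    · rw [List.length_map, hPl, htext]
      simp only [Setup.initState]
      omega
  refine ⟨fun seed => by rw [hstream]; rfl, ?_⟩
  -- All comparisons that could go wrong: kind of test, pattern, position.
  set I : Finset (Fin 3 × ℕ × ℕ) :=
    Finset.univ ×ˢ Finset.Icc 1 k ×ˢ Finset.Ico (7 * l) (8 * l + n) with hI
  have hcoll := card_exists_collision_le (p := p) I (fun i => window (textFun l text) (i.2.2 : ℕ))
    (fun i => testString l (fun j => revFun (Pt j)) i.1 i.2.1)
    (fun i => testStringLen l N per i.1 i.2.1) (B := 3 * l)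
    (by
      intro i _
      have := (hLP i.2.1).testLen_spec
      simp only [testStringLen]
      split_ifs
      · omega
      · omega
      · exact this.2.2.1.le)
    (fun i _ t _ => (textFun_le _ _ _).trans_lt (by omega))
    (fun i _ t _ => by
      simp only [testString]
      split_ifs <;> exact (revFun_le _ _).trans_lt (by omega))
  have hcard : I.card = 3 * k * (l + n) := by
    rw [hI, Finset.card_product, Finset.card_product, Finset.card_univ, Fintype.card_fin,
      Nat.card_Icc, Nat.card_Ico, Nat.add_sub_cancel, show 8 * l + n - 7 * l = l + n by omega]
    ring
  have hsub : Nat.card {seed : Fin p // stream matchCmd.prog w (64 * (6 * l))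
      (matchCmd.prog.length + 384) (initStore (P seed)).toMem (text.map Fin.val) ≠
        some (expected patterns text)} ≤ 3 * k * (l + n) * (3 * l) := by
    rw [← hcard]
    refine le_trans (Nat.card_le_card_of_injective (Subtype.map id fun seed hbad => ?_)
      (Subtype.map_injective _ Function.injective_id)) hcoll
    by_contra hgood
    refine hbad ?_
    have hocc : ∀ e j, 1 ≤ j → j ≤ k → ∀ z : ℕ, 7 * l ≤ z → z < 8 * l + n →
        fp p ((seed : ℕ) : ZMod p) (window (textFun l text) z) (testStringLen l N per e j) =
          fp p ((seed : ℕ) : ZMod p) (testString l (fun j => revFun (Pt j)) e j)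
            (testStringLen l N per e j) →
        Occ (textFun l text) (testString l (fun j => revFun (Pt j)) e j)
          (testStringLen l N per e j) z := by
      intro e j h1 h2 z h3 h4 heq t ht
      by_contra hne
      refine hgood ⟨(e, j, z), ?_, ⟨t, ht, hne⟩, heq⟩
      simp only [hI, Finset.mem_product, Finset.mem_univ, Finset.mem_Icc, Finset.mem_Ico]
      exact ⟨trivial, ⟨h1, h2⟩, h3, h4⟩
    have hset := hS seed (textFun l text) (fun z hz => if_pos hz)
      (hocc 0) (hocc 1) (hocc 2)
    rw [hstream, outputs_eq_expected (T := 8 * l + n) (N := N) hPt ?_ ?_ ?_ (by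
      rw [hPl]
      exact hset)]
    · rw [hPk]
      exact hPs
    · intro j
      have := hmin' j
      rw [hPl]
      simp only [hN]
      omega
    · rw [hPl, htext]
  have hp0 : (0 : ℝ) < p := by exact_mod_cast hp.pos
  have hn0 : (0 : ℝ) < n := by exact_mod_cast hn
  rw [div_le_div_iff₀ hp0 hn0]
  norm_cast
  -- Each of the factors $k$, $l+n$, $l$, $n$ is at most $n+m+\sigma$, whose fourth power is below
  -- $p$.
  calc _ ≤ 3 * k * (l + n) * (3 * l) * n := Nat.mul_le_mul_right _ hsub
    _ = 9 * (k * (l + n) * l * n) := by ring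
    _ ≤ 9 * ((n + m + σ) * (n + m + σ) * (n + m + σ) * (n + m + σ)) :=
        Nat.mul_le_mul_left _ (Nat.mul_le_mul (Nat.mul_le_mul (Nat.mul_le_mul (by omega) (by omega))
          (by omega)) (by omega))
    _ = 9 * (n + m + σ) ^ 4 := by ring
    _ ≤ _ := by gcongr; omega
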